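/- Let $k$ be an algebraically closed field and $\Lambda$ a gentle $k$-algebra, i.e. a finite-dimensional algebra Morita equivalent to $kQ/I$, where $Q$ is a finite quiver and $I$ is an admissible ideal generated by paths of length two such that: at most two arrows start and at most two arrows end at each vertex; for each arrow $a$ there is at most one arrow $b$ with $s(b)=e(a)$ and $ba\notin I$, at most one $b$ with $s(b)=e(a)$ and $ba\in I$, at most one arrow $c$ with $e(c)=s(a)$ and $ac\notin I$, and at most one $c$ with $e(c)=s(a)$ and $ac\in I$. Paths are read from right to left, $P(x)$ is the indecomposable projective left $\Lambda$-module corresponding to the left module $(kQ/I)e_x$, and a path $p$ from $x$ to $y$ gives a map $P(y)\to P(x)$ (right multiplication); maps are composed from left to right. A homotopy letter is a nontrivial path $p\notin I$ (direct letter) or its formal inverse $\bar p$ (inverse letter). A homotopy string is a (finite, or left, right or two-sided infinite) reduced walk $\tau=\cdots\tau_{i+1}\tau_i\cdots$ in arrows and inverse arrows, written in its decomposition into homotopy letters: consecutive direct letters $p\,q$ satisfy $pq\in I$, consecutive inverse letters $\bar p\,\bar q$ satisfy $qp\in I$; trivial strings at vertices are allowed, and an infinite string is, towards the left, eventually a sequence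 of direct letters that are single arrows, and, towards the right, eventually a sequence of inverse letters that are single inverse arrows. A homotopy band is a word of letters $\sigma=\sigma_n\cdots\sigma_1$, $n\geq 1$, such that $\sigma\sigma$ is a homotopy string with letters $\sigma_n,\dots,\sigma_1,\sigma_n,\dots,\sigma_1$, $\sigma$ is not a proper power, and $\sigma$ has as many direct as inverse letters. The unfolded diagram of a string has one vertex for each vertex of the walk between (or at the ends of) its letters; a direct letter is an arrow from left to right and an inverse letter an arrow from right to left, and arrows raise the cohomological degree by one. The string complex $P^\bullet_\tau$ has as its degree $n$ term the direct sum of the $P(x)$ over the vertices of degree $n$, and its differential has the letters as components. The band complex $B^\bullet_{\sigma,\lambda}$, $\lambda\in k^*$, is defined in the same way, with the two ends of $\sigma$ identified, and with one chosen direct letter multiplied by $\lambda$. Let $\sigma=\beta\sigma_L\rho\sigma_R\alpha$ be a homotopy band and $\tau=\delta\tau_L\rho\tau_R\gamma$ a (possibly infinite) homotopy string, decomposed into words of letters, where $\sigma_L,\sigma_R$ are letters; $\tau_L,\tau_R$ are letters or empty, with $\delta=\emptyset$ if $\tau_L=\emptyset$ and $\gamma=\emptyset$ if $\tau_R=\emptyset$;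 and the (possibly trivial) word $\rho$ is a maximal common substring, lying in the same cohomological degrees in both. A graph map $f^\bullet\colon B^\bullet_{\sigma,\lambda}\to P^\bullet_\tau$ is given by such data satisfying one of the right endpoint conditions * (RG1) $\sigma_R,\tau_R$ are direct and $\tau_R=\sigma_Rf_R$ for a nontrivial path $f_R$; * (RG2) $\sigma_R,\tau_R$ are inverse and $\bar\sigma_R=f_R\bar\tau_R$ for a nontrivial path $f_R$; * (RG3) $\sigma_R$ is direct, and $\tau_R$ is inverse or empty, and one of the left endpoint conditions (LG1)–(LG3), which are the right endpoint conditions for $\bar\sigma_L,\bar\tau_L,f_L$ in place of $\sigma_R,\tau_R,f_R$. Its components are identities along $\rho$ and, if they exist, $f_L$ and $f_R$ at the outer vertices of $\sigma_L,\tau_L$ and of $\sigma_R,\tau_R$; if the letter carrying $\lambda$ lies in $\sigma_L\rho\sigma_R$, the components to the right of this letter are multiplied by $\lambda^{-1}$. The graph map is compatibly oriented if either $\rho$ is nontrivial, or $f_L$ or $f_R$ exists, or both of the following hold: $\tau_L\bar\sigma_L\notin I$ (as a path) unless $\tau_L=\emptyset$, and $\bar\tau_R\sigma_R\notin I$ unless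 $\tau_R=\emptyset$. **Proposition.** Let $f^\bullet\colon B^\bullet_{\sigma,\lambda}\to P^\bullet_\tau$ be a compatibly oriented graph map. Then the mapping cone $M^\bullet_{f^\bullet}$ is isomorphic, in the homotopy category of complexes of $\Lambda$-modules (equivalently, in its full subcategory $\mathsf K^{b,-}(\mathrm{proj}\,\Lambda)\simeq\mathsf D^b(\Lambda)$), to the string complex $P^\bullet_c$ of the homotopy string $$c=\begin{cases}\delta\tau_L\bar\sigma_L\bar\beta\bar\alpha\bar\sigma_R\tau_R\gamma & \text{if }\tau_L\neq\emptyset\text{ and }\tau_R\neq\emptyset,\\ \bar\beta\bar\alpha\bar\sigma_R\tau_R\gamma & \text{if }\tau_L=\emptyset\text{ and }\tau_R\neq\emptyset,\\ \delta\tau_L\bar\sigma_L\bar\beta\bar\alpha & \text{if }\tau_L\neq\emptyset\text{ and }\tau_R=\emptyset,\\ \bar\beta\bar\alpha & \text{if }\tau_L=\tau_R=\emptyset,\end{cases}$$ where the walks $\tau_L\bar\sigma_L$ and $\bar\sigma_R\tau_R$ are reduced to single letters: $\tau_L\bar\sigma_L$ is $\bar f_L$ under (LG1), (LG2) and the direct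 letter given by the composed path under (LG3); $\bar\sigma_R\tau_R$ is $f_R$ under (RG1), (RG2) and the inverse of the path $\bar\tau_R\sigma_R$ under (RG3). The grading of $P^\bullet_c$ is the one in which the vertex of $c$ between $\bar\beta$ and $\bar\alpha$ lies in degree one less than the corresponding vertex of $\sigma$ (the common end of $\sigma$). -/

import Mathlib

open CategoryTheory

universe u

noncomputable section

namespace Gentle

/-! ### Bound quivers, gentle algebras -/

section BoundQuiver

variable {Q : Type u} [Quiver.{u} Q]

/-- A list `a_n, …, a_1` of arrows is a path `a_n ⋯ a_1` (read from right to left, so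
`s(a_{i+1}) = e(a_i)`) which is not in the ideal generated by the length two paths `b a` with
`R b a`, i.e. none of its length two subpaths is one of the relations. -/
def IsNonzeroPath (R : Quiver.Total Q → Quiver.Total Q → Prop) (p : List (Quiver.Total Q)) : Prop :=
  p.IsChain (fun b a => b.left = a.right ∧ ¬ R b a)

/-- `(Q, I)` is a gentle bound quiver, where `I` is the ideal generated by the paths `b a` of
length two (first `a`, then `b`) with `R b a`. -/
structure IsGentle (R : Quiver.Total Q → Quiver.Total Q → Prop) : Prop where
  /-- the relations are paths of length two -/
  comp : ∀ b a, R b a → b.left = a.right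
  /-- the ideal is admissible: all sufficiently long paths lie in it -/
  admissible : ∃ N : ℕ, ∀ p : List (Quiver.Total Q), IsNonzeroPath R p → p.length < N
  starting : ∀ x : Q, {a : Quiver.Total Q | a.left = x}.encard ≤ 2
  ending : ∀ x : Q, {a : Quiver.Total Q | a.right = x}.encard ≤ 2
  nonrel_left : ∀ a : Quiver.Total Q, {b | b.left = a.right ∧ ¬ R b a}.Subsingleton
  nonrel_right : ∀ a : Quiver.Total Q, {c | a.left = c.right ∧ ¬ R a c}.Subsingleton
  rel_left : ∀ a : Quiver.Total Q, {b | R b a}.Subsingleton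
  rel_right : ∀ a : Quiver.Total Q, {c | R a c}.Subsingleton

variable (k : Type u) [Field k] [Fintype Q]

/-- Relations presenting `kQ/I` on the generators `e_x` (`x` a vertex) and `a` (an arrow):
the path algebra relations (products of paths are read from right to left), together with
`b a = 0` for `R b a`. -/
inductive AlgRel (R : Quiver.Total Q → Quiver.Total Q → Prop) :
    FreeAlgebra k (Q ⊕ Quiver.Total Q) → FreeAlgebra k (Q ⊕ Quiver.Total Q) → Prop
  | idem (x : Q) : AlgRel R
      (FreeAlgebra.ι k (Sum.inl x) * FreeAlgebra.ι k (Sum.inl x)) (FreeAlgebra.ι k (Sum.inl x))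
  | orth (x y : Q) (h : x ≠ y) : AlgRel R
      (FreeAlgebra.ι k (Sum.inl x) * FreeAlgebra.ι k (Sum.inl y)) 0
  | one : AlgRel R (∑ x : Q, FreeAlgebra.ι k (Sum.inl x)) 1
  | target (a : Quiver.Total Q) : AlgRel R
      (FreeAlgebra.ι k (Sum.inl a.right) * FreeAlgebra.ι k (Sum.inr a)) (FreeAlgebra.ι k (Sum.inr a))
  | source (a : Quiver.Total Q) : AlgRel R
      (FreeAlgebra.ι k (Sum.inr a) * FreeAlgebra.ι k (Sum.inl a.left)) (FreeAlgebra.ι k (Sum.inr a))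
  | rel (b a : Quiver.Total Q) (h : R b a) : AlgRel R
      (FreeAlgebra.ι k (Sum.inr b) * FreeAlgebra.ι k (Sum.inr a)) 0

/-- The bound quiver algebra `kQ/I`. -/
abbrev BoundAlg (R : Quiver.Total Q → Quiver.Total Q → Prop) : Type u := RingQuot (AlgRel k R)

variable (R : Quiver.Total Q → Quiver.Total Q → Prop)

/-- The idempotent of a vertex. -/
def vert (x : Q) : BoundAlg k R :=
  RingQuot.mkAlgHom k (AlgRel k R) (FreeAlgebra.ι k (Sum.inl x))

/-- The class of an arrow. -/
def arr (a : Quiver.Total Q) : BoundAlg k R :=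
  RingQuot.mkAlgHom k (AlgRel k R) (FreeAlgebra.ι k (Sum.inr a))

end BoundQuiver

/-! ### Unfolded diagrams and their complexes -/

section Diagrams

variable {A : Type u} [Ring A]

/-- The left ideal `A e`; for `A = kQ/I` and `e = e_x` it is the indecomposable projective `P(x)`. -/
abbrev Proj (e : A) : Submodule A A := Submodule.span A {e}

/-- Right multiplication `q ↦ q z e'` (by the component in `e A e'` of `z`), as a map
`A e → A e'`. -/
def rmul (z e e' : A) : Proj e →ₗ[A] Proj e' :=
  (LinearMap.toSpanSingleton A A (z * e')).restrict
    (fun q _ => by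
      rw [LinearMap.toSpanSingleton_apply, smul_eq_mul, ← mul_assoc]
      exact Submodule.smul_mem _ _ (Submodule.mem_span_singleton_self _))

theorem rmul_comp (z w e e' e'' : A) (h : z * e' * w = 0) (q : Proj e) :
    rmul w e' e'' (rmul z e e' q) = 0 := by
  ext
  simp only [rmul, LinearMap.restrict_apply,
    LinearMap.toSpanSingleton_apply, smul_eq_mul, ZeroMemClass.coe_zero]
  rw [mul_assoc, ← mul_assoc _ w, h, zero_mul, mul_zero]

variable (A) in
/-- An unfolded diagram: vertices (the elements `v` of `V` with `mem v`) carrying an idempotent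
`idem v` of the algebra (so the projective `A (idem v)`) and a cohomological degree `deg v`, and for
every `v` the list `out v` of the arrows leaving `v`; an arrow is recorded by its target and its
label. -/
structure Diagram where
  V : Type
  mem : V → Prop
  idem : V → A
  deg : V → ℤ
  out : V → List (V × A)

namespace Diagram

/-- The vertices of degree `n`. -/
abbrev Vtx (D : Diagram A) (n : ℤ) : Type := {v : D.V // D.mem v ∧ D.deg v = n}

/-- The term in degree `n`: the direct sum of the projectives at the vertices of degree `n`. -/
abbrev X (D : Diagram A) (n : ℤ) : Type u := DirectSum (D.Vtx n) (fun v => Proj (D.idem v.1))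

open Classical in
/-- The inclusion of the summand at `w`, or zero if `w` is not a vertex of degree `n`. -/
def incl (D : Diagram A) (n : ℤ) (w : D.V) : Proj (D.idem w) →ₗ[A] D.X n :=
  if h : D.mem w ∧ D.deg w = n then
    DirectSum.lof A (D.Vtx n) (fun w => Proj (D.idem w.1)) ⟨w, h⟩
  else 0

/-- Right multiplication by `a`, from the projective at the vertex `v` of `D` to the summand at the
vertex `w` of `D'` in degree `n'`. -/
def arrowMap (D D' : Diagram A) (n' : ℤ) (v : D.V) (w : D'.V) (a : A) :
    Proj (D.idem v) →ₗ[A] D'.X n' :=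
  (D'.incl n' w) ∘ₗ (rmul a (D.idem v) (D'.idem w))

open Classical in
/-- The map `D.X n → D'.X n'` whose component from the summand at `v` to the summand at `w` is
right multiplication by the sum of the labels `a` with `(w, a)` in the list `m v`. -/
def matMap (D D' : Diagram A) (m : D.V → List (D'.V × A)) (n n' : ℤ) : D.X n →ₗ[A] D'.X n' :=
  DirectSum.toModule A (D.Vtx n) (D'.X n')
    (fun v => ((m v.1).map (fun wa => arrowMap D D' n' v.1 wa.1 wa.2)).sum)

/-- Any two consecutive arrows of the diagram compose to zero. -/
def SqZero (D : Diagram A) : Prop :=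
  ∀ v w a x b, (w, a) ∈ D.out v → (x, b) ∈ D.out w → a * D.idem w * b = 0

theorem sum_map_apply {M N ι : Type*} [AddCommGroup M] [AddCommGroup N] [Module A M] [Module A N]
    (l : List ι) (g : ι → M →ₗ[A] N) (q : M) : (l.map g).sum q = (l.map (fun i => g i q)).sum := by
  induction l with
  | nil => simp
  | cons a l ih => simp [ih]

theorem matMap_incl (D D' : Diagram A) (m : D.V → List (D'.V × A)) (n n' : ℤ) (v : D.V)
    (h : D.mem v ∧ D.deg v = n) (q : Proj (D.idem v)) :
    matMap D D' m n n' (D.incl n v q) =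
      ((m v).map (fun wa => arrowMap D D' n' v wa.1 wa.2 q)).sum := by
  unfold matMap incl
  rw [dif_pos h, DirectSum.toModule_lof, sum_map_apply]

theorem matMap_sq (D : Diagram A) (h : D.SqZero) (n n' n'' : ℤ) :
    (matMap D D D.out n' n'').comp (matMap D D D.out n n') = 0 := by
  classical
  refine DirectSum.linearMap_ext (R := A) (fun v => LinearMap.ext fun q => ?_)
  have e : DirectSum.lof A (D.Vtx n) (fun w => Proj (D.idem w.1)) v = D.incl n v.1 := by
    rw [incl, dif_pos v.2]
  rw [LinearMap.comp_apply, LinearMap.comp_apply, e, matMap_incl _ _ _ _ _ _ v.2, map_list_sum,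
    List.map_map]
  apply List.sum_eq_zero
  intro y hy
  obtain ⟨⟨w, a⟩, hw, rfl⟩ := List.mem_map.1 hy
  by_cases hm : D.mem w ∧ D.deg w = n'
  · rw [Function.comp_apply, arrowMap, LinearMap.comp_apply]
    rw [matMap_incl _ _ _ _ _ _ hm]
    apply List.sum_eq_zero
    intro z hz
    obtain ⟨⟨x, b⟩, hx, rfl⟩ := List.mem_map.1 hz
    rw [arrowMap, LinearMap.comp_apply, rmul_comp _ _ _ _ _ (h v.1 w a x b hw hx), map_zero]
  · rw [Function.comp_apply, arrowMap, incl, dif_neg hm, LinearMap.zero_comp, LinearMap.zero_apply,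
      map_zero]

/-- The complex of an unfolded diagram. -/
def complex (D : Diagram A) (h : D.SqZero) : CochainComplex (ModuleCat.{u} A) ℤ :=
  CochainComplex.of (fun n => ModuleCat.of A (D.X n))
    (fun n => ModuleCat.ofHom (matMap D D D.out n (n + 1)))
    (fun n => by
      rw [← ModuleCat.ofHom_comp, matMap_sq D h]
      rfl)

end Diagram

end Diagrams

/-! ### Homotopy letters, homotopy strings, homotopy bands -/

section Strings

variable (Q : Type u) [Quiver.{u} Q]

/-- A nontrivial word `p = a_n ⋯ a_1` of arrows, or its formal inverse (if `isInv`). -/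
structure Letter where
  arrows : List (Quiver.Total Q)
  ne : arrows ≠ []
  isInv : Bool

variable {Q}

namespace Letter

/-- The formal inverse. -/
def bar (l : Letter Q) : Letter Q := ⟨l.arrows, l.ne, !l.isInv⟩

/-- The first arrow `a_1` of the underlying path. -/
def firstArrow (l : Letter Q) : Quiver.Total Q := l.arrows.getLast l.ne

/-- The last arrow `a_n` of the underlying path. -/
def lastArrow (l : Letter Q) : Quiver.Total Q := l.arrows.head l.ne

/-- The left vertex of the letter (its end, as words are read from right to left). -/
def lft (l : Letter Q) : Q := if l.isInv then l.firstArrow.left else l.lastArrow.right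

/-- The right vertex of the letter (its start). -/
def rgt (l : Letter Q) : Q := if l.isInv then l.lastArrow.right else l.firstArrow.left

/-- The cohomological degree of the right vertex minus that of the left vertex. -/
def sgn (l : Letter Q) : ℤ := if l.isInv then -1 else 1

/-- The element of the algebra given by the underlying path. -/
def elt {A : Type u} [Ring A] (arr : Quiver.Total Q → A) (l : Letter Q) : A :=
  (l.arrows.map arr).prod

end Letter

variable (R : Quiver.Total Q → Quiver.Total Q → Prop)

/-- `l m` (with `l` on the left) may be two consecutive homotopy letters of a homotopy string:
the walk `l m` is reduced, and it is cut into homotopy letters exactly between `l` and `m`. -/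
def Follows (l m : Letter Q) : Prop :=
  l.rgt = m.lft ∧
    match l.isInv, m.isInv with
    | false, false => R l.firstArrow m.lastArrow
    | true, true => R m.firstArrow l.lastArrow
    | false, true => l.firstArrow ≠ m.firstArrow
    | true, false => l.lastArrow ≠ m.lastArrow

/-- A possibly infinite sequence of letters `⋯ l_2 l_1 · r_1 r_2 ⋯` with a marked vertex `base` in
cohomological degree `baseDeg`. Both halves are recorded as seen from the base vertex: the right
half as `r_1, r_2, …`, the left half by the inverted letters `l̄_1, l̄_2, …`. -/
structure StringData (Q : Type u) [Quiver.{u} Q] where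
  base : Q
  baseDeg : ℤ
  left : Stream'.Seq (Letter Q)
  right : Stream'.Seq (Letter Q)

namespace StringData

variable (S : StringData Q)

/-- The letters numbered from left to right: the vertices are numbered by integers, with the base
vertex `0`, and letter `i` joins the vertices `i` and `i + 1`. -/
def letterAt : ℤ → Option (Letter Q)
  | Int.ofNat n => S.right.get? n
  | Int.negSucc n => (S.left.get? n).map Letter.bar

/-- The integers that number a vertex. -/
def IsVertex : ℤ → Prop
  | Int.ofNat 0 => True
  | Int.ofNat (n + 1) => (S.right.get? n).isSome
  | Int.negSucc n => (S.left.get? n).isSome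

/-- The vertex of the quiver at the vertex `i`. -/
def vtx (i : ℤ) : Q :=
  match S.letterAt i with
  | some l => l.lft
  | none =>
    match S.letterAt (i - 1) with
    | some l => l.rgt
    | none => S.base

/-- The cohomological degree of the vertex `i`. -/
def deg : ℤ → ℤ
  | Int.ofNat n => S.baseDeg + ∑ j ∈ Finset.range n, ((S.right.get? j).map Letter.sgn).getD 0
  | Int.negSucc n =>
    S.baseDeg + ∑ j ∈ Finset.range (n + 1), ((S.left.get? j).map Letter.sgn).getD 0

/-- A half of a string, read away from the base vertex, is finite or is eventually an inverse
antipath (each letter is a single inverse arrow). -/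
def EventuallyAntipath (s : Stream'.Seq (Letter Q)) : Prop :=
  ∃ N : ℕ, ∀ n, N ≤ n → ∀ l, s.get? n = some l → l.isInv = true ∧ l.arrows.length = 1

/-- The data form a finite or infinite homotopy string, decomposed into its homotopy letters. -/
structure IsHomotopyString : Prop where
  letter : ∀ i l, S.letterAt i = some l → IsNonzeroPath R l.arrows
  follows : ∀ i l m, S.letterAt i = some l → S.letterAt (i + 1) = some m → Follows R l m
  base_right : ∀ l, S.letterAt 0 = some l → l.lft = S.base
  base_left : ∀ l, S.letterAt (-1) = some l → l.rgt = S.base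
  antipath_left : EventuallyAntipath S.left
  antipath_right : EventuallyAntipath S.right

end StringData

/-- A word of letters `σ = σ_n ⋯ σ_1` (listed from left to right) is a homotopy band: `σσ` is a
homotopy string with the evident homotopy letters (in particular `σ` is closed, and its first and
last letters are compatible), `σ` is not a proper power, and it has as many direct as inverse
homotopy letters. -/
structure IsHomotopyBand (σ : List (Letter Q)) : Prop where
  ne : σ ≠ []
  letter : ∀ l ∈ σ, IsNonzeroPath R l.arrows
  follows : (σ ++ σ).IsChain (Follows R)
  primitive : ∀ (w : List (Letter Q)) (m : ℕ), 1 < m → σ ≠ (List.replicate m w).flatten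
  balanced : σ.countP (fun l => l.isInv) = σ.countP (fun l => !l.isInv)

theorem IsHomotopyBand.follows_cyclic {σ : List (Letter Q)} (h : IsHomotopyBand R σ) (i : ℕ)
    (l m : Letter Q) (hl : σ[i]? = some l) (hm : σ[(i + 1) % σ.length]? = some m) :
    Follows R l m := by
  obtain ⟨hi, rfl⟩ := List.getElem?_eq_some_iff.1 hl
  obtain ⟨hj, rfl⟩ := List.getElem?_eq_some_iff.1 hm
  have h1 := List.isChain_iff_getElem.1 h.follows i (by rw [List.length_append]; omega)
  rw [List.getElem_append_left hi] at h1
  rcases Nat.lt_or_ge (i + 1) σ.length with h2 | h2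
  · rw [List.getElem_append_left h2] at h1
    simpa only [Nat.mod_eq_of_lt h2] using h1
  · rw [List.getElem_append_right h2] at h1
    have h3 : i + 1 = σ.length := by omega
    simpa only [h3, Nat.sub_self, Nat.mod_self] using h1

/-- A word of letters, its left end being in cohomological degree `baseDeg`. The vertices are
numbered from left to right and modulo the length by `0, 1, …`, and letter `i` joins the vertices
`i` and `i + 1`. The scalar of the band is placed on letter `pos`. -/
structure BandData (Q : Type u) [Quiver.{u} Q] where
  word : List (Letter Q)
  baseDeg : ℤ
  pos : ℕ

namespace BandData

variable (B : BandData Q)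

/-- The data form a homotopy band with its scalar placed on a direct homotopy letter. -/
structure IsBand : Prop where
  band : IsHomotopyBand R B.word
  direct : ∃ l, B.word[B.pos]? = some l ∧ l.isInv = false

def deg (i : ℕ) : ℤ := B.baseDeg + ((B.word.take i).map Letter.sgn).sum

end BandData

end Strings

/-! ### String complexes and band complexes -/

section Complexes

variable {Q : Type u} [Quiver.{u} Q] [Fintype Q] (k : Type u) [Field k]
  (R : Quiver.Total Q → Quiver.Total Q → Prop)

theorem vert_mul_self (x : Q) : vert k R x * vert k R x = vert k R x := by
  unfold vert
  rw [← map_mul]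
  exact RingQuot.mkAlgHom_rel k (AlgRel.idem x)

theorem arr_mul_vert (a : Quiver.Total Q) : arr k R a * vert k R a.left = arr k R a := by
  unfold vert arr
  rw [← map_mul]
  exact RingQuot.mkAlgHom_rel k (AlgRel.source a)

theorem arr_mul_arr (b a : Quiver.Total Q) (h : R b a) : arr k R b * arr k R a = 0 := by
  unfold arr
  rw [← map_mul, ← map_zero (RingQuot.mkAlgHom k (AlgRel k R))]
  exact RingQuot.mkAlgHom_rel k (AlgRel.rel b a h)

theorem elt_mul_elt (l m : Letter Q) (x : Q) (hx : x = l.firstArrow.left)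
    (h : R l.firstArrow m.lastArrow) :
    l.elt (arr k R) * vert k R x * m.elt (arr k R) = 0 := by
  have h1 : l.elt (arr k R) =
      (l.arrows.dropLast.map (arr k R)).prod * arr k R l.firstArrow := by
    conv_lhs => rw [Letter.elt, ← List.dropLast_append_getLast l.ne]
    simp [Letter.firstArrow]
  have h2 : m.elt (arr k R) = arr k R m.lastArrow * (m.arrows.tail.map (arr k R)).prod := by
    conv_lhs => rw [Letter.elt, ← List.cons_head_tail m.ne]
    rw [List.map_cons, List.prod_cons, Letter.lastArrow]
  rw [h1, h2, hx, mul_assoc (List.prod _), arr_mul_vert, mul_assoc, ← mul_assoc (arr k R _),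
    arr_mul_arr k R _ _ h, zero_mul, mul_zero]

/-- The unfolded diagram of a string: a direct letter gives an arrow from left to right, an inverse
letter an arrow from right to left. -/
def StringData.diagram (S : StringData Q) : Diagram (BoundAlg k R) where
  V := ℤ
  mem := S.IsVertex
  idem i := vert k R (S.vtx i)
  deg := S.deg
  out i :=
    (match S.letterAt i with
      | some l => if l.isInv then [] else [(i + 1, l.elt (arr k R))]
      | none => []) ++
    (match S.letterAt (i - 1) with
      | some l => if l.isInv then [(i - 1, l.elt (arr k R))] else []
      | none => [])

/-- The unfolded diagram of a band with scalar `lam`. -/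
def BandData.diagram (B : BandData Q) (lam : kˣ) : Diagram (BoundAlg k R) where
  V := ℕ
  mem i := i < B.word.length
  idem i := ((B.word[i]?).map (fun l => vert k R l.lft)).getD 0
  deg := B.deg
  out i :=
    (match B.word[i]? with
      | some l => if l.isInv then [] else
          [((i + 1) % B.word.length,
            (if i = B.pos then (lam : k) else 1) • l.elt (arr k R))]
      | none => []) ++
    (match B.word[(i + B.word.length - 1) % B.word.length]? with
      | some l => if l.isInv then
          [((i + B.word.length - 1) % B.word.length, l.elt (arr k R))] else []
      | none => [])

theorem StringData.mem_out (S : StringData Q) (i w : ℤ) (a : BoundAlg k R)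
    (h : (w, a) ∈ (S.diagram k R).out i) :
    (∃ l, S.letterAt i = some l ∧ l.isInv = false ∧ w = i + 1 ∧ a = l.elt (arr k R)) ∨
    (∃ l, S.letterAt (i - 1) = some l ∧ l.isInv = true ∧ w = i - 1 ∧ a = l.elt (arr k R)) := by
  rcases List.mem_append.1 h with h | h
  · left
    cases hl : S.letterAt i with
    | none => simp [hl] at h
    | some l =>
      cases hi : l.isInv with
      | true => simp [hl, hi] at h
      | false =>
        simp [hl, hi] at h
        exact ⟨l, rfl, hi, h.1, h.2⟩
  · right
    cases hl : S.letterAt (i - 1) with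
    | none => simp [hl] at h
    | some l =>
      cases hi : l.isInv with
      | false => simp [hl, hi] at h
      | true =>
        simp [hl, hi] at h
        exact ⟨l, rfl, hi, h.1, h.2⟩

theorem StringData.sqZero (S : StringData Q) (hS : S.IsHomotopyString R) :
    (S.diagram k R).SqZero := by
  intro (v : ℤ) (w : ℤ) a (x : ℤ) b hwa hxb
  change a * vert k R (S.vtx w) * b = 0
  rcases S.mem_out k R v w a hwa with ⟨l, hl, hli, rfl, rfl⟩ | ⟨l, hl, hli, rfl, rfl⟩ <;>
    rcases S.mem_out k R _ x b hxb with ⟨m, hm, hmi, rfl, rfl⟩ | ⟨m, hm, hmi, rfl, rfl⟩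
  · have hf := hS.follows v l m hl hm
    unfold Follows at hf
    rw [hli, hmi] at hf
    refine elt_mul_elt k R l m _ ?_ hf.2
    rw [StringData.vtx, hm]
    exact hf.1.symm.trans (by simp [Letter.rgt, hli])
  · rw [add_sub_cancel_right, hl] at hm
    cases hm
    simp [hli] at hmi
  · rw [hl] at hm
    cases hm
    simp [hli] at hmi
  · have hf := hS.follows (v - 1 - 1) m l hm (by rwa [sub_add_cancel])
    unfold Follows at hf
    rw [hli, hmi] at hf
    refine elt_mul_elt k R l m _ ?_ hf.2
    rw [StringData.vtx, hl]
    simp [Letter.lft, hli]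

theorem BandData.mem_out (B : BandData Q) (lam : kˣ) (i w : ℕ) (a : BoundAlg k R)
    (h : (w, a) ∈ (B.diagram k R lam).out i) :
    (∃ l, B.word[i]? = some l ∧ l.isInv = false ∧ w = (i + 1) % B.word.length ∧
      ∃ c : k, a = c • l.elt (arr k R)) ∨
    (∃ l, B.word[(i + B.word.length - 1) % B.word.length]? = some l ∧ l.isInv = true ∧
      w = (i + B.word.length - 1) % B.word.length ∧ ∃ c : k, a = c • l.elt (arr k R)) := by
  rcases List.mem_append.1 h with h | h
  · left
    cases hl : B.word[i]? with
    | none => simp [hl] at h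
    | some l =>
      cases hi : l.isInv with
      | true => simp [hl, hi] at h
      | false =>
        simp only [hl, hi, List.mem_singleton, Prod.mk.injEq, Bool.false_eq_true, if_false] at h
        exact ⟨l, rfl, hi, h.1, _, h.2⟩
  · right
    cases hl : B.word[(i + B.word.length - 1) % B.word.length]? with
    | none => simp [hl] at h
    | some l =>
      cases hi : l.isInv with
      | false => simp [hl, hi] at h
      | true =>
        simp only [hl, hi, List.mem_singleton, Prod.mk.injEq, if_true] at h
        exact ⟨l, rfl, hi, h.1, 1, by rw [one_smul]; exact h.2⟩

theorem BandData.sqZero (B : BandData Q) (lam : kˣ) (hB : IsHomotopyBand R B.word) :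
    (B.diagram k R lam).SqZero := by
  intro (v : ℕ) (w : ℕ) a (x : ℕ) b hwa hxb
  change a * ((B.word[w]?).map (fun l => vert k R l.lft)).getD 0 * b = 0
  have hn : 0 < B.word.length := List.length_pos_of_ne_nil hB.ne
  rcases B.mem_out k R lam v w a hwa with ⟨l, hl, hli, hw, c, rfl⟩ | ⟨l, hl, hli, hw, c, rfl⟩ <;>
    rcases B.mem_out k R lam w x b hxb with ⟨m, hm, hmi, hx, c', rfl⟩ | ⟨m, hm, hmi, hx, c', rfl⟩
  · have hf := hB.follows_cyclic R v l m hl (by rw [← hw]; exact hm)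
    unfold Follows at hf
    rw [hli, hmi] at hf
    rw [hm, Option.map_some, Option.getD_some, smul_mul_assoc, smul_mul_assoc, mul_smul_comm,
      elt_mul_elt k R l m _ (hf.1.symm.trans (by simp [Letter.rgt, hli])) hf.2, smul_zero,
      smul_zero]
  · exfalso
    have hv : v < B.word.length := (List.getElem?_eq_some_iff.1 hl).1
    have e : (w + B.word.length - 1) % B.word.length = v := by
      rw [hw]
      rcases Nat.lt_or_ge (v + 1) B.word.length with h2 | h2
      · rw [Nat.mod_eq_of_lt h2, show v + 1 + B.word.length - 1 = v + B.word.length by omega,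
          Nat.add_mod_right, Nat.mod_eq_of_lt hv]
      · have h3 : v + 1 = B.word.length := by omega
        rw [h3, Nat.mod_self, Nat.zero_add, Nat.mod_eq_of_lt (by omega)]
        omega
    rw [e, hl] at hm
    cases hm
    simp [hli] at hmi
  · exfalso
    rw [hw, hl] at hm
    cases hm
    simp [hli] at hmi
  · have e : ((w + B.word.length - 1) % B.word.length + 1) % B.word.length = w := by
      have hw' : w < B.word.length := by rw [hw]; exact Nat.mod_lt _ hn
      rw [Nat.mod_add_mod, show w + B.word.length - 1 + 1 = w + B.word.length by omega,
        Nat.add_mod_right, Nat.mod_eq_of_lt hw']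
    have hf := hB.follows_cyclic R _ m l hm (by rw [e, hw]; exact hl)
    unfold Follows at hf
    rw [hli, hmi] at hf
    rw [hw, hl, Option.map_some, Option.getD_some, smul_mul_assoc, smul_mul_assoc, mul_smul_comm,
      elt_mul_elt k R l m _ (by simp [Letter.lft, hli]) hf.2, smul_zero, smul_zero]

/-- The string complex `P_σ` of a finite or infinite homotopy string. -/
def stringComplex (S : StringData Q) (hS : S.IsHomotopyString R) :
    CochainComplex (ModuleCat.{u} (BoundAlg k R)) ℤ :=
  (S.diagram k R).complex (S.sqZero k R hS)

/-- The one-dimensional band complex `B_{σ,λ}`. -/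
def bandComplex (B : BandData Q) (lam : kˣ) (hB : B.IsBand R) :
    CochainComplex (ModuleCat.{u} (BoundAlg k R)) ℤ :=
  (B.diagram k R lam).complex (B.sqZero k R lam hB.band)

end Complexes

/-! ### Overlaps and graph maps from a band to a string -/

section Overlap

variable {Q : Type u} [Quiver.{u} Q]

/-- The right endpoint conditions for graph maps. Here `s` is the letter of the source following
the overlap on its right, `t` the letter of the target there (possibly empty), and `f` the
component of the graph map at the right vertices of these letters (a direct letter, or empty). -/
inductive EndCond : Letter Q → Option (Letter Q) → Option (Letter Q) → Prop
  /-- both letters are direct and `t = s f` -/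
  | rg1 (s t f : Letter Q) (hs : s.isInv = false) (ht : t.isInv = false) (hf : f.isInv = false)
      (h : t.arrows = s.arrows ++ f.arrows) : EndCond s (some t) (some f)
  /-- both letters are inverse and `s̄ = f t̄` -/
  | rg2 (s t f : Letter Q) (hs : s.isInv = true) (ht : t.isInv = true) (hf : f.isInv = false)
      (h : s.arrows = f.arrows ++ t.arrows) : EndCond s (some t) (some f)
  /-- `s` is direct and `t` is inverse -/
  | rg3 (s t : Letter Q) (hs : s.isInv = false) (ht : t.isInv = true) : EndCond s (some t) none
  /-- `s` is direct and `t` is empty -/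
  | rg3_empty (s : Letter Q) (hs : s.isInv = false) : EndCond s none none

/-- The part of the homotopy string of the cone that replaces `s̄ t ⋯`, where `s` is the letter of
the source to the right of the overlap and the sequence `t` is what follows the overlap in the
target. If the target ends with the overlap, nothing is left; otherwise `s̄` and the first letter
of `t` merge to the reduced walk `s̄ t`, which is `f` if one of the conditions `rg1`, `rg2` holds,
and otherwise is the inverse of the path `t̄ s`. -/
def junction (s : Letter Q) (f : Option (Letter Q)) (t : Stream'.Seq (Letter Q)) :
    Stream'.Seq (Letter Q) :=
  match t.head with
  | none => Stream'.Seq.nil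
  | some t₀ =>
    match f with
    | some f => Stream'.Seq.cons f t.tail
    | none => Stream'.Seq.cons ⟨t₀.arrows ++ s.arrows, by simp [s.ne], true⟩ t.tail

/-- The data of a decomposition `σ = β σ_L ρ σ_R α` of a word of letters and a decomposition
`τ = δ τ_L ρ τ_R γ` of a possibly infinite sequence of letters with the same middle part `ρ`, with
components `f_L`, `f_R` (possibly empty) of a graph map. The ends of `τ` are recorded as
`leftEnd = \overline{δ τ_L}` (so that its first letter is `τ̄_L`) and `rightEnd = τ_R γ`; each of
them may be empty. `baseDeg` is the cohomological degree of the left end of `σ`, and `pos` the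
position of the letter of `σ` that carries the scalar. -/
structure Overlap (Q : Type u) [Quiver.{u} Q] where
  β : List (Letter Q)
  σL : Letter Q
  ρ : List (Letter Q)
  σR : Letter Q
  α : List (Letter Q)
  leftEnd : Stream'.Seq (Letter Q)
  rightEnd : Stream'.Seq (Letter Q)
  fL : Option (Letter Q)
  fR : Option (Letter Q)
  baseDeg : ℤ
  pos : ℕ

namespace Overlap

variable (o : Overlap Q)

/-- The word `σ = β σ_L ρ σ_R α`. -/
def band : BandData Q where
  word := o.β ++ o.σL :: (o.ρ ++ o.σR :: o.α)
  baseDeg := o.baseDeg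
  pos := o.pos

/-- The sequence `τ = δ τ_L ρ τ_R γ`, with the left end of `ρ` as base vertex. It is graded such
that `ρ` lies in the same degrees in `σ` and in `τ`. -/
def string : StringData Q where
  base := o.σL.rgt
  baseDeg := o.band.deg (o.β.length + 1)
  left := o.leftEnd
  right := (Stream'.Seq.ofList o.ρ).append o.rightEnd

/-- The sequence `δ τ_L σ̄_L β̄ ᾱ σ̄_R τ_R γ` (reduced, and without `τ_L σ̄_L` or `σ̄_R τ_R` if
`τ_L` or `τ_R`, respectively, is empty). Its base vertex is the one between `β̄` and `ᾱ`. -/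
def cone : StringData Q where
  base := ((o.β ++ [o.σL]).head (by simp)).lft
  baseDeg := o.baseDeg - 1
  left := (Stream'.Seq.ofList o.β).append (junction o.σL.bar o.fL o.leftEnd)
  right := (Stream'.Seq.ofList (o.α.reverse.map Letter.bar)).append (junction o.σR o.fR o.rightEnd)

/-- The letters and components at both ends of `ρ` satisfy endpoint conditions of graph maps;
the left endpoint conditions are the right ones for the inverted letters. -/
structure Endpoints : Prop where
  left : EndCond o.σL.bar o.leftEnd.head o.fL
  right : EndCond o.σR o.rightEnd.head o.fR

/-- `σ` and `τ` are compatibly oriented: if the graph map is concentrated in one degree, i.e. if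
`ρ` is trivial and there are no components `f_L` and `f_R`, then the path `τ_L σ̄_L` (if `τ_L` is
nonempty) and the path `τ̄_R σ_R` (if `τ_R` is nonempty) are nonzero. -/
def Compatible (R : Quiver.Total Q → Quiver.Total Q → Prop) : Prop :=
  o.ρ = [] → o.fL = none → o.fR = none →
    (∀ t, o.leftEnd.head = some t → IsNonzeroPath R (t.arrows ++ o.σL.arrows)) ∧
    (∀ t, o.rightEnd.head = some t → IsNonzeroPath R (t.arrows ++ o.σR.arrows))

variable [Fintype Q] (k : Type u) [Field k] (R : Quiver.Total Q → Quiver.Total Q → Prop)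

/-- The scalar of the component at the vertex `i` of `σ`: the components are `1` up to the letter
carrying the scalar `lam` of the band complex and `lam⁻¹` after it. (So all of them are `1` if that
letter lies in `β` or `α`.) -/
def scalar (lam : kˣ) (i : ℕ) : k :=
  if o.β.length ≤ o.pos ∧ o.pos < i then ((lam⁻¹ : kˣ) : k) else 1

/-- The components of the graph map: identities (up to the above scalars) along `ρ`, and the
paths `f_L` and `f_R`, should they exist, at the outer vertices of the neighbouring letters. -/
def components (lam : kˣ) (i : ℕ) : List (ℤ × BoundAlg k R) :=
  (if o.β.length + 1 ≤ i ∧ i ≤ o.β.length + 1 + o.ρ.length then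
    [((i : ℤ) - o.β.length - 1, o.scalar k lam i • (1 : BoundAlg k R))] else []) ++
  (if i = o.β.length then
    o.fL.toList.map (fun f => ((-1 : ℤ), o.scalar k lam o.β.length • f.elt (arr k R))) else []) ++
  (if i = (o.β.length + o.ρ.length + 2) % o.band.word.length then
    o.fR.toList.map (fun f => ((o.ρ.length : ℤ) + 1,
      o.scalar k lam (o.β.length + o.ρ.length + 2) • f.elt (arr k R))) else [])

variable {k R}

/-- The chain map `B_{σ,λ} ⟶ P_τ` is the graph map with the given components. -/
def IsGraphMap {lam : kˣ} {hσ : o.band.IsBand R} {hτ : o.string.IsHomotopyString R}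
    (f : bandComplex k R o.band lam hσ ⟶ stringComplex k R o.string hτ) : Prop :=
  ∀ n : ℤ, f.f n = ModuleCat.ofHom
    (Diagram.matMap (o.band.diagram k R lam) (o.string.diagram k R) (o.components k R lam) n n)

end Overlap

end Overlap

end Gentle

end

/-! In degree `n` the mapping cone of `f` is `B^{n+1} ⊕ P^n`, with one projective for each vertex of
`σ` and each vertex of `τ`. Along `ρ` the graph map is the identity up to units, so every vertex of
`ρ` in `σ` cancels against its copy in `τ` by Gaussian elimination. The surviving vertices are those
of `c`: cutting `ρ` out of the cycle `σ` leaves a walk between the outer vertices of `σ_L` and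
`σ_R`, which `c` traverses backwards, and the two ends of `τ` outside `ρ` are attached to it.

The reduced differential has four parts: `-d_B`, `f`, `d_P` and the zigzags that enter `ρ` by `d_P`,
pass back to the band by the inverse of `f` and leave `ρ` by `d_B`. The first part gives the letters
of `β̄ ᾱ`, the third those of `δ` and `γ`. The letters at the two junctions come from the other two:
under (RG1) and (RG2) the component `f_R` joins the outer vertices and there is no zigzag, while
under (RG3) the zigzag is the composed path `τ̄_R σ_R`; the left end is symmetric. A zigzag could
leave `ρ` at the wrong end only if `ρ` is trivial, and then the relations of the gentle algebra make
it zero (`label_mul_label_right`, `label_mul_label_left`).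

All coefficients left over are units: signs, powers of `λ`, and their products. Since the band has
been cut open, `c` contains no cycle, and rescaling the summands one after the other along `c` turns
all coefficients into `1` (`exists_normalizes`). This is why `λ` does not occur in the result.

The elimination is the formal statement `nonempty_homotopyEquiv_mappingCone`. That `c` is a homotopy
string, `cone_isHomotopyString`, rests on the uniqueness conditions for gentle relations and, for a
map concentrated in one degree, on compatible orientation. The comparison of differentials is made
vertex by vertex in `differential_mid`, `differential_of_gt` and `differential_of_lt`. A Morita
equivalence is additive, so it carries the homotopy equivalence over to `Λ`. -/

noncomputable section

namespace Gentle

/-! ### Gaussian elimination in a mapping cone -/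

section ConeReduction

open CochainComplex CochainComplex.HomComplex Limits

/-- Elimination of a contractible part of a mapping cone. The maps `a`, `b` include the terms of `K`
into those of the cone, the maps `a'`, `b'` project back, and `s` is inverse to the part of `f` that
is eliminated. -/
theorem nonempty_homotopyEquiv_mappingCone {C : Type*} [Category C] [Preadditive C]
    [HasBinaryBiproducts C] {B P K : CochainComplex C ℤ} (f : B ⟶ P)
    (s : ∀ n, P.X n ⟶ B.X n) (a : ∀ p q, K.X p ⟶ B.X q) (a' : ∀ p q, B.X p ⟶ K.X q)
    (b : ∀ n, K.X n ⟶ P.X n) (b' : ∀ n, P.X n ⟶ K.X n)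
    (hK : ∀ n, a n (n + 1) ≫ a' (n + 1) n + b n ≫ b' n = 𝟙 _)
    (hbs : ∀ n, b n ≫ s n = 0) (hsa : ∀ n, s (n + 1) ≫ a' (n + 1) n = 0)
    (hB : ∀ n, a' (n + 1) n ≫ a n (n + 1) + f.f (n + 1) ≫ s (n + 1) = 𝟙 _)
    (hP : ∀ n, b' n ≫ b n + s n ≫ f.f n = 𝟙 _)
    (hab : ∀ n, a' (n + 1) n ≫ b n = 0) (hba : ∀ n, b' n ≫ a n (n + 1) = 0)
    (hd : ∀ n, K.d n (n + 1) =
      - a n (n + 1) ≫ B.d (n + 1) (n + 1 + 1) ≫ a' (n + 1 + 1) (n + 1) +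
      a n (n + 1) ≫ f.f (n + 1) ≫ b' (n + 1) + b n ≫ P.d n (n + 1) ≫ b' (n + 1) +
      b n ≫ P.d n (n + 1) ≫ s (n + 1) ≫ B.d (n + 1) (n + 1 + 1) ≫ a' (n + 1 + 1) (n + 1)) :
    Nonempty (HomotopyEquiv (mappingCone f) K) := by
  have haa : ∀ n, a n (n + 1) ≫ a' (n + 1) n ≫ a n (n + 1) = a n (n + 1) := fun n => by
    have h := hK n =≫ a n (n + 1)
    simpa [hba] using h
  have hbb' : ∀ n, b' n ≫ b n ≫ b' n = b' n := fun n => by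
    have h := b' n ≫= hK n
    simpa [reassoc_of% hba] using h
  -- This identity and the next say that `f` is block diagonal: it maps the surviving part of `B` to
  -- the surviving part of `P`, and the eliminated part to the eliminated part.
  have hafs : ∀ n, a n (n + 1) ≫ f.f (n + 1) ≫ s (n + 1) = 0 := fun n => by
    have h := a n (n + 1) ≫= hB n
    simpa [haa] using h
  have hsfb : ∀ n, s n ≫ f.f n ≫ b' n = 0 := fun n => by
    have h := hP n =≫ b' n
    simpa [hbb'] using h
  -- The next four identities move `K.d` past a projection or an inclusion. Each replaces a
  -- projection onto surviving terms by the identity minus the projection onto eliminated ones.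
  have hbd : ∀ n, b' n ≫ K.d n (n + 1) = P.d n (n + 1) ≫ b' (n + 1) +
      P.d n (n + 1) ≫ s (n + 1) ≫ B.d (n + 1) (n + 1 + 1) ≫ a' (n + 1 + 1) (n + 1) -
      s n ≫ f.f n ≫ (P.d n (n + 1) ≫ b' (n + 1) +
      P.d n (n + 1) ≫ s (n + 1) ≫ B.d (n + 1) (n + 1 + 1) ≫ a' (n + 1 + 1) (n + 1)) := fun n => by
    have h : b' n ≫ b n = 𝟙 _ - s n ≫ f.f n := by rw [← hP n]; abel
    rw [hd]
    simp only [Preadditive.comp_add, Preadditive.comp_neg, reassoc_of% hba, zero_comp,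
      neg_zero, zero_add, reassoc_of% h]
    simp only [Preadditive.sub_comp, Category.id_comp, Category.assoc]
    abel
  have had : ∀ n, a' (n + 1) n ≫ K.d n (n + 1) =
      - B.d (n + 1) (n + 1 + 1) ≫ a' (n + 1 + 1) (n + 1) + f.f (n + 1) ≫ b' (n + 1) +
      f.f (n + 1) ≫ s (n + 1) ≫ B.d (n + 1) (n + 1 + 1) ≫ a' (n + 1 + 1) (n + 1) := fun n => by
    have h : a' (n + 1) n ≫ a n (n + 1) = 𝟙 _ - f.f (n + 1) ≫ s (n + 1) := by rw [← hB n]; abel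
    rw [hd]
    simp only [Preadditive.comp_add, Preadditive.comp_neg, reassoc_of% hab, zero_comp,
      add_zero, reassoc_of% h]
    simp only [Preadditive.sub_comp, Category.id_comp, Category.assoc, hsfb, comp_zero]
    abel
  have hdb : ∀ n, K.d n (n + 1) ≫ b (n + 1) = a n (n + 1) ≫ f.f (n + 1) + b n ≫ P.d n (n + 1) -
      b n ≫ P.d n (n + 1) ≫ s (n + 1) ≫ f.f (n + 1) := fun n => by
    have h : b' (n + 1) ≫ b (n + 1) = 𝟙 _ - s (n + 1) ≫ f.f (n + 1) := by rw [← hP]; abel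
    rw [hd]
    simp only [Preadditive.add_comp, Preadditive.neg_comp, Category.assoc, hab, comp_zero, h,
      Preadditive.comp_sub, Category.comp_id, reassoc_of% hafs, zero_comp]
    abel
  have hda : ∀ n, K.d n (n + 1) ≫ a (n + 1) (n + 1 + 1) =
      - a n (n + 1) ≫ B.d (n + 1) (n + 1 + 1) +
      a n (n + 1) ≫ f.f (n + 1) ≫ P.d (n + 1) (n + 1 + 1) ≫ s (n + 1 + 1) +
      b n ≫ P.d n (n + 1) ≫ s (n + 1) ≫ B.d (n + 1) (n + 1 + 1) -
      b n ≫ P.d n (n + 1) ≫ s (n + 1) ≫ f.f (n + 1) ≫ P.d (n + 1) (n + 1 + 1) ≫ s (n + 1 + 1) :=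
    fun n => by
    have h : a' (n + 1 + 1) (n + 1) ≫ a (n + 1) (n + 1 + 1) = 𝟙 _ - f.f (n + 1 + 1) ≫ s (n + 1 + 1)
      := by rw [← hB]; abel
    rw [hd]
    simp only [Preadditive.add_comp, Preadditive.neg_comp, Category.assoc, hba, comp_zero, h,
      Preadditive.comp_sub, Category.comp_id, f.comm_assoc]
    abel
  -- The plain inclusion is not a chain map, as `P.d` may run from surviving terms into eliminated
  -- ones. The correction by `- P.d ≫ s` in the band summand compensates for this.
  let φ : K ⟶ mappingCone f :=
    { f := fun n => (a n (n + 1) - b n ≫ P.d n (n + 1) ≫ s (n + 1)) ≫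
          (mappingCone.inl f).v (n + 1) n (by lia) + b n ≫ (mappingCone.inr f).f n
      comm' := by
        rintro n _ rfl
        refine mappingCone.ext_to f _ _ rfl ?_ ?_
        · simp only [Preadditive.add_comp, Preadditive.comp_add, Category.assoc,
            mappingCone.inl_v_fst_v, mappingCone.inr_f_fst_v, comp_zero, add_zero,
            mappingCone.d_fst_v f n (n + 1) (n + 1 + 1) rfl rfl, Preadditive.comp_neg,
            mappingCone.inl_v_fst_v_assoc, mappingCone.inr_f_fst_v_assoc, zero_comp, neg_zero,
            Category.comp_id, Preadditive.comp_sub, Preadditive.sub_comp, hda, reassoc_of% hdb,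
            HomologicalComplex.d_comp_d_assoc]
          abel
        · simp only [Preadditive.add_comp, Preadditive.comp_add, Category.assoc,
            mappingCone.inl_v_snd_v, mappingCone.inr_f_snd_v, comp_zero, zero_add,
            mappingCone.d_snd_v f n (n + 1) rfl,
            mappingCone.inl_v_fst_v_assoc, mappingCone.inr_f_fst_v_assoc, zero_comp,
            mappingCone.inl_v_snd_v_assoc, mappingCone.inr_f_snd_v_assoc, add_zero,
            Category.comp_id, Preadditive.sub_comp, hdb, sub_zero]
          abel }
  -- Dually, an eliminated term of `P` is sent on through `s` and the differential of `B` to the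
  -- surviving terms.
  let ψ : mappingCone f ⟶ K :=
    { f := fun n => (mappingCone.fst f).1.v n (n + 1) rfl ≫ a' (n + 1) n +
          (mappingCone.snd f).v n n (add_zero n) ≫
            (b' n + s n ≫ B.d n (n + 1) ≫ a' (n + 1) n)
      comm' := by
        rintro n _ rfl
        refine mappingCone.ext_from f (n + 1) n rfl ?_ ?_
        · simp only [Preadditive.add_comp, Preadditive.comp_add, Category.assoc,
            mappingCone.inl_v_fst_v_assoc, mappingCone.inl_v_snd_v_assoc, zero_comp, add_zero, had,
            mappingCone.inl_v_d_assoc f (n + 1) n (n + 1 + 1) (by lia) (by lia),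
            Preadditive.sub_comp, mappingCone.inr_f_snd_v_assoc, mappingCone.inr_f_fst_v_assoc,
            comp_zero]
          abel
        · simp only [Preadditive.add_comp, Preadditive.comp_add, Category.assoc,
            mappingCone.inr_f_d_assoc, zero_comp,
            mappingCone.inr_f_snd_v_assoc, mappingCone.inr_f_fst_v_assoc,
            comp_zero, zero_add, hbd, had, Preadditive.comp_neg, f.comm_assoc,
            HomologicalComplex.d_comp_d_assoc]
          abel }
  -- The contraction of the eliminated part: from the summand `P` back to the summand `B` by `s`.
  let z : Cochain (mappingCone f) (mappingCone f) (-1) :=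
    (mappingCone.snd f).comp ((Cochain.ofHoms s).comp (mappingCone.inl f) (zero_add _)) (zero_add _)
  have h1 : φ ≫ ψ = 𝟙 K := by
    ext n
    simp only [φ, ψ, HomologicalComplex.comp_f, HomologicalComplex.id_f, Preadditive.add_comp,
      Preadditive.comp_add, Category.assoc, mappingCone.inl_v_fst_v_assoc,
      mappingCone.inl_v_snd_v_assoc, mappingCone.inr_f_snd_v_assoc, mappingCone.inr_f_fst_v_assoc,
      zero_comp, comp_zero, add_zero, zero_add, Preadditive.sub_comp, hsa, reassoc_of% hbs,
      sub_zero, hK]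
  have h2 : Cochain.ofHom (𝟙 (mappingCone f)) = δ (-1) 0 z + Cochain.ofHom (ψ ≫ φ) := by
    ext n
    have hbd' : b' n ≫ b n = 𝟙 _ - s n ≫ f.f n := by rw [← hP n]; abel
    have had' : a' (n + 1) n ≫ a n (n + 1) = 𝟙 _ - f.f (n + 1) ≫ s (n + 1) := by
      rw [← hB n]; abel
    rw [Cochain.add_v, δ_v (-1) 0 (by lia) z n n (by lia) (n - 1) (n + 1) rfl rfl]
    simp only [z, Cochain.zero_cochain_comp_v, Cochain.ofHoms_v, Cochain.ofHom_v,
      HomologicalComplex.comp_f, HomologicalComplex.id_f, φ, ψ, Category.assoc,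
      mappingCone.inl_v_d f n (n - 1) (n + 1) (by lia) (by lia), Int.negOnePow_zero, one_smul]
    refine mappingCone.ext_from f (n + 1) n rfl ?_ ?_
    · simp only [Preadditive.add_comp, Preadditive.comp_add, Category.assoc, Category.comp_id,
        mappingCone.inl_v_fst_v_assoc, mappingCone.inl_v_snd_v_assoc, zero_comp, add_zero,
        mappingCone.inl_v_d_assoc f (n + 1) n (n + 1 + 1) (by lia) (by lia), zero_add,
        Preadditive.sub_comp, Preadditive.comp_sub, mappingCone.inr_f_snd_v_assoc,
        comp_zero, sub_zero, reassoc_of% had', reassoc_of% hab, Category.id_comp]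
      abel
    · simp only [Preadditive.add_comp, Preadditive.comp_add, Category.assoc, Category.comp_id,
        mappingCone.inr_f_d_assoc, zero_comp, zero_add,
        Preadditive.sub_comp, Preadditive.comp_sub, mappingCone.inr_f_snd_v_assoc,
        mappingCone.inr_f_fst_v_assoc, comp_zero, reassoc_of% hba, reassoc_of% hbd',
        reassoc_of% had', reassoc_of% hab, Category.id_comp, sub_zero, add_zero, f.comm_assoc]
      abel
  exact ⟨ψ, φ, ((Cochain.equivHomotopy _ _).symm ⟨z, h2⟩).symm, Homotopy.ofEq h1⟩

end ConeReduction
end Gentle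

namespace Gentle
namespace Diagram

/-! ### Generators of the terms of a diagram complex -/

section Elements

variable {A : Type u} [Ring A]

/-- The element `a e_w` of the summand `A e_w` at the vertex `w`, or zero if `w` is not a vertex of
degree `n`. -/
def el (D : Diagram A) (n : ℤ) (w : D.V) : A →ₗ[A] D.X n :=
  (D.incl n w) ∘ₗ LinearMap.toSpanSingleton A (Proj (D.idem w))
    ⟨D.idem w, Submodule.mem_span_singleton_self _⟩

theorem el_eq_zero (D : Diagram A) {n : ℤ} {w : D.V} (h : ¬ (D.mem w ∧ D.deg w = n)) (x : A) :
    D.el n w x = 0 := by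
  rw [el, incl, dif_neg h]; rfl

theorem el_mul_idem (D : Diagram A) (n : ℤ) (w : D.V) (hw : D.idem w * D.idem w = D.idem w)
    (x : A) : D.el n w (x * D.idem w) = D.el n w x := by
  rw [el, LinearMap.comp_apply, LinearMap.comp_apply]
  congr 1
  ext
  simp [mul_assoc, hw]

/-- Each summand `A e_v` is cyclic with generator `e_v`, so equations between the maps of the
elimination may be checked on one element per vertex. -/
theorem hom_ext (D : Diagram A) {n : ℤ} {M : Type*} [AddCommMonoid M] [Module A M]
    {g h : D.X n →ₗ[A] M}
    (H : ∀ v, D.mem v → D.deg v = n → g (D.el n v 1) = h (D.el n v 1)) : g = h := by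
  classical
  refine DirectSum.linearMap_ext (R := A) (fun v => ?_)
  have e : DirectSum.lof A (D.Vtx n) (fun w => Proj (D.idem w.1)) v = D.incl n v.1 := by
    rw [incl, dif_pos v.2]
  rw [e]
  ext q
  obtain ⟨c, hc⟩ := Submodule.mem_span_singleton.1 q.2
  have hq : q = c • ⟨D.idem v.1, Submodule.mem_span_singleton_self _⟩ := by
    ext; simpa using hc.symm
  have h1 := H v.1 v.2.1 v.2.2
  rw [el, LinearMap.comp_apply, LinearMap.toSpanSingleton_apply, one_smul] at h1
  rw [hq, map_smul, map_smul, LinearMap.comp_apply, LinearMap.comp_apply, h1]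

/-- The value of a matrix on the element `x e_v`. -/
theorem matMap_el (D D' : Diagram A) (m : D.V → List (D'.V × A)) (n n' : ℤ) (v : D.V)
    (h : D.mem v ∧ D.deg v = n) (x : A) :
    matMap D D' m n n' (D.el n v x) =
      ((m v).map (fun wa => D'.el n' wa.1 (x * D.idem v * wa.2))).sum := by
  rw [el, LinearMap.comp_apply, matMap_incl _ _ _ _ _ _ h]
  congr 2
  ext wa : 1
  rw [arrowMap, LinearMap.comp_apply, el, LinearMap.comp_apply]
  congr 1
  ext
  simp [rmul, mul_assoc]

theorem complex_d (D : Diagram A) (h : D.SqZero) (n : ℤ) :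
    (D.complex h).d n (n + 1) = ModuleCat.ofHom (matMap D D D.out n (n + 1)) :=
  CochainComplex.of_d (fun n => ModuleCat.of A (D.X n))
    (fun n => ModuleCat.ofHom (matMap D D D.out n (n + 1))) n

end Elements

end Diagram
-- Letters, gentle relations and the letters at the junctions
section Letters

variable {Q : Type u} [Quiver.{u} Q]

namespace Letter

@[simp] theorem bar_bar (l : Letter Q) : l.bar.bar = l := by
  cases l; simp [bar]

@[simp] theorem bar_arrows (l : Letter Q) : l.bar.arrows = l.arrows := rfl

@[simp] theorem bar_isInv (l : Letter Q) : l.bar.isInv = !l.isInv := rfl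

@[simp] theorem bar_firstArrow (l : Letter Q) : l.bar.firstArrow = l.firstArrow := rfl

@[simp] theorem bar_lastArrow (l : Letter Q) : l.bar.lastArrow = l.lastArrow := rfl

@[simp] theorem bar_lft (l : Letter Q) : l.bar.lft = l.rgt := by
  cases h : l.isInv <;> simp [lft, rgt, h]

@[simp] theorem bar_rgt (l : Letter Q) : l.bar.rgt = l.lft := by
  cases h : l.isInv <;> simp [lft, rgt, h]

@[simp] theorem bar_sgn (l : Letter Q) : l.bar.sgn = - l.sgn := by
  cases h : l.isInv <;> simp [sgn, h]

@[simp] theorem bar_elt {A : Type u} [Ring A] (g : Quiver.Total Q → A) (l : Letter Q) :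
    l.bar.elt g = l.elt g := rfl

theorem lastArrow_of_append {l m n : Letter Q} (h : l.arrows = m.arrows ++ n.arrows) :
    l.lastArrow = m.lastArrow := by
  simp only [lastArrow, h, List.head_append_of_ne_nil m.ne]

theorem firstArrow_of_append {l m n : Letter Q} (h : l.arrows = m.arrows ++ n.arrows) :
    l.firstArrow = n.firstArrow := by
  simp only [firstArrow, h, List.getLast_append_of_ne_nil _ n.ne]

end Letter

variable {R : Quiver.Total Q → Quiver.Total Q → Prop}

theorem IsNonzeroPath.of_append_left {p q : List (Quiver.Total Q)} (h : IsNonzeroPath R (p ++ q)) :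
    IsNonzeroPath R p := List.IsChain.left_of_append h

theorem IsNonzeroPath.of_append_right {p q : List (Quiver.Total Q)}
    (h : IsNonzeroPath R (p ++ q)) : IsNonzeroPath R q := List.IsChain.right_of_append h

/-- A product of two nontrivial paths is nonzero iff both are and the arrows at the junction do not
form a relation. -/
theorem isNonzeroPath_append (l m : Letter Q) : IsNonzeroPath R (l.arrows ++ m.arrows) ↔
    IsNonzeroPath R l.arrows ∧ IsNonzeroPath R m.arrows ∧
      l.firstArrow.left = m.lastArrow.right ∧ ¬ R l.firstArrow m.lastArrow := by
  unfold IsNonzeroPath Letter.firstArrow Letter.lastArrow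
  rw [List.isChain_append]
  refine and_congr_right fun _ => and_congr_right fun _ => ?_
  rw [List.getLast?_eq_some_getLast l.ne, List.head?_eq_some_head m.ne]
  simp

theorem Follows.bar {l m : Letter Q} (h : Follows R l m) : Follows R m.bar l.bar := by
  refine ⟨by simpa using h.1.symm, ?_⟩
  have h2 := h.2
  cases hl : l.isInv <;> cases hm : m.isInv <;> simp [hl, hm] at h2 ⊢
  · exact h2
  · exact fun e => h2 e.symm
  · exact fun e => h2 e.symm
  · exact h2

/-- Whether `m` may follow `l` depends only on the right end of `l`. -/
theorem Follows.congr_left {l l' m : Letter Q} (h : Follows R l m) (hr : l'.rgt = l.rgt)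
    (hi : l'.isInv = l.isInv) (h0 : l.isInv = false → l'.firstArrow = l.firstArrow)
    (h1 : l.isInv = true → l'.lastArrow = l.lastArrow) : Follows R l' m := by
  refine ⟨hr.trans h.1, ?_⟩
  have h2 := h.2
  cases hl : l.isInv <;> cases hm : m.isInv <;> simp_all

/-- Whether `m` may follow `l` depends only on the left end of `m`. -/
theorem Follows.congr_right {l m m' : Letter Q} (h : Follows R l m) (hr : m'.lft = m.lft)
    (hi : m'.isInv = m.isInv) (h0 : m.isInv = false → m'.lastArrow = m.lastArrow)
    (h1 : m.isInv = true → m'.firstArrow = m.firstArrow) : Follows R l m' := by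
  simpa using (h.bar.congr_left (l' := m'.bar) (by simpa using hr) (by simpa using hi)
    (by simpa using h1) (by simpa using h0)).bar

/-- If the letter `r` may be followed by the direct letter `s` and by the inverse letter `t`, then
the path `t̄ s` is nonzero. -/
theorem IsGentle.nonzero_of_follows (hR : IsGentle R) {r s t : Letter Q} (hs : s.isInv = false)
    (ht : t.isInv = true) (hrs : Follows R r s) (hrt : Follows R r t)
    (hs' : IsNonzeroPath R s.arrows) (ht' : IsNonzeroPath R t.arrows) :
    IsNonzeroPath R (t.arrows ++ s.arrows) := by
  refine (isNonzeroPath_append t s).2 ⟨ht', hs', ?_, fun h => ?_⟩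
  · simpa [Letter.lft, hs, ht] using hrt.1.symm.trans hrs.1
  -- A relation between `t̄` and `s` would have to be the one that `r` already forms with `s` (if
  -- `r` is direct) or with `t` (if `r` is inverse). Uniqueness of relations then identifies an
  -- arrow of `r` with one of `t` or `s`, against reducedness.
  · have h1 := hrs.2
    have h2 := hrt.2
    cases hr : r.isInv <;> simp [hr, hs, ht] at h1 h2
    · exact h2 (hR.rel_left _ h1 h)
    · exact h1 (hR.rel_right _ h2 h)

/-- The letter replacing `s̄ t` in the homotopy string of a cone. -/
def junctionLetter (s : Letter Q) (f : Option (Letter Q)) (t : Letter Q) : Letter Q :=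
  match f with
  | some f => f
  | none => ⟨t.arrows ++ s.arrows, by simp [s.ne], true⟩

theorem junction_get?_zero (s : Letter Q) (f : Option (Letter Q)) (t : Stream'.Seq (Letter Q)) :
    (junction s f t).get? 0 = t.head.map (junctionLetter s f) := by
  unfold junction junctionLetter
  cases t.head <;> cases f <;> simp

theorem junction_get?_succ (s : Letter Q) (f : Option (Letter Q)) (t : Stream'.Seq (Letter Q))
    (n : ℕ) : (junction s f t).get? (n + 1) = t.get? (n + 1) := by
  unfold junction
  cases h : t.head with
  | none =>
    have : t.get? (n + 1) = none := Stream'.Seq.le_stable t (Nat.zero_le _) h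
    simp [this]
  | some t₀ => cases f <;> simp [Stream'.Seq.get?_tail]

theorem get?_ofList_append_left {X : Type*} (l : List X) (s : Stream'.Seq X) {n : ℕ}
    (h : n < l.length) : ((Stream'.Seq.ofList l).append s).get? n = some l[n] := by
  induction l generalizing n with
  | nil => simp at h
  | cons a l ih =>
    rw [Stream'.Seq.ofList_cons, Stream'.Seq.cons_append]
    cases n with
    | zero => simp
    | succ n =>
      rw [Stream'.Seq.get?_cons_succ, ih (by simpa using h)]
      simp

theorem get?_ofList_append_right {X : Type*} (l : List X) (s : Stream'.Seq X) (n : ℕ) :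
    ((Stream'.Seq.ofList l).append s).get? (l.length + n) = s.get? n := by
  induction l with
  | nil => simp
  | cons a l ih =>
    rw [Stream'.Seq.ofList_cons, Stream'.Seq.cons_append, List.length_cons,
      show l.length + 1 + n = l.length + n + 1 by omega, Stream'.Seq.get?_cons_succ, ih]

/-- The left end of the letter at a junction fits to what precedes it. -/
theorem EndCond.follows_junctionLetter (hR : IsGentle R) {s t a : Letter Q} {f : Option (Letter Q)}
    (h : EndCond s (some t) f) (ht : IsNonzeroPath R t.arrows)
    (hsa : Follows R s a) : Follows R a.bar (junctionLetter s f t) := by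
  cases h with
  | rg1 _ f hs hti hf h =>
    obtain ⟨-, -, h1, h2⟩ := (isNonzeroPath_append s f).1 (h ▸ ht)
    have h3 := hsa.1
    have h4 := hsa.2
    refine ⟨?_, ?_⟩
    · cases ha : a.isInv <;>
        simpa [junctionLetter, Letter.lft, Letter.rgt, hf, hs, h1, ha] using h3.symm
    -- Here `s f` is a nonzero path. If `a` is direct, `s a` contains a relation at its junction and
    -- `s f` does not, so `a` and `f` have different last arrows. If `a` is inverse, the only arrow
    -- composable with the last arrow of `f` without relation belongs to `s`, so the first arrow of
    -- `a` must form a relation with it.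
    · cases ha : a.isInv <;> simp [junctionLetter, ha, hf, hs] at h4 ⊢
      · rintro e
        exact h2 (e ▸ h4)
      · by_contra h5
        refine h4 (hR.nonrel_left f.lastArrow ⟨h1, h2⟩ ⟨?_, h5⟩)
        rw [← h1]
        simpa [Letter.lft, Letter.rgt, hs, ha] using h3.symm
  | rg2 _ f hs hti hf h =>
    refine hsa.bar.congr_right ?_ (by simp [junctionLetter, hf, hs])
      (fun _ => (Letter.lastArrow_of_append h).symm) (by simp [hs])
    simp [junctionLetter, Letter.lft, hs, hf, Letter.lastArrow_of_append h]
  | rg3 _ hs hti =>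
    have h : (junctionLetter s none t).arrows = t.arrows ++ s.arrows := rfl
    refine hsa.bar.congr_right ?_ (by simp [junctionLetter, hs]) (by simp [hs])
      (fun _ => Letter.firstArrow_of_append h)
    simp [Letter.lft, hs, Letter.firstArrow_of_append h]
    simp [junctionLetter]

theorem EndCond.junctionLetter_rgt {s t : Letter Q} {f : Option (Letter Q)}
    (h : EndCond s (some t) f) (hs : IsNonzeroPath R s.arrows) :
    (junctionLetter s f t).rgt = t.rgt := by
  cases h with
  | rg1 _ f hs' hti hf h =>
    simp [junctionLetter, Letter.rgt, hf, hti, Letter.firstArrow_of_append h]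
  | rg2 _ f hs' hti hf h =>
    obtain ⟨-, -, h1, -⟩ := (isNonzeroPath_append f t).1 (h ▸ hs)
    simp [junctionLetter, Letter.rgt, hf, hti, h1]
  | rg3 _ hs' hti =>
    have h : (junctionLetter s none t).arrows = t.arrows ++ s.arrows := rfl
    simp [Letter.rgt, hti, Letter.lastArrow_of_append h]
    simp [junctionLetter]

theorem EndCond.junctionLetter_lft {s t : Letter Q} {f : Option (Letter Q)}
    (h : EndCond s (some t) f) (ht : IsNonzeroPath R t.arrows) :
    (junctionLetter s f t).lft = s.rgt := by
  cases h with
  | rg1 _ f hs hti hf h =>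
    obtain ⟨-, -, h1, -⟩ := (isNonzeroPath_append s f).1 (h ▸ ht)
    simp [junctionLetter, Letter.rgt, Letter.lft, hf, hs, h1]
  | rg2 _ f hs hti hf h =>
    simp [junctionLetter, Letter.lft, Letter.rgt, hs, hf, Letter.lastArrow_of_append h]
  | rg3 _ hs hti =>
    have h : (junctionLetter s none t).arrows = t.arrows ++ s.arrows := rfl
    simp [Letter.lft, Letter.rgt, hs, Letter.firstArrow_of_append h]
    simp [junctionLetter]

/-- The right end of the letter at a junction fits to what follows it. -/
theorem EndCond.junctionLetter_follows (hR : IsGentle R) {s t v : Letter Q} {f : Option (Letter Q)}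
    (h : EndCond s (some t) f) (hs : IsNonzeroPath R s.arrows)
    (htv : Follows R t v) : Follows R (junctionLetter s f t) v := by
  have hr := h.junctionLetter_rgt hs
  cases h with
  | rg1 _ f hs' hti hf h =>
    exact htv.congr_left hr (by simp [junctionLetter, hf, hti])
      (fun _ => (Letter.firstArrow_of_append h).symm) (by simp [hti])
  | rg2 _ f hs' hti hf h =>
    obtain ⟨-, -, h1, h2⟩ := (isNonzeroPath_append f t).1 (h ▸ hs)
    refine ⟨hr.trans htv.1, ?_⟩
    have h3 := htv.1
    have h4 := htv.2
    -- Now `f t̄` is a nonzero path. For direct `v`, only the last arrow of `t̄` may precede `f`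
    -- without relation, so `f v` contains a relation. For inverse `v`, equal first arrows of `f`
    -- and `v` would make `f t̄` zero.
    cases hv : v.isInv <;> simp [junctionLetter, hf, hti, hv] at h4 ⊢
    · by_contra h5
      refine h4 (hR.nonrel_right f.firstArrow ⟨h1, h2⟩ ⟨?_, h5⟩)
      rw [h1]
      simpa [Letter.lft, Letter.rgt, hti, hv] using h3
    · rintro e
      exact h2 (e ▸ h4)
  | rg3 _ hs' hti =>
    have h : (junctionLetter s none t).arrows = t.arrows ++ s.arrows := rfl
    exact htv.congr_left hr (by simp [junctionLetter, hti]) (by simp [hti])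
      (fun _ => (Letter.lastArrow_of_append h))

/-- An existing component `f` is a subpath of `t` or of `s`, so only the composed path of the third
endpoint condition needs a separate argument. -/
theorem EndCond.isNonzeroPath_junctionLetter {s t : Letter Q} {f : Option (Letter Q)}
    (h : EndCond s (some t) f) (hs : IsNonzeroPath R s.arrows) (ht : IsNonzeroPath R t.arrows)
    (hts : f = none → IsNonzeroPath R (t.arrows ++ s.arrows)) :
    IsNonzeroPath R (junctionLetter s f t).arrows := by
  cases h with
  | rg1 _ f hs' hti hf h => exact IsNonzeroPath.of_append_right (h ▸ ht)
  | rg2 _ f hs' hti hf h => exact IsNonzeroPath.of_append_left (h ▸ hs)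
  | rg3 _ hs' hti => exact hts rfl

/-- If the component at one end exists, then the neighbouring letters of source and target have the
same end towards the overlap. -/
theorem EndCond.follows_of_component {s t f a : Letter Q} (h : EndCond s (some t) (some f))
    (hlft : t.lft = s.lft) (hta : Follows R a t) : Follows R a s := by
  cases h with
  | rg1 _ f hs hti hf h =>
    exact hta.congr_right hlft.symm (by rw [hs, hti])
      (fun _ => (Letter.lastArrow_of_append h).symm) (by simp [hti])
  | rg2 _ f hs hti hf h =>
    exact hta.congr_right hlft.symm (by rw [hs, hti]) (by simp [hti])
      (fun _ => Letter.firstArrow_of_append h)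

theorem EndCond.follows_of_component' {s t f a : Letter Q} (h : EndCond s (some t) (some f))
    (hlft : t.lft = s.lft) (hta : Follows R a s) : Follows R a t := by
  cases h with
  | rg1 _ f hs hti hf h =>
    exact hta.congr_right hlft (by rw [hs, hti])
      (fun _ => (Letter.lastArrow_of_append h)) (by simp [hs])
  | rg2 _ f hs hti hf h =>
    exact hta.congr_right hlft (by rw [hs, hti]) (by simp [hs])
      (fun _ => (Letter.firstArrow_of_append h).symm)

end Letters
-- Positions of the letters in band, string and cone
section OverlapLetters

variable {Q : Type u} [Quiver.{u} Q]

theorem StringData.letterAt_natCast (S : StringData Q) (n : ℕ) :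
    S.letterAt (n : ℤ) = S.right.get? n := rfl

theorem StringData.letterAt_neg (S : StringData Q) (n : ℕ) :
    S.letterAt (-1 - (n : ℤ)) = (S.left.get? n).map Letter.bar := by
  rw [show (-1 - (n : ℤ)) = Int.negSucc n by omega]
  rfl

namespace Overlap

variable (o : Overlap Q)

theorem length_word : o.band.word.length = o.β.length + o.ρ.length + o.α.length + 2 := by
  simp [band]; omega

/-- The letters of the band, numbered periodically. -/
def bandLetter (j : ℤ) : Letter Q := o.band.word.getD (j % o.band.word.length).toNat o.σL

theorem bandLetter_add_length (j : ℤ) : o.bandLetter (j + o.band.word.length) = o.bandLetter j := by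
  simp [bandLetter]

theorem getElem?_word {n : ℕ} (h : n < o.band.word.length) :
    o.band.word[n]? = some (o.bandLetter n) := by
  rw [bandLetter, Int.emod_eq_of_lt (by omega) (by omega), Int.toNat_natCast,
    List.getD_eq_getElem _ _ h, List.getElem?_eq_getElem h]

theorem bandLetter_mem (j : ℤ) : o.bandLetter j ∈ o.band.word := by
  have hN := o.length_word
  have h : (j % o.band.word.length).toNat < o.band.word.length := by
    have := Int.emod_lt_of_pos j (b := o.band.word.length) (by omega)
    have := Int.emod_nonneg j (b := o.band.word.length) (by omega)
    omega
  rw [bandLetter, List.getD_eq_getElem _ _ h]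
  exact List.getElem_mem h

theorem bandLetter_β {n : ℕ} (h : n < o.β.length) : o.bandLetter n = o.β[n] := by
  have := o.length_word
  refine Option.some_injective _ ?_
  rw [← o.getElem?_word (by omega)]
  simp [band, List.getElem?_append_left h]

theorem bandLetter_σL : o.bandLetter o.β.length = o.σL := by
  have := o.length_word
  refine Option.some_injective _ ?_
  rw [← o.getElem?_word (by omega)]
  simp [band]

theorem bandLetter_ρ {n : ℕ} (h : n < o.ρ.length) :
    o.bandLetter (o.β.length + 1 + n) = o.ρ[n] := by
  have := o.length_word
  refine Option.some_injective _ ?_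
  rw [show (o.β.length + 1 + n : ℤ) = ((o.β.length + 1 + n : ℕ) : ℤ) by simp,
    ← o.getElem?_word (by omega)]
  simp only [band]
  rw [List.getElem?_append_right (by omega), show o.β.length + 1 + n - o.β.length = n + 1 by omega,
    List.getElem?_cons_succ, List.getElem?_append_left h, List.getElem?_eq_getElem h]

theorem bandLetter_σR : o.bandLetter (o.β.length + 1 + o.ρ.length) = o.σR := by
  have := o.length_word
  refine Option.some_injective _ ?_
  rw [show (o.β.length + 1 + o.ρ.length : ℤ) = ((o.β.length + 1 + o.ρ.length : ℕ) : ℤ) by simp,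
    ← o.getElem?_word (by omega)]
  simp only [band]
  rw [List.getElem?_append_right (by omega),
    show o.β.length + 1 + o.ρ.length - o.β.length = o.ρ.length + 1 by omega,
    List.getElem?_cons_succ, List.getElem?_append_right (by omega)]
  simp

theorem bandLetter_α {n : ℕ} (h : n < o.α.length) :
    o.bandLetter (o.β.length + o.ρ.length + 2 + n) = o.α[n] := by
  have := o.length_word
  refine Option.some_injective _ ?_
  rw [show (o.β.length + o.ρ.length + 2 + n : ℤ) = ((o.β.length + o.ρ.length + 2 + n : ℕ) : ℤ)
    by simp, ← o.getElem?_word (by omega)]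
  simp only [band]
  rw [List.getElem?_append_right (by omega),
    show o.β.length + o.ρ.length + 2 + n - o.β.length = (o.ρ.length + (n + 1)) + 1 by omega,
    List.getElem?_cons_succ, List.getElem?_append_right (by omega), Nat.add_sub_cancel_left,
    List.getElem?_cons_succ, List.getElem?_eq_getElem h]

theorem follows_bandLetter {R : Quiver.Total Q → Quiver.Total Q → Prop}
    (h : IsHomotopyBand R o.band.word) (j : ℤ) :
    Follows R (o.bandLetter j) (o.bandLetter (j + 1)) := by
  have hN := o.length_word
  have h1 := Int.emod_lt_of_pos j (b := o.band.word.length) (by omega)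
  have h2 := Int.emod_nonneg j (b := o.band.word.length) (by omega)
  refine h.follows_cyclic R (j % o.band.word.length).toNat _ _ ?_ ?_
  · rw [o.getElem?_word (by omega), Int.toNat_of_nonneg h2]
    simp [bandLetter]
  · have e : (j + 1) % o.band.word.length =
        (((j % o.band.word.length).toNat + 1) % o.band.word.length : ℕ) := by
      push_cast
      rw [Int.toNat_of_nonneg h2]
      simp
    rw [o.getElem?_word (Nat.mod_lt _ (by omega)), ← e]
    simp [bandLetter]

theorem string_letterAt_ρ {j : ℤ} (h0 : 0 ≤ j) (h1 : j < o.ρ.length) :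
    o.string.letterAt j = some (o.bandLetter (o.β.length + 1 + j)) := by
  lift j to ℕ using h0
  rw [StringData.letterAt_natCast, o.bandLetter_ρ (by omega)]
  exact get?_ofList_append_left _ _ _

theorem string_letterAt_right (n : ℕ) :
    o.string.letterAt (o.ρ.length + n) = o.rightEnd.get? n := by
  rw [← Nat.cast_add, StringData.letterAt_natCast]
  exact get?_ofList_append_right _ _ _

theorem string_letterAt_left (n : ℕ) :
    o.string.letterAt (-1 - n) = (o.leftEnd.get? n).map Letter.bar :=
  o.string.letterAt_neg n

/-- The base vertex of the cone is vertex `0` of the band and the direction is reversed, so vertex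
`i` of the cone is vertex `-i` of the band. The letter joining `i` and `i + 1` is thus the inverse
of the one joining `-i - 1` and `-i`. -/
theorem cone_letterAt_mid {i : ℤ} (h0 : -o.β.length ≤ i) (h1 : i < o.α.length) :
    o.cone.letterAt i = some (o.bandLetter (-i - 1)).bar := by
  rcases le_or_gt 0 i with h | h
  · lift i to ℕ using h
    rw [StringData.letterAt_natCast]
    have hl : i < (o.α.reverse.map Letter.bar).length := by simpa using h1
    refine (get?_ofList_append_left _ _ hl).trans ?_
    have e := o.bandLetter_α (n := o.α.length - 1 - i) (by omega)
    -- To the right of the base the index `-i - 1` is negative; one full turn around the band brings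
    -- it into `α`.
    rw [← o.bandLetter_add_length, show (-(i : ℤ) - 1 + o.band.word.length) =
      o.β.length + o.ρ.length + 2 + (o.α.length - 1 - i : ℕ) by have := o.length_word; omega, e]
    simp
  · obtain ⟨n, rfl⟩ : ∃ n : ℕ, i = -1 - n := ⟨(-1 - i).toNat, by omega⟩
    have hl : n < o.β.length := by omega
    rw [StringData.letterAt_neg, show (-(-1 - (n : ℤ)) - 1) = n by omega, o.bandLetter_β hl]
    exact congrArg _ (get?_ofList_append_left _ _ hl)

theorem cone_letterAt_right (n : ℕ) :
    o.cone.letterAt (o.α.length + n) = (junction o.σR o.fR o.rightEnd).get? n := by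
  rw [← Nat.cast_add, StringData.letterAt_natCast]
  have := get?_ofList_append_right (o.α.reverse.map Letter.bar) (junction o.σR o.fR o.rightEnd) n
  rw [List.length_map, List.length_reverse] at this
  exact this

theorem cone_letterAt_left (n : ℕ) :
    o.cone.letterAt (-o.β.length - 1 - n) =
      ((junction o.σL.bar o.fL o.leftEnd).get? n).map Letter.bar := by
  rw [show (-(o.β.length : ℤ) - 1 - n) = -1 - ((o.β.length + n : ℕ) : ℤ) by push_cast; ring,
    StringData.letterAt_neg]
  exact congrArg _ (get?_ofList_append_right _ _ n)

/-- The junction letter has number `|α|` in the cone and stands in the place of `τ_R`, which has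
number `|ρ|` in the string; this fixes the shift. -/
theorem cone_letterAt_of_gt {i : ℤ} (h : o.α.length < i) :
    o.cone.letterAt i = o.string.letterAt (i - o.α.length + o.ρ.length) := by
  obtain ⟨n, rfl⟩ : ∃ n : ℕ, i = o.α.length + (n + 1 : ℕ) := ⟨(i - o.α.length - 1).toNat, by omega⟩
  rw [cone_letterAt_right, junction_get?_succ, ← string_letterAt_right]
  congr 1
  ring

theorem cone_letterAt_of_lt {i : ℤ} (h : i < -o.β.length - 1) :
    o.cone.letterAt i = o.string.letterAt (i + o.β.length) := by
  obtain ⟨n, rfl⟩ : ∃ n : ℕ, i = -o.β.length - 1 - (n + 1 : ℕ) :=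
    ⟨(-i - o.β.length - 2).toNat, by omega⟩
  rw [cone_letterAt_left, junction_get?_succ, ← string_letterAt_left]
  congr 1
  ring

theorem head_rightEnd : o.rightEnd.head = o.string.letterAt o.ρ.length := by
  change o.rightEnd.get? 0 = _
  simpa using (o.string_letterAt_right 0).symm

theorem head_leftEnd : o.leftEnd.head = (o.string.letterAt (-1)).map Letter.bar := by
  have h := o.string_letterAt_left 0
  rw [Nat.cast_zero, sub_zero] at h
  rw [h, Option.map_map]
  change o.leftEnd.get? 0 = _
  cases o.leftEnd.get? 0 <;> simp

theorem cone_letterAt_junction_right : o.cone.letterAt o.α.length =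
    (o.string.letterAt o.ρ.length).map (junctionLetter o.σR o.fR) := by
  have h := o.cone_letterAt_right 0
  rwa [Nat.cast_zero, add_zero, junction_get?_zero, head_rightEnd] at h

theorem cone_letterAt_junction_left : o.cone.letterAt (-o.β.length - 1) =
    (o.string.letterAt (-1)).map (fun t => (junctionLetter o.σL.bar o.fL t.bar).bar) := by
  have h := o.cone_letterAt_left 0
  rwa [Nat.cast_zero, sub_zero, junction_get?_zero, head_leftEnd, Option.map_map, Option.map_map]
    at h

end Overlap

end OverlapLetters
-- The word of the cone is a homotopy string
section ConeString

variable {Q : Type u} [Quiver.{u} Q] {R : Quiver.Total Q → Quiver.Total Q → Prop}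

theorem StringData.eventuallyAntipath_of_eventually_eq {s t : Stream'.Seq (Letter Q)} {p q : ℕ}
    (h : StringData.EventuallyAntipath s) (hst : ∀ n, t.get? (n + p) = s.get? (n + q)) :
    StringData.EventuallyAntipath t := by
  obtain ⟨N, hN⟩ := h
  refine ⟨N + p, fun n hn l hl => hN (n - p + q) (by omega) l ?_⟩
  rw [← hst, Nat.sub_add_cancel (by omega), hl]

namespace Overlap

variable {o : Overlap Q}

theorem Endpoints.endCond_right (h : o.Endpoints) {t : Letter Q}
    (ht : o.string.letterAt o.ρ.length = some t) : EndCond o.σR (some t) o.fR := by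
  have := h.right
  rwa [head_rightEnd, ht] at this

theorem Endpoints.endCond_left (h : o.Endpoints) {t : Letter Q}
    (ht : o.string.letterAt (-1) = some t) : EndCond o.σL.bar (some t.bar) o.fL := by
  have := h.left
  rwa [head_leftEnd, ht] at this

theorem Endpoints.fR_eq_none (h : o.Endpoints) (ht : o.string.letterAt o.ρ.length = none) :
    o.fR = none := by
  have := h.right
  rw [head_rightEnd, ht] at this
  generalize o.fR = f at this ⊢
  cases this
  rfl

theorem Endpoints.fL_eq_none (h : o.Endpoints) (ht : o.string.letterAt (-1) = none) :
    o.fL = none := by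
  have := h.left
  rw [head_leftEnd, ht] at this
  generalize o.fL = f at this ⊢
  cases this
  rfl

theorem EndCond_none {s t : Letter Q} (h : EndCond s (some t) none) :
    s.isInv = false ∧ t.isInv = true := by
  cases h with
  | rg3 _ hs ht => exact ⟨hs, ht⟩

theorem bandLetter_zero_lft : (o.bandLetter 0).lft = o.cone.base := by
  have hN := o.length_word
  have h := o.getElem?_word (n := 0) (by omega)
  rw [Nat.cast_zero] at h
  have h1 : o.band.word[0]? = some ((o.β ++ [o.σL]).head (by simp)) := by
    rw [← List.head?_eq_some_head, List.head?_eq_getElem?]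
    simp only [band]
    rcases Nat.eq_zero_or_pos o.β.length with h | h
    · simp [List.length_eq_zero_iff.1 h]
    · rw [List.getElem?_append_left h, List.getElem?_append_left h]
  rw [h] at h1
  rw [Option.some_injective _ h1]
  rfl

variable (hσ : IsHomotopyBand R o.band.word)
include hσ

theorem follows_σR : Follows R o.σR (o.bandLetter (-o.α.length)) := by
  have h := o.follows_bandLetter hσ (o.β.length + 1 + o.ρ.length)
  rw [bandLetter_σR] at h
  rw [← o.bandLetter_add_length]
  convert h using 2
  have := o.length_word
  omega

theorem follows_σL : Follows R (o.bandLetter (o.β.length - 1)) o.σL := by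
  have h := o.follows_bandLetter hσ (o.β.length - 1)
  rwa [sub_add_cancel, bandLetter_σL] at h

theorem isNonzeroPath_bandLetter (j : ℤ) : IsNonzeroPath R (o.bandLetter j).arrows :=
  hσ.letter _ (o.bandLetter_mem j)

theorem isNonzeroPath_σR : IsNonzeroPath R o.σR.arrows := by
  rw [← bandLetter_σR]; exact isNonzeroPath_bandLetter hσ _

theorem isNonzeroPath_σL : IsNonzeroPath R o.σL.arrows := by
  rw [← bandLetter_σL]; exact isNonzeroPath_bandLetter hσ _

variable (hR : IsGentle R) (hτ : o.string.IsHomotopyString R)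
  (hend : o.Endpoints) (hcomp : o.Compatible R)
include hR hτ hend hcomp

/-- Only the composed path under (RG3) is in question. By `nonzero_of_follows` it is nonzero once a
single letter precedes both `σ_R` and `τ_R`. This is the last letter of `ρ` or, if `ρ` is trivial
and `f_L` exists, the letter `σ_L`, which has the same arrow as `τ_L` at the end facing `ρ`. In the
remaining case the map is concentrated in one degree and compatibility applies. -/
theorem isNonzeroPath_junction_right {t : Letter Q} (ht : o.string.letterAt o.ρ.length = some t) :
    IsNonzeroPath R (junctionLetter o.σR o.fR t).arrows := by
  have hE := hend.endCond_right ht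
  refine hE.isNonzeroPath_junctionLetter (isNonzeroPath_σR hσ) (hτ.letter _ _ ht) fun hfR => ?_
  rw [hfR] at hE
  obtain ⟨hs, hti⟩ := EndCond_none hE
  rcases Nat.eq_zero_or_pos o.ρ.length with h0 | h0
  · rcases hfL : o.fL with _ | f
    · exact (hcomp (List.length_eq_zero_iff.1 h0) hfL hfR).2 t (by rw [head_rightEnd, ht])
    · rcases htL : o.string.letterAt (-1) with _ | tL
      · simp [hend.fL_eq_none htL] at hfL
      · have hEL := hend.endCond_left htL
        rw [hfL] at hEL
        rw [h0, Nat.cast_zero] at ht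
        have h1 : Follows R o.σL t := by
          have := hEL.follows_of_component (by simpa [string] using hτ.base_left _ htL)
            (hτ.follows (-1) _ _ htL ht).bar
          simpa using this.bar
        have h2 := o.follows_bandLetter hσ o.β.length
        rw [bandLetter_σL, show (o.β.length + 1 : ℤ) = o.β.length + 1 + o.ρ.length by omega,
          bandLetter_σR] at h2
        exact hR.nonzero_of_follows hs hti h2 h1 (isNonzeroPath_σR hσ) (hτ.letter _ _ ht)
  · have h1 := hτ.follows (o.ρ.length - 1) _ _ (o.string_letterAt_ρ (by omega) (by omega))
      (by rw [sub_add_cancel]; exact ht)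
    have h2 := o.follows_bandLetter hσ (o.β.length + 1 + (o.ρ.length - 1))
    rw [show (o.β.length + 1 + (o.ρ.length - 1) + 1 : ℤ) = o.β.length + 1 + o.ρ.length by ring,
      bandLetter_σR] at h2
    exact hR.nonzero_of_follows hs hti h2 h1 (isNonzeroPath_σR hσ) (hτ.letter _ _ ht)

theorem isNonzeroPath_junction_left {t : Letter Q} (ht : o.string.letterAt (-1) = some t) :
    IsNonzeroPath R (junctionLetter o.σL.bar o.fL t.bar).arrows := by
  have hE := hend.endCond_left ht
  refine hE.isNonzeroPath_junctionLetter (isNonzeroPath_σL hσ)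
    (hτ.letter (-1) t ht) fun hfL => ?_
  rw [hfL] at hE
  obtain ⟨hs, hti⟩ := EndCond_none hE
  rcases Nat.eq_zero_or_pos o.ρ.length with h0 | h0
  · rcases hfR : o.fR with _ | f
    · exact (hcomp (List.length_eq_zero_iff.1 h0) hfL hfR).1 t.bar (by rw [head_leftEnd, ht]; rfl)
    · rcases htR : o.string.letterAt o.ρ.length with _ | tR
      · simp [hend.fR_eq_none htR] at hfR
      · have hER := hend.endCond_right htR
        rw [hfR] at hER
        rw [h0, Nat.cast_zero] at htR
        have h2 := o.follows_bandLetter hσ o.β.length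
        rw [bandLetter_σL, show (o.β.length + 1 : ℤ) = o.β.length + 1 + o.ρ.length by omega,
          bandLetter_σR] at h2
        have h1 : Follows R t o.σR :=
          hER.follows_of_component ((hτ.base_right _ htR).trans h2.1)
            (hτ.follows (-1) _ _ ht htR)
        exact hR.nonzero_of_follows hs hti h2.bar h1.bar (isNonzeroPath_σL hσ) (hτ.letter (-1) t ht)
  · have h1 := hτ.follows (-1) _ _ ht (o.string_letterAt_ρ (by omega) (by omega))
    have h2 := o.follows_bandLetter hσ o.β.length
    rw [bandLetter_σL] at h2
    rw [show (o.β.length + 1 + (-1 + 1) : ℤ) = o.β.length + 1 by ring] at h1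
    exact hR.nonzero_of_follows hs hti h2.bar h1.bar (isNonzeroPath_σL hσ) (hτ.letter (-1) t ht)

/-- The word of the cone is a homotopy string. -/
theorem cone_isHomotopyString : o.cone.IsHomotopyString R where
  letter i l hl := by
    rcases lt_trichotomy i (-o.β.length - 1) with h | rfl | h
    · rw [cone_letterAt_of_lt _ h] at hl
      exact hτ.letter _ _ hl
    · rw [cone_letterAt_junction_left] at hl
      obtain ⟨t, ht, rfl⟩ := Option.map_eq_some_iff.1 hl
      exact isNonzeroPath_junction_left hσ hR hτ hend hcomp ht
    rcases lt_trichotomy i o.α.length with h' | rfl | h'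
    · rw [cone_letterAt_mid _ (by omega) h'] at hl
      cases hl
      exact isNonzeroPath_bandLetter hσ _
    · rw [cone_letterAt_junction_right] at hl
      obtain ⟨t, ht, rfl⟩ := Option.map_eq_some_iff.1 hl
      exact isNonzeroPath_junction_right hσ hR hτ hend hcomp ht
    · rw [cone_letterAt_of_gt _ h'] at hl
      exact hτ.letter _ _ hl
  follows i l l' hl hl' := by
    rcases lt_trichotomy i (-o.β.length - 1) with h | rfl | h
    · rw [cone_letterAt_of_lt _ h] at hl
      rcases eq_or_ne (i + 1) (-o.β.length - 1) with e | e
      · rw [e, cone_letterAt_junction_left] at hl'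
        obtain ⟨t, ht, rfl⟩ := Option.map_eq_some_iff.1 hl'
        have h1 := hτ.follows _ l t hl (by rwa [show i + o.β.length + 1 = -1 by omega])
        have h2 := (hend.endCond_left ht).junctionLetter_follows hR (isNonzeroPath_σL hσ) h1.bar
        simpa using h2.bar
      · rw [cone_letterAt_of_lt _ (by omega)] at hl'
        exact hτ.follows _ l l' hl (by rwa [show i + o.β.length + 1 = i + 1 + o.β.length by ring])
    · rw [cone_letterAt_junction_left] at hl
      obtain ⟨t, ht, rfl⟩ := Option.map_eq_some_iff.1 hl
      rw [sub_add_cancel] at hl'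
      -- If `α` and `β` are both empty, the two junction letters are neighbours. The right one then
      -- meets `σ̄_L` because in the cyclic word `σ_R` is followed by `σ_L`.
      have key : Follows R o.σL.bar l' := by
        rcases (show -(o.β.length : ℤ) ≤ o.α.length by omega).lt_or_eq with h | h
        · rw [cone_letterAt_mid _ le_rfl h, neg_neg] at hl'
          cases hl'
          exact (follows_σL hσ).bar
        · rw [h, cone_letterAt_junction_right] at hl'
          obtain ⟨t', ht', rfl⟩ := Option.map_eq_some_iff.1 hl'
          refine (hend.endCond_right ht').follows_junctionLetter hR (hτ.letter _ _ ht') ?_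
          have h1 := follows_σR hσ
          rwa [show (-o.α.length : ℤ) = o.β.length by omega, bandLetter_σL] at h1
      have h2 := (hend.endCond_left ht).follows_junctionLetter hR
        (hτ.letter (-1) t ht) key
      simpa using h2.bar
    rcases lt_trichotomy i o.α.length with h' | rfl | h'
    · rw [cone_letterAt_mid _ (by omega) h'] at hl
      cases hl
      rcases (show i + 1 ≤ o.α.length by omega).lt_or_eq with e | e
      · rw [cone_letterAt_mid _ (by omega) e] at hl'
        cases hl'
        have h1 := (o.follows_bandLetter hσ (-(i + 1) - 1)).bar
        rwa [show -(i + 1) - 1 + 1 = -i - 1 by ring] at h1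
      · rw [e, cone_letterAt_junction_right] at hl'
        obtain ⟨t', ht', rfl⟩ := Option.map_eq_some_iff.1 hl'
        refine (hend.endCond_right ht').follows_junctionLetter hR (hτ.letter _ _ ht') ?_
        have h1 := follows_σR hσ
        rwa [← e, show -(i + 1) = -i - 1 by ring] at h1
    · rw [cone_letterAt_junction_right] at hl
      obtain ⟨t, ht, rfl⟩ := Option.map_eq_some_iff.1 hl
      rw [cone_letterAt_of_gt _ (by omega)] at hl'
      have h1 := hτ.follows _ t l' ht (by convert hl' using 2; ring)
      exact (hend.endCond_right ht).junctionLetter_follows hR (isNonzeroPath_σR hσ) h1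
    · rw [cone_letterAt_of_gt _ h'] at hl
      rw [cone_letterAt_of_gt _ (by omega)] at hl'
      exact hτ.follows _ l l' hl (by convert hl' using 2; ring)
  base_right l hl := by
    have h1 := o.follows_bandLetter hσ (-1)
    rw [← bandLetter_zero_lft, ← show (o.bandLetter (-1)).rgt = (o.bandLetter 0).lft from h1.1]
    rcases Nat.eq_zero_or_pos o.α.length with e | e
    · rw [show (0 : ℤ) = o.α.length by omega, cone_letterAt_junction_right] at hl
      obtain ⟨t, ht, rfl⟩ := Option.map_eq_some_iff.1 hl
      rw [(hend.endCond_right ht).junctionLetter_lft (hτ.letter _ _ ht), (follows_σR hσ).1, e,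
        show -((0 : ℕ) : ℤ) = 0 from rfl]
      exact h1.1.symm
    · rw [cone_letterAt_mid _ (by omega) (by omega)] at hl
      cases hl
      simp
  base_left l hl := by
    rw [← bandLetter_zero_lft]
    rcases Nat.eq_zero_or_pos o.β.length with e | e
    · rw [show (-1 : ℤ) = -o.β.length - 1 by omega, cone_letterAt_junction_left] at hl
      obtain ⟨t, ht, rfl⟩ := Option.map_eq_some_iff.1 hl
      have h2 := o.bandLetter_σL
      rw [e, Nat.cast_zero] at h2
      rw [Letter.bar_rgt, (hend.endCond_left ht).junctionLetter_lft
        (hτ.letter (-1) t ht), h2, Letter.bar_rgt]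
    · rw [cone_letterAt_mid _ (by omega) (by omega)] at hl
      cases hl
      simp
  antipath_left := by
    refine StringData.eventuallyAntipath_of_eventually_eq (p := o.β.length + 1) (q := 1)
      hτ.antipath_left fun n => ?_
    have h := get?_ofList_append_right o.β (junction o.σL.bar o.fL o.leftEnd) (n + 1)
    rw [junction_get?_succ] at h
    rw [show n + (o.β.length + 1) = o.β.length + (n + 1) by omega]
    exact h
  antipath_right := by
    refine StringData.eventuallyAntipath_of_eventually_eq (p := o.α.length + 1)
      (q := o.ρ.length + 1) hτ.antipath_right fun n => ?_
    have h := get?_ofList_append_right (o.α.reverse.map Letter.bar)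
      (junction o.σR o.fR o.rightEnd) (n + 1)
    rw [junction_get?_succ, List.length_map, List.length_reverse] at h
    have h' := get?_ofList_append_right o.ρ o.rightEnd (n + 1)
    rw [show n + (o.α.length + 1) = o.α.length + (n + 1) by omega,
      show n + (o.ρ.length + 1) = o.ρ.length + (n + 1) by omega]
    exact h.trans h'.symm

end Overlap

end ConeString
-- Vertices and degrees of band, string and cone
section Positions

variable {Q : Type u} [Quiver.{u} Q] {R : Quiver.Total Q → Quiver.Total Q → Prop}

namespace StringData

variable (S : StringData Q)

theorem isVertex_of_pos {i : ℤ} (h : 0 < i) : S.IsVertex i ↔ (S.letterAt (i - 1)).isSome := by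
  obtain ⟨n, rfl⟩ : ∃ n : ℕ, i = Int.ofNat (n + 1) := ⟨(i - 1).toNat, by simp; omega⟩
  rw [show Int.ofNat (n + 1) - 1 = (n : ℤ) by simp]
  rfl

theorem isVertex_of_neg {i : ℤ} (h : i < 0) : S.IsVertex i ↔ (S.letterAt i).isSome := by
  obtain ⟨n, rfl⟩ : ∃ n : ℕ, i = Int.negSucc n := ⟨(-i - 1).toNat, by omega⟩
  simp [IsVertex, letterAt]

/-- Missing letters count as sign zero, so the degree function extends past the ends of a finite
string and the recursion holds for all integers. -/
theorem deg_add_one (i : ℤ) :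
    S.deg (i + 1) = S.deg i + ((S.letterAt i).map Letter.sgn).getD 0 := by
  obtain ⟨n, rfl⟩ | ⟨n, rfl⟩ : (∃ n : ℕ, i = Int.ofNat n) ∨ ∃ n : ℕ, i = Int.negSucc n := by
    cases i <;> simp
  · rw [show Int.ofNat n + 1 = Int.ofNat (n + 1) from rfl]
    simp only [deg, letterAt, Finset.sum_range_succ, add_assoc]
  · have e : S.deg (Int.negSucc n + 1) =
        S.baseDeg + ∑ j ∈ Finset.range n, ((S.left.get? j).map Letter.sgn).getD 0 := by
      cases n with
      | zero => simp [deg]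
      | succ n => rw [show Int.negSucc (n + 1) + 1 = Int.negSucc n by omega]; rfl
    rw [e]
    simp only [deg, letterAt, Finset.sum_range_succ]
    cases S.left.get? n
    · simp
    · simp [← add_assoc]

variable {S}

theorem vtx_of_letterAt {i : ℤ} {l : Letter Q} (h : S.letterAt i = some l) : S.vtx i = l.lft := by
  rw [vtx, h]

theorem IsHomotopyString.vtx_add_one (hS : S.IsHomotopyString R) {i : ℤ} {l : Letter Q}
    (h : S.letterAt i = some l) : S.vtx (i + 1) = l.rgt := by
  rw [vtx]
  rcases h' : S.letterAt (i + 1) with _ | m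
  · simp [h]
  · exact (hS.follows _ _ _ h h').1.symm

theorem IsHomotopyString.vtx_zero (hS : S.IsHomotopyString R) : S.vtx 0 = S.base := by
  rw [vtx]
  rcases h' : S.letterAt 0 with _ | m
  · rcases h'' : S.letterAt (0 - 1) with _ | m
    · rfl
    · exact hS.base_left _ h''
  · exact hS.base_right _ h'

end StringData

theorem sum_map_sgn (l : List (Letter Q)) : (l.map Letter.sgn).sum =
    (l.countP (fun l => !l.isInv) : ℤ) - l.countP (fun l => l.isInv) := by
  induction l with
  | nil => simp
  | cons a l ih =>
    rw [List.map_cons, List.sum_cons, ih, List.countP_cons, List.countP_cons]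
    cases h : a.isInv <;> simp [Letter.sgn, h] <;> ring

/-- Used to compare gradings: degree functions that agree at one vertex and change by the same signs
along the letters agree on the whole interval. -/
theorem eq_of_eq_differences {F G : ℤ → ℤ} {a b c : ℤ} (hac : a ≤ c) (hcb : c ≤ b) (hc : F c = G c)
    (h : ∀ i, a ≤ i → i < b → F (i + 1) - F i = G (i + 1) - G i) {i : ℤ} (hai : a ≤ i)
    (hib : i ≤ b) : F i = G i := by
  rcases le_total c i with hi | hi
  · induction i, hi using Int.leInduction with
    | base => exact hc
    | succ j hj ih =>
      have := ih (by omega) (by omega)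
      have := h j (by omega) (by omega)
      omega
  · induction i, hi using Int.leInductionDown with
    | base => exact hc
    | pred j hj ih =>
      have := ih (by omega) (by omega)
      have := h (j - 1) (by omega) (by omega)
      rw [sub_add_cancel] at this
      omega

namespace Overlap

variable (o : Overlap Q)

/-- The vertices of the band, numbered periodically. -/
def bandVertex (j : ℤ) : ℕ := (j % o.band.word.length).toNat

theorem bandVertex_lt (j : ℤ) : o.bandVertex j < o.band.word.length := by
  have := o.length_word
  have := Int.emod_lt_of_pos j (b := o.band.word.length) (by omega)
  have := Int.emod_nonneg j (b := o.band.word.length) (by omega)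
  unfold bandVertex
  omega

theorem bandVertex_add_length (j : ℤ) :
    o.bandVertex (j + o.band.word.length) = o.bandVertex j := by
  simp [bandVertex]

theorem bandVertex_natCast {n : ℕ} (h : n < o.band.word.length) : o.bandVertex n = n := by
  rw [bandVertex, Int.emod_eq_of_lt (by omega) (by omega), Int.toNat_natCast]

theorem getElem?_bandVertex (j : ℤ) :
    o.band.word[o.bandVertex j]? = some (o.bandLetter j) := by
  have h := o.bandVertex_lt j
  rw [List.getElem?_eq_getElem h]
  unfold bandLetter
  rw [List.getD_eq_getElem _ _ (show (j % o.band.word.length).toNat < _ from h)]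
  rfl

theorem bandVertex_add_one (j : ℤ) :
    o.bandVertex (j + 1) = (o.bandVertex j + 1) % o.band.word.length := by
  have := o.length_word
  have h := Int.emod_nonneg j (b := o.band.word.length) (by omega)
  have h' := Int.emod_nonneg (j + 1) (b := o.band.word.length) (by omega)
  unfold bandVertex
  zify
  rw [Int.toNat_of_nonneg h, Int.toNat_of_nonneg h']
  simp

theorem bandVertex_sub_one (j : ℤ) :
    o.bandVertex (j - 1) =
      (o.bandVertex j + o.band.word.length - 1) % o.band.word.length := by
  have := o.length_word
  have h := Int.emod_nonneg j (b := o.band.word.length) (by omega)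
  have h' := Int.emod_nonneg (j - 1) (b := o.band.word.length) (by omega)
  unfold bandVertex
  rw [Nat.add_sub_assoc (by omega)]
  zify
  rw [Int.toNat_of_nonneg h, Int.toNat_of_nonneg h', Nat.cast_sub (by omega)]
  simp [← add_sub_assoc, Int.sub_emod]

variable {o}

/-- At the last letter the numbering returns to `0`; there the claim holds because a band has as
many direct as inverse letters. -/
theorem deg_bandVertex_add_one (hσ : IsHomotopyBand R o.band.word) (j : ℤ) :
    o.band.deg (o.bandVertex (j + 1)) = o.band.deg (o.bandVertex j) + (o.bandLetter j).sgn := by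
  have h := o.getElem?_bandVertex j
  have hlt := o.bandVertex_lt j
  have h1 : o.band.deg (o.bandVertex j + 1) =
      o.band.deg (o.bandVertex j) + (o.bandLetter j).sgn := by
    unfold BandData.deg
    rw [List.take_add_one, h]
    simp [add_assoc]
  rw [← h1, bandVertex_add_one]
  rcases (show o.bandVertex j + 1 ≤ o.band.word.length by omega).lt_or_eq with h2 | h2
  · rw [Nat.mod_eq_of_lt h2]
  · rw [h2, Nat.mod_self]
    simp [BandData.deg, sum_map_sgn, hσ.balanced]

section

variable (hσ : IsHomotopyBand R o.band.word)
include hσ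

theorem string_deg_ρ {j : ℤ} (h0 : 0 ≤ j) (h1 : j ≤ o.ρ.length) :
    o.string.deg j = o.band.deg (o.bandVertex (o.β.length + 1 + j)) := by
  have := o.length_word
  refine eq_of_eq_differences (F := o.string.deg)
    (G := fun j => o.band.deg (o.bandVertex (o.β.length + 1 + j))) (a := 0) (b := o.ρ.length)
    (c := 0) le_rfl (by omega) ?_ ?_ h0 h1
  · simp only [add_zero]
    rw [← Nat.cast_one, ← Nat.cast_add, bandVertex_natCast _ (by omega)]
    simp [StringData.deg, string]
  · intro i h2 h3
    rw [StringData.deg_add_one, string_letterAt_ρ _ h2 h3, ← add_assoc,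
      deg_bandVertex_add_one hσ]
    simp

theorem cone_deg_mid {i : ℤ} (h0 : -o.β.length ≤ i) (h1 : i ≤ o.α.length) :
    o.cone.deg i = o.band.deg (o.bandVertex (-i)) - 1 := by
  have := o.length_word
  refine eq_of_eq_differences (F := o.cone.deg)
    (G := fun j => o.band.deg (o.bandVertex (-j)) - 1) (a := -o.β.length) (b := o.α.length)
    (c := 0) (by omega) (by omega) ?_ ?_ h0 h1
  · rw [neg_zero, show (0 : ℤ) = (0 : ℕ) from rfl, bandVertex_natCast _ (by omega)]
    simp [StringData.deg, cone, BandData.deg, band]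
  · intro i h2 h3
    have h := deg_bandVertex_add_one hσ (-(i + 1))
    rw [show -(i + 1) + 1 = -i by ring] at h
    rw [StringData.deg_add_one, cone_letterAt_mid _ h2 h3, h, show -(i + 1) = -i - 1 by ring]
    simp

variable (hend : o.Endpoints)
include hend

/-- It suffices to cross the junction. There the sign of `σ_R` plus the sign of the junction letter
minus the shift `1` equals the sign of `τ_R` under each endpoint condition; empty letters count as
zero. -/
theorem cone_deg_of_gt {i : ℤ} (h : o.α.length < i) :
    o.cone.deg i = o.string.deg (i - o.α.length + o.ρ.length) := by
  refine eq_of_eq_differences (F := o.cone.deg)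
    (G := fun i => o.string.deg (i - o.α.length + o.ρ.length)) (a := o.α.length + 1) (b := i)
    (c := o.α.length + 1) le_rfl (by omega) ?_ ?_ h le_rfl
  · rw [show (o.α.length + 1 - o.α.length + o.ρ.length : ℤ) = o.ρ.length + 1 by ring,
      StringData.deg_add_one, StringData.deg_add_one, cone_letterAt_junction_right,
      string_deg_ρ hσ (by omega) le_rfl, cone_deg_mid hσ (by omega) le_rfl]
    have e : o.band.deg (o.bandVertex (-o.α.length)) =
        o.band.deg (o.bandVertex (o.β.length + 1 + o.ρ.length)) + o.σR.sgn := by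
      rw [← bandLetter_σR, ← deg_bandVertex_add_one hσ, ← bandVertex_add_length]
      congr 2
      have := o.length_word
      omega
    rw [e]
    have hE := hend.right
    rw [head_rightEnd] at hE
    generalize o.string.letterAt o.ρ.length = t at hE ⊢
    generalize o.fR = f at hE ⊢
    generalize o.σR = s at hE ⊢
    cases hE with
    | rg1 t f hs ht hf h => simp [junctionLetter, Letter.sgn, hs, ht, hf]
    | rg2 t f hs ht hf h => simp [junctionLetter, Letter.sgn, hs, ht, hf]
    | rg3 t hs ht => simp [junctionLetter, Letter.sgn, hs, ht]
    | rg3_empty hs => simp [Letter.sgn, hs]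
  · intro j h1 h2
    rw [StringData.deg_add_one, cone_letterAt_of_gt _ (by omega),
      show j + 1 - o.α.length + o.ρ.length = j - o.α.length + o.ρ.length + 1 by ring,
      StringData.deg_add_one]
    ring

theorem cone_deg_of_lt {i : ℤ} (h : i < -o.β.length) :
    o.cone.deg i = o.string.deg (i + o.β.length) := by
  refine eq_of_eq_differences (F := o.cone.deg)
    (G := fun i => o.string.deg (i + o.β.length)) (a := i) (b := -o.β.length - 1)
    (c := -o.β.length - 1) (by omega) le_rfl ?_ ?_ le_rfl (by omega)
  · have h1 := o.cone.deg_add_one (-o.β.length - 1)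
    have h2 := o.string.deg_add_one (-1)
    have e := deg_bandVertex_add_one hσ o.β.length
    rw [sub_add_cancel, cone_deg_mid hσ le_rfl (by omega), cone_letterAt_junction_left,
      neg_neg] at h1
    rw [neg_add_cancel, string_deg_ρ hσ le_rfl (by omega), add_zero, e, bandLetter_σL] at h2
    -- The left junction is read from right to left, so the endpoint condition concerns `σ̄_L` and
    -- `τ̄_L`, and the signs of both letters are negated.
    rw [show (-o.β.length - 1 + o.β.length : ℤ) = -1 by ring]
    have hE := hend.left
    rw [head_leftEnd] at hE
    generalize o.string.letterAt (-1) = t at hE h1 h2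
    generalize o.fL = f at hE h1
    generalize hs : o.σL.bar = s at hE h1
    rw [show o.σL.sgn = -s.sgn by simp [← hs]] at h2
    generalize h3 : t.map Letter.bar = t' at hE
    obtain rfl : t'.map Letter.bar = t := by rw [← h3]; cases t <;> simp
    cases hE with
    | rg1 t f hs ht hf h =>
      simp [junctionLetter, Letter.sgn, hs, ht, hf] at h1 h2; omega
    | rg2 t f hs ht hf h => simp [junctionLetter, Letter.sgn, hs, ht, hf] at h1 h2; omega
    | rg3 t hs ht => simp [junctionLetter, Letter.sgn, hs, ht] at h1 h2; omega
    | rg3_empty hs => simp [Letter.sgn, hs] at h1 h2; omega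
  · intro j h1 h2
    rw [StringData.deg_add_one, cone_letterAt_of_lt _ (by omega),
      show j + 1 + (o.β.length : ℤ) = j + o.β.length + 1 by ring,
      StringData.deg_add_one]
    ring

end

section

theorem string_isVertex_ρ {j : ℤ} (h0 : 0 ≤ j) (h1 : j ≤ o.ρ.length) : o.string.IsVertex j := by
  rcases h0.eq_or_lt with rfl | h
  · trivial
  · rw [StringData.isVertex_of_pos _ h, string_letterAt_ρ _ (by omega) (by omega)]
    rfl

theorem cone_isVertex_mid {i : ℤ} (h0 : -o.β.length ≤ i) (h1 : i ≤ o.α.length) :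
    o.cone.IsVertex i := by
  rcases lt_trichotomy i 0 with h | rfl | h
  · rw [StringData.isVertex_of_neg _ h, cone_letterAt_mid _ (by omega) (by omega)]
    rfl
  · trivial
  · rw [StringData.isVertex_of_pos _ h, cone_letterAt_mid _ (by omega) (by omega)]
    rfl

theorem cone_isVertex_of_gt {i : ℤ} (h : o.α.length < i) :
    o.cone.IsVertex i ↔ o.string.IsVertex (i - o.α.length + o.ρ.length) := by
  rw [StringData.isVertex_of_pos _ (by omega), StringData.isVertex_of_pos _ (by omega)]
  rcases eq_or_ne (i - 1) o.α.length with e | e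
  · rw [e, cone_letterAt_junction_right, Option.isSome_map,
      show i - o.α.length + o.ρ.length - 1 = o.ρ.length by omega]
  · rw [cone_letterAt_of_gt _ (by omega),
      show i - o.α.length + o.ρ.length - 1 = i - 1 - o.α.length + o.ρ.length by ring]

theorem cone_isVertex_of_lt {i : ℤ} (h : i < -o.β.length) :
    o.cone.IsVertex i ↔ o.string.IsVertex (i + o.β.length) := by
  rw [StringData.isVertex_of_neg _ (by omega), StringData.isVertex_of_neg _ (by omega)]
  rcases eq_or_ne i (-o.β.length - 1) with rfl | e
  · rw [cone_letterAt_junction_left, Option.isSome_map,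
      show (-o.β.length - 1 + o.β.length : ℤ) = -1 by ring]
  · rw [cone_letterAt_of_lt _ (by omega)]

theorem string_vtx_ρ (hσ : IsHomotopyBand R o.band.word) (hτ : o.string.IsHomotopyString R) {j : ℤ}
    (h0 : 0 ≤ j) (h1 : j ≤ o.ρ.length) :
    o.string.vtx j = (o.bandLetter (o.β.length + 1 + j)).lft := by
  rcases h0.eq_or_lt with rfl | h
  · rw [hτ.vtx_zero, add_zero, ← (o.follows_bandLetter hσ _).1, bandLetter_σL]
    rfl
  · have h2 := hτ.vtx_add_one (o.string_letterAt_ρ (j := j - 1) (by omega) (by omega))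
    rw [sub_add_cancel] at h2
    rw [h2, (o.follows_bandLetter hσ _).1]
    congr 2
    ring

theorem cone_vtx_mid (hσ : IsHomotopyBand R o.band.word) (hc : o.cone.IsHomotopyString R) {i : ℤ}
    (h0 : -o.β.length ≤ i) (h1 : i ≤ o.α.length) :
    o.cone.vtx i = (o.bandLetter (-i)).lft := by
  rcases h0.eq_or_lt with e | h
  · rcases h1.lt_or_eq with h | h
    · rw [StringData.vtx_of_letterAt (o.cone_letterAt_mid h0 h), Letter.bar_lft,
        (o.follows_bandLetter hσ _).1, sub_add_cancel]
    · obtain rfl : i = 0 := by omega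
      rw [hc.vtx_zero, neg_zero, bandLetter_zero_lft]
  · have h2 := hc.vtx_add_one (o.cone_letterAt_mid (i := i - 1) (by omega) (by omega))
    rw [sub_add_cancel] at h2
    rw [h2, Letter.bar_rgt]
    congr 2
    ring

variable (hσ : IsHomotopyBand R o.band.word) (hτ : o.string.IsHomotopyString R)
  (hend : o.Endpoints) (hc : o.cone.IsHomotopyString R)
include hσ hτ hend hc

theorem cone_vtx_of_gt {i : ℤ} (h : o.α.length < i) (hi : o.cone.IsVertex i) :
    o.cone.vtx i = o.string.vtx (i - o.α.length + o.ρ.length) := by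
  rw [StringData.isVertex_of_pos _ (by omega), Option.isSome_iff_exists] at hi
  obtain ⟨l, hl⟩ := hi
  have h1 := hc.vtx_add_one hl
  rw [sub_add_cancel] at h1
  rw [h1]
  rcases eq_or_ne (i - 1) o.α.length with e | e
  · rw [e, cone_letterAt_junction_right] at hl
    obtain ⟨t, ht, rfl⟩ := Option.map_eq_some_iff.1 hl
    rw [(hend.endCond_right ht).junctionLetter_rgt (isNonzeroPath_σR hσ), ← hτ.vtx_add_one ht]
    congr 1
    omega
  · rw [cone_letterAt_of_gt _ (by omega)] at hl
    rw [← hτ.vtx_add_one hl]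
    congr 1
    ring

omit hτ hc in
theorem cone_vtx_of_lt {i : ℤ} (h : i < -o.β.length) (hi : o.cone.IsVertex i) :
    o.cone.vtx i = o.string.vtx (i + o.β.length) := by
  rw [StringData.isVertex_of_neg _ (by omega), Option.isSome_iff_exists] at hi
  obtain ⟨l, hl⟩ := hi
  rw [StringData.vtx_of_letterAt hl]
  rcases eq_or_ne i (-o.β.length - 1) with rfl | e
  · rw [cone_letterAt_junction_left] at hl
    obtain ⟨t, ht, rfl⟩ := Option.map_eq_some_iff.1 hl
    rw [Letter.bar_lft, (hend.endCond_left ht).junctionLetter_rgt (isNonzeroPath_σL hσ),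
      Letter.bar_rgt, ← StringData.vtx_of_letterAt ht]
    congr 1
    omega
  · rw [cone_letterAt_of_lt _ (by omega)] at hl
    rw [← StringData.vtx_of_letterAt hl]

end

end Overlap

end Positions
-- Differentials and matrices evaluated on generators
theorem Diagram.matMap_el_nil {A : Type u} [Ring A] {D D' : Diagram A}
    {m : D.V → List (D'.V × A)} {v : D.V} (hm : m v = []) (n n' : ℤ) (x : A) :
    matMap D D' m n n' (D.el n v x) = 0 := by
  by_cases h : D.mem v ∧ D.deg v = n
  · simp [matMap_el _ _ _ _ _ _ h, hm]
  · rw [el_eq_zero _ h, map_zero]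

/-- The inclusions, projections and partial inverse of the elimination each send a vertex to at most
one vertex with a unit coefficient. Outside the given degree both sides vanish, so no degree
hypothesis has to be carried along. -/
theorem Diagram.matMap_el_single {A : Type u} [Ring A] {S : Type*} [Monoid S] [MulAction S A]
    [SMulCommClass S A A] [IsScalarTower S A A]
    {D D' : Diagram A} {m : D.V → List (D'.V × A)} {v : D.V} {w : D'.V} {c : S}
    (hm : m v = [(w, c • (1 : A))]) {n n' : ℤ}
    (hidem : D.mem v → D.idem v = D'.idem w) (hw : D'.idem w * D'.idem w = D'.idem w)
    (h : D.mem v ∧ D.deg v = n ↔ D'.mem w ∧ D'.deg w = n') (x : A) :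
    matMap D D' m n n' (D.el n v x) = D'.el n' w (c • x) := by
  by_cases h' : D.mem v ∧ D.deg v = n
  · rw [matMap_el _ _ _ _ _ _ h', hm, hidem h'.1]
    simp only [List.map_cons, List.map_nil, List.sum_cons, List.sum_nil, add_zero, mul_smul_comm,
      mul_one]
    rw [← smul_mul_assoc, el_mul_idem _ _ _ hw]
  · rw [el_eq_zero _ h', el_eq_zero _ (h.not.1 h'), map_zero]

section Matrices

variable {Q : Type u} [Quiver.{u} Q] [Fintype Q] {k : Type u} [Field k]
  {R : Quiver.Total Q → Quiver.Total Q → Prop}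

variable (k R) in
/-- The path of a letter if it has the given direction, and zero otherwise. -/
def label (b : Bool) : Option (Letter Q) → BoundAlg k R
  | some l => if l.isInv = b then l.elt (arr k R) else 0
  | none => 0

theorem label_some {b : Bool} {l : Letter Q} (h : l.isInv = b) :
    label k R b (some l) = l.elt (arr k R) := if_pos h

theorem label_bar (b : Bool) (l : Letter Q) :
    label k R b (some l.bar) = label k R (!b) (some l) := by
  cases b <;> cases h : l.isInv <;> simp [label, h]

namespace StringData

variable (k R) in
/-- The element `x e_i` at the vertex `i` of a string. -/
def el (S : StringData Q) (n i : ℤ) : BoundAlg k R →ₗ[BoundAlg k R] (S.diagram k R).X n :=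
  (S.diagram k R).el n i

theorem el_eq_zero (S : StringData Q) {n i : ℤ} (h : ¬ (S.IsVertex i ∧ S.deg i = n))
    (x : BoundAlg k R) : S.el k R n i x = 0 :=
  Diagram.el_eq_zero (S.diagram k R) h x

theorem d_el (S : StringData Q) {n i : ℤ} (h : S.IsVertex i ∧ S.deg i = n) (n' : ℤ)
    (x : BoundAlg k R) :
    Diagram.matMap (S.diagram k R) (S.diagram k R) (S.diagram k R).out n n' (S.el k R n i x) =
      S.el k R n' (i + 1) (x * vert k R (S.vtx i) * label k R false (S.letterAt i)) +
      S.el k R n' (i - 1) (x * vert k R (S.vtx i) * label k R true (S.letterAt (i - 1))) := by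
  refine (Diagram.matMap_el (S.diagram k R) (S.diagram k R) (S.diagram k R).out n n' i h x).trans ?_
  have e : (S.diagram k R).out i =
    (match S.letterAt i with
      | some l => if l.isInv then [] else [(i + 1, l.elt (arr k R))]
      | none => []) ++
    (match S.letterAt (i - 1) with
      | some l => if l.isInv then [(i - 1, l.elt (arr k R))] else []
      | none => []) := rfl
  rw [e, List.map_append, List.sum_append]
  congr 1
  · rcases S.letterAt i with _ | l
    · simp [label]
    · cases hl : l.isInv <;> simp [label, hl]
      rfl
  · rcases S.letterAt (i - 1) with _ | l
    · simp [label]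
    · cases hl : l.isInv <;> simp [label, hl]
      rfl

end StringData

namespace Overlap

variable (o : Overlap Q) (lam : kˣ)

/-- The scalar of a letter of the band. -/
def weight (j : ℤ) : kˣ :=
  if (o.bandLetter j).isInv then 1 else if o.bandVertex j = o.pos then lam else 1

/-- The scalars of the components of a graph map, as units. -/
def unitScalar (i : ℕ) : kˣ := if o.β.length ≤ o.pos ∧ o.pos < i then lam⁻¹ else 1

theorem scalar_smul (i : ℕ) (x : BoundAlg k R) : o.scalar k lam i • x = o.unitScalar lam i • x := by
  unfold scalar unitScalar
  split_ifs <;> simp [Units.smul_def]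

variable (R) in
/-- The element `x e_j` at the vertex `j` of the band. -/
def bandEl (n j : ℤ) : BoundAlg k R →ₗ[BoundAlg k R] (o.band.diagram k R lam).X n :=
  (o.band.diagram k R lam).el n (o.bandVertex j)

theorem idem_bandVertex (j : ℤ) : (o.band.diagram k R lam).idem (o.bandVertex j) =
    vert k R (o.bandLetter j).lft := by
  change ((o.band.word[o.bandVertex j]?).map (fun l => vert k R l.lft)).getD 0 = _
  rw [getElem?_bandVertex]
  rfl

variable {o lam}

theorem bandEl_eq_zero {n j : ℤ} (h : o.band.deg (o.bandVertex j) ≠ n)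
    (x : BoundAlg k R) : o.bandEl R lam n j x = 0 :=
  Diagram.el_eq_zero (o.band.diagram k R lam) (fun h' => h h'.2) x

theorem bandEl_add_length (n j : ℤ) :
    o.bandEl R lam n (j + o.band.word.length) = o.bandEl R lam n j := by
  unfold bandEl
  rw [bandVertex_add_length]

theorem d_bandEl (hσ : IsHomotopyBand R o.band.word) (n j : ℤ) (x : BoundAlg k R) :
    Diagram.matMap (o.band.diagram k R lam) (o.band.diagram k R lam)
        (o.band.diagram k R lam).out n (n + 1) (o.bandEl R lam n j x) =
      o.bandEl R lam (n + 1) (j + 1) (x * vert k R (o.bandLetter j).lft *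
        (o.weight lam j • label k R false (some (o.bandLetter j)))) +
      o.bandEl R lam (n + 1) (j - 1) (x * vert k R (o.bandLetter j).lft *
        (o.weight lam (j - 1) • label k R true (some (o.bandLetter (j - 1))))) := by
  by_cases h : o.band.deg (o.bandVertex j) = n
  · refine (Diagram.matMap_el (o.band.diagram k R lam) (o.band.diagram k R lam) _ n (n + 1)
      (o.bandVertex j) ⟨o.bandVertex_lt j, h⟩ x).trans ?_
    have e : (o.band.diagram k R lam).out (o.bandVertex j) =
      (match o.band.word[o.bandVertex j]? with
        | some l => if l.isInv then [] else
            [((o.bandVertex j + 1) % o.band.word.length,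
              (if o.bandVertex j = o.band.pos then (lam : k) else 1) • l.elt (arr k R))]
        | none => []) ++
      (match o.band.word[(o.bandVertex j + o.band.word.length - 1) % o.band.word.length]? with
        | some l => if l.isInv then
            [((o.bandVertex j + o.band.word.length - 1) % o.band.word.length,
              l.elt (arr k R))] else []
        | none => []) := rfl
    rw [e, ← bandVertex_sub_one, ← bandVertex_add_one, getElem?_bandVertex, getElem?_bandVertex,
      List.map_append, List.sum_append, idem_bandVertex]
    congr 1
    · cases hl : (o.bandLetter j).isInv
      · simp only [Bool.false_eq_true, if_false, List.map_cons, List.map_nil, List.sum_cons,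
          List.sum_nil, add_zero, label_some hl, weight, hl]
        change (o.bandEl R lam (n + 1) (j + 1)) _ = _
        congr 2
        change (if o.bandVertex j = o.pos then (lam : k) else 1) • _ = _
        split_ifs <;> simp [Units.smul_def]
      · simp [label, hl]
    · cases hl : (o.bandLetter (j - 1)).isInv
      · simp [label, hl]
      · simp [label, hl, weight]
        rfl
  -- For a vertex outside degree `n`, the targets of its outgoing arrows lie outside degree `n + 1`,
  -- so the right side vanishes too.
  · have h1 := deg_bandVertex_add_one hσ j
    have h2 := deg_bandVertex_add_one hσ (j - 1)
    rw [sub_add_cancel] at h2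
    rw [bandEl_eq_zero h, map_zero]
    cases hl : (o.bandLetter j).isInv <;> cases hl' : (o.bandLetter (j - 1)).isInv <;>
      simp only [Letter.sgn, hl, hl', if_true, if_false, Bool.false_eq_true] at h1 h2 <;>
      simp only [label, hl, hl', if_true, if_false, reduceCtorEq, smul_zero, mul_zero, map_zero,
        add_zero, zero_add]
    · rw [bandEl_eq_zero (by omega)]
    · rw [bandEl_eq_zero (by omega), bandEl_eq_zero (by omega), add_zero]
    · rw [bandEl_eq_zero (by omega)]

end Overlap

end Matrices
-- The vertices of the band inside and outside the overlap
section Indices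

variable {Q : Type u} [Quiver.{u} Q] {R : Quiver.Total Q → Quiver.Total Q → Prop}

theorem EndCond.isInv_component {s f : Letter Q} {t : Option (Letter Q)}
    (h : EndCond s t (some f)) : f.isInv = false := by
  cases h <;> assumption

namespace Overlap

variable (o : Overlap Q)

theorem bandVertex_ρ {j : ℤ} (h0 : 0 ≤ j) (h1 : j ≤ o.ρ.length) :
    o.bandVertex (o.β.length + 1 + j) = o.β.length + 1 + j.toNat := by
  have := o.length_word
  have h := o.bandVertex_natCast (n := o.β.length + 1 + j.toNat) (by omega)
  rw [← h]
  congr 1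
  omega

theorem bandVertex_of_nonpos {i : ℤ} (h0 : -o.β.length ≤ i) (h1 : i ≤ 0) :
    o.bandVertex (-i) = (-i).toNat := by
  have := o.length_word
  have h := o.bandVertex_natCast (n := (-i).toNat) (by omega)
  rw [← h]
  congr 1
  omega

theorem bandVertex_of_pos {i : ℤ} (h0 : 0 < i) (h1 : i ≤ o.α.length) :
    o.bandVertex (-i) = o.band.word.length - i.toNat := by
  have := o.length_word
  have h := o.bandVertex_natCast (n := o.band.word.length - i.toNat) (by omega)
  rw [← h, ← bandVertex_add_length]
  congr 1
  omega

theorem exists_of_lt_length {v : ℕ} (hv : v < o.band.word.length) :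
    (∃ i : ℤ, -o.β.length ≤ i ∧ i ≤ o.α.length ∧ v = o.bandVertex (-i)) ∨
    ∃ j : ℤ, 0 ≤ j ∧ j ≤ o.ρ.length ∧ v = o.bandVertex (o.β.length + 1 + j) := by
  have := o.length_word
  rcases Nat.lt_or_ge o.β.length v with h | h
  · rcases Nat.lt_or_ge v (o.β.length + o.ρ.length + 2) with h' | h'
    · refine Or.inr ⟨v - o.β.length - 1, by omega, by omega, ?_⟩
      rw [bandVertex_ρ _ (by omega) (by omega)]
      omega
    · refine Or.inl ⟨o.band.word.length - v, by omega, by omega, ?_⟩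
      rw [bandVertex_of_pos _ (by omega) (by omega)]
      omega
  · refine Or.inl ⟨-v, by omega, by omega, ?_⟩
    rw [bandVertex_of_nonpos _ (by omega) (by omega)]
    omega

variable {o}

/-- The shift by one reflects that `B^{n+1}` is a summand of the mapping cone in degree `n`. -/
theorem mid_degree_iff (hσ : IsHomotopyBand R o.band.word) {i : ℤ}
    (h0 : -o.β.length ≤ i) (h1 : i ≤ o.α.length) (n : ℤ) :
    o.cone.IsVertex i ∧ o.cone.deg i = n ↔
      o.bandVertex (-i) < o.band.word.length ∧ o.band.deg (o.bandVertex (-i)) = n + 1 := by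
  have h2 := cone_isVertex_mid h0 h1
  have h3 := o.bandVertex_lt (-i)
  rw [cone_deg_mid hσ h0 h1]
  constructor
  · rintro ⟨-, h⟩; exact ⟨h3, by omega⟩
  · rintro ⟨-, h⟩; exact ⟨h2, by omega⟩

theorem overlap_degree_iff (hσ : IsHomotopyBand R o.band.word) {j : ℤ}
    (h0 : 0 ≤ j) (h1 : j ≤ o.ρ.length) (n : ℤ) :
    o.string.IsVertex j ∧ o.string.deg j = n ↔
      o.bandVertex (o.β.length + 1 + j) < o.band.word.length ∧
      o.band.deg (o.bandVertex (o.β.length + 1 + j)) = n := by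
  have h2 := string_isVertex_ρ h0 h1
  have h3 := o.bandVertex_lt (o.β.length + 1 + j)
  rw [string_deg_ρ hσ h0 h1]
  simp [h2, h3]

end Overlap

end Indices

/-! ### Inclusions, projections and the partial inverse of the graph map -/

section Reduction

variable {Q : Type u} [Quiver.{u} Q] [Fintype Q] {k : Type u} [Field k]
  {R : Quiver.Total Q → Quiver.Total Q → Prop}

namespace Overlap

variable (o : Overlap Q)

variable (k R) (ε : ℤ → kˣ)

/-- The map from the cone to the band, up to the scalars `ε` the identity on the vertices of the
band outside the overlap. -/
def toBand (i : ℤ) : List (ℕ × BoundAlg k R) :=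
  if -o.β.length ≤ i ∧ i ≤ o.α.length then [(o.bandVertex (-i), ε i • 1)] else []

/-- The map from the cone to the string, up to the scalars `ε` the identity on the vertices of the
string outside the overlap. -/
def toString (i : ℤ) : List (ℤ × BoundAlg k R) :=
  if i < -o.β.length then [(i + o.β.length, ε i • 1)] else
    if o.α.length < i then [(i - o.α.length + o.ρ.length, ε i • 1)] else []

/-- The map from the band to the cone that is inverse to `toBand` outside the overlap. -/
def ofBand (v : ℕ) : List (ℤ × BoundAlg k R) :=
  if v ≤ o.β.length then [(-(v : ℤ), (ε (-v))⁻¹ • 1)] else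
    if o.β.length + o.ρ.length + 2 ≤ v then
      [((o.band.word.length : ℤ) - v, (ε (o.band.word.length - v))⁻¹ • 1)] else []

/-- The map from the string to the cone that is inverse to `toString` outside the overlap. -/
def ofString (j : ℤ) : List (ℤ × BoundAlg k R) :=
  if j < 0 then [(j - o.β.length, (ε (j - o.β.length))⁻¹ • 1)] else
    if o.ρ.length < j then
      [(j - o.ρ.length + o.α.length, (ε (j - o.ρ.length + o.α.length))⁻¹ • 1)] else []

/-- The map from the string to the band that is inverse to the graph map on the overlap. -/
def overlapInv (lam : kˣ) (j : ℤ) : List (ℕ × BoundAlg k R) :=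
  if 0 ≤ j ∧ j ≤ o.ρ.length then
    [(o.bandVertex (o.β.length + 1 + j), (o.unitScalar lam (o.β.length + 1 + j.toNat))⁻¹ • 1)]
  else []

variable {k R ε} {o} {lam : kˣ}

theorem ofBand_bandVertex {i : ℤ} (h0 : -o.β.length ≤ i) (h1 : i ≤ o.α.length) :
    o.ofBand k R ε (o.bandVertex (-i)) = [(i, (ε i)⁻¹ • 1)] := by
  have := o.length_word
  rcases le_or_gt i 0 with h | h
  · rw [bandVertex_of_nonpos _ h0 h, ofBand, if_pos (by omega), Int.toNat_of_nonneg (by omega),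
      neg_neg]
  · rw [bandVertex_of_pos _ h h1, ofBand, if_neg (by omega), if_pos (by omega),
      show (o.band.word.length : ℤ) - (o.band.word.length - i.toNat : ℕ) = i by omega]

theorem ofBand_bandVertex_ρ {j : ℤ} (h0 : 0 ≤ j) (h1 : j ≤ o.ρ.length) :
    o.ofBand k R ε (o.bandVertex (o.β.length + 1 + j)) = [] := by
  rw [bandVertex_ρ _ h0 h1, ofBand, if_neg (by omega), if_neg (by omega)]

variable (hσ : IsHomotopyBand R o.band.word) (hτ : o.string.IsHomotopyString R)
  (hend : o.Endpoints) (hc : o.cone.IsHomotopyString R)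

include hσ hc in
theorem toBand_el {i : ℤ} (h0 : -o.β.length ≤ i) (h1 : i ≤ o.α.length) (n : ℤ)
    (x : BoundAlg k R) :
    Diagram.matMap (o.cone.diagram k R) (o.band.diagram k R lam) (o.toBand k R ε) n (n + 1)
      (o.cone.el k R n i x) = o.bandEl R lam (n + 1) (-i) (ε i • x) := by
  refine Diagram.matMap_el_single (D := o.cone.diagram k R) (D' := o.band.diagram k R lam)
    (m := o.toBand k R ε) (v := i) (w := o.bandVertex (-i)) (if_pos ⟨h0, h1⟩) (fun _ => ?_) ?_
    (mid_degree_iff hσ h0 h1 n) x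
  · rw [idem_bandVertex, ← cone_vtx_mid hσ hc h0 h1]
    rfl
  · rw [idem_bandVertex]
    exact vert_mul_self k R _

theorem toBand_el_eq_zero {i : ℤ} (h : i < -o.β.length ∨ o.α.length < i) (n n' : ℤ)
    (x : BoundAlg k R) :
    Diagram.matMap (o.cone.diagram k R) (o.band.diagram k R lam) (o.toBand k R ε) n n'
      (o.cone.el k R n i x) = 0 :=
  Diagram.matMap_el_nil (D := o.cone.diagram k R) (D' := o.band.diagram k R lam)
    (m := o.toBand k R ε) (v := i) (if_neg (by omega)) n n' x

include hσ hc in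
theorem ofBand_el {i : ℤ} (h0 : -o.β.length ≤ i) (h1 : i ≤ o.α.length) (n : ℤ)
    (x : BoundAlg k R) :
    Diagram.matMap (o.band.diagram k R lam) (o.cone.diagram k R) (o.ofBand k R ε) (n + 1) n
      (o.bandEl R lam (n + 1) (-i) x) = o.cone.el k R n i ((ε i)⁻¹ • x) := by
  refine Diagram.matMap_el_single (D' := o.cone.diagram k R) (D := o.band.diagram k R lam)
    (m := o.ofBand k R ε) (w := i) (v := o.bandVertex (-i)) (ofBand_bandVertex h0 h1)
    (fun _ => ?_) (vert_mul_self k R _) (mid_degree_iff hσ h0 h1 n).symm x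
  rw [idem_bandVertex, ← cone_vtx_mid hσ hc h0 h1]
  rfl

theorem ofBand_el_ρ {j : ℤ} (h0 : 0 ≤ j) (h1 : j ≤ o.ρ.length) (n n' : ℤ)
    (x : BoundAlg k R) :
    Diagram.matMap (o.band.diagram k R lam) (o.cone.diagram k R) (o.ofBand k R ε) n n'
      (o.bandEl R lam n (o.β.length + 1 + j) x) = 0 :=
  Diagram.matMap_el_nil (D := o.band.diagram k R lam) (D' := o.cone.diagram k R)
    (m := o.ofBand k R ε) (ofBand_bandVertex_ρ h0 h1) n n' x

section

include hσ hτ hend hc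

theorem toString_el_of_gt {i : ℤ} (h : o.α.length < i) (n : ℤ) (x : BoundAlg k R) :
    Diagram.matMap (o.cone.diagram k R) (o.string.diagram k R) (o.toString k R ε) n n
      (o.cone.el k R n i x) = o.string.el k R n (i - o.α.length + o.ρ.length) (ε i • x) := by
  have h1 := cone_isVertex_of_gt h
  have h2 := cone_deg_of_gt hσ hend h
  have h3 := cone_vtx_of_gt hσ hτ hend hc h
  have h4 : o.toString k R ε i = [(i - o.α.length + o.ρ.length, ε i • 1)] :=
    (if_neg (by omega)).trans (if_pos h)
  generalize i - o.α.length + o.ρ.length = j at h1 h2 h3 h4 ⊢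
  exact Diagram.matMap_el_single (D := o.cone.diagram k R) (D' := o.string.diagram k R)
    (m := o.toString k R ε) (v := i) (w := j) h4 (fun hi => congrArg (vert k R) (h3 hi))
    (vert_mul_self k R _)
    (and_congr h1 (by change o.cone.deg i = n ↔ o.string.deg j = n; rw [h2])) x

omit hτ hc in
theorem toString_el_of_lt {i : ℤ} (h : i < -o.β.length) (n : ℤ) (x : BoundAlg k R) :
    Diagram.matMap (o.cone.diagram k R) (o.string.diagram k R) (o.toString k R ε) n n
      (o.cone.el k R n i x) = o.string.el k R n (i + o.β.length) (ε i • x) := by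
  have h1 := cone_isVertex_of_lt h
  have h2 := cone_deg_of_lt hσ hend h
  have h3 := cone_vtx_of_lt hσ hend h
  have h4 : o.toString k R ε i = [(i + o.β.length, ε i • 1)] := if_pos h
  generalize i + o.β.length = j at h1 h2 h3 h4 ⊢
  exact Diagram.matMap_el_single (D := o.cone.diagram k R) (D' := o.string.diagram k R)
    (m := o.toString k R ε) (v := i) (w := j) h4 (fun hi => congrArg (vert k R) (h3 hi))
    (vert_mul_self k R _)
    (and_congr h1 (by change o.cone.deg i = n ↔ o.string.deg j = n; rw [h2])) x

theorem ofString_el_of_gt {i : ℤ} (h : o.α.length < i) (n : ℤ) (x : BoundAlg k R) :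
    Diagram.matMap (o.string.diagram k R) (o.cone.diagram k R) (o.ofString k R ε) n n
      (o.string.el k R n (i - o.α.length + o.ρ.length) x) = o.cone.el k R n i ((ε i)⁻¹ • x) := by
  have h1 := cone_isVertex_of_gt h
  have h2 := cone_deg_of_gt hσ hend h
  have h3 := cone_vtx_of_gt hσ hτ hend hc h
  have h4 : o.ofString k R ε (i - o.α.length + o.ρ.length) = [(i, (ε i)⁻¹ • 1)] := by
    rw [ofString, if_neg (by omega), if_pos (by omega),
      show i - o.α.length + o.ρ.length - o.ρ.length + o.α.length = i by ring]
  generalize i - o.α.length + o.ρ.length = j at h1 h2 h3 h4 ⊢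
  exact Diagram.matMap_el_single (D' := o.cone.diagram k R) (D := o.string.diagram k R)
    (m := o.ofString k R ε) (v := j) (w := i) h4 (fun hi => congrArg (vert k R) (h3 (h1.2 hi)).symm)
    (vert_mul_self k R _)
    (and_congr h1.symm (by change o.string.deg j = n ↔ o.cone.deg i = n; rw [h2])) x

omit hτ hc in
theorem ofString_el_of_lt {i : ℤ} (h : i < -o.β.length) (n : ℤ) (x : BoundAlg k R) :
    Diagram.matMap (o.string.diagram k R) (o.cone.diagram k R) (o.ofString k R ε) n n
      (o.string.el k R n (i + o.β.length) x) = o.cone.el k R n i ((ε i)⁻¹ • x) := by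
  have h1 := cone_isVertex_of_lt h
  have h2 := cone_deg_of_lt hσ hend h
  have h3 := cone_vtx_of_lt hσ hend h
  have h4 : o.ofString k R ε (i + o.β.length) = [(i, (ε i)⁻¹ • 1)] := by
    rw [ofString, if_pos (by omega), show i + o.β.length - o.β.length = i by ring]
  generalize i + o.β.length = j at h1 h2 h3 h4 ⊢
  exact Diagram.matMap_el_single (D' := o.cone.diagram k R) (D := o.string.diagram k R)
    (m := o.ofString k R ε) (v := j) (w := i) h4 (fun hi => congrArg (vert k R) (h3 (h1.2 hi)).symm)
    (vert_mul_self k R _)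
    (and_congr h1.symm (by change o.string.deg j = n ↔ o.cone.deg i = n; rw [h2])) x

end

theorem toString_el_mid {i : ℤ} (h0 : -o.β.length ≤ i) (h1 : i ≤ o.α.length) (n n' : ℤ)
    (x : BoundAlg k R) :
    Diagram.matMap (o.cone.diagram k R) (o.string.diagram k R) (o.toString k R ε) n n'
      (o.cone.el k R n i x) = 0 :=
  Diagram.matMap_el_nil (D := o.cone.diagram k R) (D' := o.string.diagram k R)
    (m := o.toString k R ε) (v := i) ((if_neg (by omega)).trans (if_neg (by omega))) n n' x

theorem ofString_el_ρ {j : ℤ} (h0 : 0 ≤ j) (h1 : j ≤ o.ρ.length) (n n' : ℤ)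
    (x : BoundAlg k R) :
    Diagram.matMap (o.string.diagram k R) (o.cone.diagram k R) (o.ofString k R ε) n n'
      (o.string.el k R n j x) = 0 :=
  Diagram.matMap_el_nil (D := o.string.diagram k R) (D' := o.cone.diagram k R)
    (m := o.ofString k R ε) (v := j) ((if_neg (by omega)).trans (if_neg (by omega))) n n' x

include hσ hτ in
theorem overlapInv_el {j : ℤ} (h0 : 0 ≤ j) (h1 : j ≤ o.ρ.length) (n : ℤ) (x : BoundAlg k R) :
    Diagram.matMap (o.string.diagram k R) (o.band.diagram k R lam) (o.overlapInv k R lam) n n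
      (o.string.el k R n j x) = o.bandEl R lam n (o.β.length + 1 + j)
        ((o.unitScalar lam (o.β.length + 1 + j.toNat))⁻¹ • x) := by
  refine Diagram.matMap_el_single (D := o.string.diagram k R) (D' := o.band.diagram k R lam)
    (m := o.overlapInv k R lam) (v := j) (w := o.bandVertex (o.β.length + 1 + j)) (if_pos ⟨h0, h1⟩)
    (fun _ => ?_) ?_ (overlap_degree_iff hσ h0 h1 n) x
  · rw [idem_bandVertex, ← string_vtx_ρ hσ hτ h0 h1]
    rfl
  · rw [idem_bandVertex]
    exact vert_mul_self k R _

theorem overlapInv_el_eq_zero {j : ℤ} (h : j < 0 ∨ o.ρ.length < j) (n n' : ℤ)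
    (x : BoundAlg k R) :
    Diagram.matMap (o.string.diagram k R) (o.band.diagram k R lam) (o.overlapInv k R lam) n n'
      (o.string.el k R n j x) = 0 :=
  Diagram.matMap_el_nil (D := o.string.diagram k R) (D' := o.band.diagram k R lam)
    (m := o.overlapInv k R lam) (v := j)
    (if_neg (by omega)) n n' x

include hσ hτ in
theorem components_el_ρ {j : ℤ} (h0 : 0 ≤ j) (h1 : j ≤ o.ρ.length) (n : ℤ) (x : BoundAlg k R) :
    Diagram.matMap (o.band.diagram k R lam) (o.string.diagram k R) (o.components k R lam) n n
      (o.bandEl R lam n (o.β.length + 1 + j) x) =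
    o.string.el k R n j (o.unitScalar lam (o.β.length + 1 + j.toNat) • x) := by
  have e : o.components k R lam (o.bandVertex (o.β.length + 1 + j)) =
      [(j, o.unitScalar lam (o.β.length + 1 + j.toNat) • 1)] := by
    have hN := o.length_word
    rw [components, bandVertex_ρ _ h0 h1, if_pos (by omega), if_neg (by omega), if_neg, scalar_smul]
    · rw [List.append_nil, List.append_nil,
        show ((o.β.length + 1 + j.toNat : ℕ) : ℤ) - o.β.length - 1 = j by omega]
    -- If `α` is empty, the right vertex of `σ_R` is numbered `0`, hence the reduction modulo the
    -- length. In either case it lies outside the overlap.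
    · rcases Nat.eq_zero_or_pos o.α.length with h | h
      · rw [show o.β.length + o.ρ.length + 2 = o.band.word.length by omega, Nat.mod_self]
        omega
      · rw [Nat.mod_eq_of_lt (by omega)]
        omega
  refine Diagram.matMap_el_single (D' := o.string.diagram k R) (D := o.band.diagram k R lam)
    (m := o.components k R lam) (w := j) (v := o.bandVertex (o.β.length + 1 + j)) e
    (fun _ => ?_) (vert_mul_self k R _) (overlap_degree_iff hσ h0 h1 n).symm x
  rw [idem_bandVertex, ← string_vtx_ρ hσ hτ h0 h1]
  rfl

include hend in
-- A sum of two conditional terms is needed: if `α` and `β` are empty, one vertex of the band is the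
-- outer end of both `σ_L` and `σ_R` and may carry both `f_L` and `f_R`.
theorem components_el_mid {i : ℤ} (h0 : -o.β.length ≤ i) (h1 : i ≤ o.α.length) {n : ℤ}
    (hn : o.band.deg (o.bandVertex (-i)) = n) (x : BoundAlg k R) :
    Diagram.matMap (o.band.diagram k R lam) (o.string.diagram k R) (o.components k R lam) n n
      (o.bandEl R lam n (-i) x) =
    (if i = -o.β.length then o.string.el k R n (-1) (x * vert k R (o.bandLetter (-i)).lft *
      (o.unitScalar lam o.β.length • label k R false o.fL)) else 0) +
    (if i = o.α.length then o.string.el k R n (o.ρ.length + 1)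
      (x * vert k R (o.bandLetter (-i)).lft *
      (o.unitScalar lam (o.β.length + o.ρ.length + 2) • label k R false o.fR)) else 0) := by
  refine (Diagram.matMap_el (o.band.diagram k R lam) (o.string.diagram k R)
    (o.components k R lam) n n (o.bandVertex (-i)) ⟨o.bandVertex_lt _, hn⟩ x).trans ?_
  rw [idem_bandVertex]
  change ((o.components k R lam (o.bandVertex (-i))).map (fun wa => o.string.el k R n wa.1
    (x * vert k R (o.bandLetter (-i)).lft * wa.2))).sum = _
  have hN := o.length_word
  have hfL : ∀ f, o.fL = some f → f.isInv = false := fun f hf => by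
    have := hend.left
    rw [hf] at this
    exact this.isInv_component
  have hfR : ∀ f, o.fR = some f → f.isInv = false := fun f hf => by
    have := hend.right
    rw [hf] at this
    exact this.isInv_component
  have e1 : ¬ (o.β.length + 1 ≤ o.bandVertex (-i) ∧
      o.bandVertex (-i) ≤ o.β.length + 1 + o.ρ.length) := by
    rcases le_or_gt i 0 with h | h
    · rw [bandVertex_of_nonpos _ h0 h]; omega
    · rw [bandVertex_of_pos _ h h1]; omega
  have e2 : o.bandVertex (-i) = o.β.length ↔ i = -o.β.length := by
    rcases le_or_gt i 0 with h | h
    · rw [bandVertex_of_nonpos _ h0 h]; omega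
    · rw [bandVertex_of_pos _ h h1]; omega
  have e3 : o.bandVertex (-i) = (o.β.length + o.ρ.length + 2) % o.band.word.length ↔
      i = o.α.length := by
    rcases Nat.eq_zero_or_pos o.α.length with h' | h'
    · rw [show o.β.length + o.ρ.length + 2 = o.band.word.length by omega, Nat.mod_self,
        bandVertex_of_nonpos _ h0 (by omega)]
      omega
    · rw [Nat.mod_eq_of_lt (by omega)]
      rcases le_or_gt i 0 with h | h
      · rw [bandVertex_of_nonpos _ h0 h]; omega
      · rw [bandVertex_of_pos _ h h1]; omega
  have e : o.components k R lam (o.bandVertex (-i)) =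
      (if i = -o.β.length then o.fL.toList.map (fun f => ((-1 : ℤ),
        o.scalar k lam o.β.length • f.elt (arr k R))) else []) ++
      (if i = o.α.length then o.fR.toList.map (fun f => ((o.ρ.length : ℤ) + 1,
        o.scalar k lam (o.β.length + o.ρ.length + 2) • f.elt (arr k R))) else []) := by
    rw [components, if_neg e1, List.nil_append]
    simp only [e2, e3]
  rw [e, List.map_append, List.sum_append]
  congr 1
  · split_ifs
    · rcases hf : o.fL with _ | f
      · simp [label]
      · simp [label, hfL f hf, scalar_smul]
    · rfl
  · split_ifs
    · rcases hf : o.fR with _ | f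
      · simp [label]
      · simp [label, hfR f hf, scalar_smul]
    · rfl

end Overlap

end Reduction
-- Labels of the junction letters, vanishing products and rescaling
section Labels

variable {Q : Type u} [Quiver.{u} Q] [Fintype Q] {k : Type u} [Field k]
  {R : Quiver.Total Q → Quiver.Total Q → Prop}

theorem Letter.elt_mul_vert (l : Letter Q) :
    l.elt (arr k R) * vert k R l.firstArrow.left = l.elt (arr k R) := by
  conv_lhs => rw [Letter.elt, ← List.dropLast_append_getLast l.ne]
  conv_rhs => rw [Letter.elt, ← List.dropLast_append_getLast l.ne]
  rw [List.map_append, List.prod_append, mul_assoc]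
  congr 1
  rw [List.map_singleton, List.prod_singleton]
  exact arr_mul_vert k R l.firstArrow

theorem EndCond.label_false_junctionLetter {s t : Letter Q} {f : Option (Letter Q)}
    (h : EndCond s (some t) f) : label k R false (some (junctionLetter s f t)) =
      label k R false f := by
  cases h <;> rfl

/-- The right side is the label of the zigzag through the overlap. Under (RG1) the letter `t`, under
(RG2) the letter `s` points the wrong way and both sides vanish; under (RG3) the zigzag is the
composed path. -/
theorem EndCond.label_true_junctionLetter {s t : Letter Q} {f : Option (Letter Q)}
    (h : EndCond s (some t) f) (hlft : t.lft = s.lft) :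
    label k R true (some (junctionLetter s f t)) =
      label k R true (some t) * vert k R s.lft * label k R false (some s) := by
  cases h with
  | rg1 _ f hs ht hf h => simp [junctionLetter, label, hf, ht]
  | rg2 _ f hs ht hf h => simp [junctionLetter, label, hf, hs]
  | rg3 _ hs ht =>
    rw [label_some hs, label_some ht, label_some (by rfl), ← hlft,
      show t.lft = t.firstArrow.left by simp [Letter.lft, ht], Letter.elt_mul_vert]
    simp [junctionLetter, Letter.elt]

/-- Cancellation of the scalars in a component of a differential. -/
theorem inv_smul_smul_mul_smul {A : Type*} [Ring A] [Algebra k A] {c e e' : kˣ} (h : e' = c * e)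
    (x y z : A) : e'⁻¹ • ((e • x) * y * (c • z)) = x * y * z := by
  rw [smul_mul_assoc, smul_mul_assoc, mul_smul_comm, smul_smul, smul_smul, h,
    show (c * e)⁻¹ * e * c = 1 by rw [mul_assoc, mul_comm e, inv_mul_cancel], one_smul]

/-- Start with `1` at `0` and multiply by `g` to the right, by its inverses to the left. -/
theorem exists_units_recursion (g : ℤ → kˣ) : ∃ e : ℤ → kˣ, ∀ i, e (i + 1) = g i * e i := by
  refine ⟨fun i => match i with
    | Int.ofNat n => ∏ j ∈ Finset.range n, g j
    | Int.negSucc n => (∏ j ∈ Finset.range (n + 1), g (Int.negSucc j))⁻¹, fun i => ?_⟩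
  obtain ⟨n, rfl⟩ | ⟨n, rfl⟩ : (∃ n : ℕ, i = Int.ofNat n) ∨ ∃ n : ℕ, i = Int.negSucc n := by
    cases i <;> simp
  · rw [show Int.ofNat n + 1 = Int.ofNat (n + 1) from rfl]
    simp [Finset.prod_range_succ, mul_comm]
  · cases n with
    | zero => simp
    | succ n =>
      rw [show Int.negSucc (n + 1) + 1 = Int.negSucc n by omega]
      simp [Finset.prod_range_succ _ (n + 1)]

namespace Overlap

variable (o : Overlap Q) (lam : kˣ)

/-- The coefficient of the letter `i` of the cone in the reduced mapping cone. -/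
def coefficient (i : ℤ) : kˣ :=
  if i = o.α.length then
    if o.fR.isSome then o.unitScalar lam (o.β.length + o.ρ.length + 2)
    else (o.unitScalar lam (o.β.length + 1 + o.ρ.length))⁻¹ *
      o.weight lam (o.β.length + 1 + o.ρ.length)
  else if i = -o.β.length - 1 then
    if o.fL.isSome then o.unitScalar lam o.β.length
    else (o.unitScalar lam (o.β.length + 1))⁻¹ * o.weight lam o.β.length
  else if -o.β.length ≤ i ∧ i < o.α.length then -o.weight lam (-i - 1) else 1

/-- The scalars `ε` at the vertices of the cone turn the coefficients of the reduced mapping cone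
into ones. -/
def Normalizes (ε : ℤ → kˣ) : Prop :=
  ∀ i l, o.cone.letterAt i = some l →
    (l.isInv = false → ε (i + 1) = o.coefficient lam i * ε i) ∧
    (l.isInv = true → ε i = o.coefficient lam i * ε (i + 1))

omit [Fintype Q] in
-- Each letter of the cone relates the scalars of two consecutive vertices, and a walk without cycle
-- imposes no further condition.
theorem exists_normalizes : ∃ ε, o.Normalizes lam ε := by
  obtain ⟨ε, hε⟩ := exists_units_recursion (fun i => match o.cone.letterAt i with
    | some l => if l.isInv then (o.coefficient lam i)⁻¹ else o.coefficient lam i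
    | none => 1)
  refine ⟨ε, fun i l hl => ?_⟩
  have := hε i
  simp only [hl] at this
  rw [this]
  constructor <;> intro h <;> simp [h]

variable {o lam}

omit [Fintype Q] in
theorem string_head_lft (hσ : IsHomotopyBand R o.band.word) (hτ : o.string.IsHomotopyString R)
    {t : Letter Q} (ht : o.string.letterAt o.ρ.length = some t) : t.lft = o.σR.lft := by
  rw [← StringData.vtx_of_letterAt ht, string_vtx_ρ hσ hτ (by omega) le_rfl, bandLetter_σR]

variable (hσ : IsHomotopyBand R o.band.word) (hR : IsGentle R)
  (hτ : o.string.IsHomotopyString R) (hend : o.Endpoints) (hcomp : o.Compatible R)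

include hσ hR hτ hend hcomp

/-- If the overlap is trivial, the letter of the target on its right and the letter of the source
on its left compose to zero. -/
theorem label_mul_label_right (h0 : o.ρ.length = 0) {t : Letter Q}
    (ht : o.string.letterAt o.ρ.length = some t) :
    label k R true (some t) * vert k R o.σR.lft * label k R true (some o.σL) = 0 := by
  cases hti : t.isInv
  · simp [label, hti]
  cases hsi : o.σL.isInv
  · simp [label, hsi]
  rw [label_some hti, label_some hsi]
  have hlft := string_head_lft hσ hτ ht
  refine elt_mul_elt k R _ _ _ (by simpa [Letter.lft, hti] using hlft.symm) ?_
  have hE := hend.endCond_right ht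
  have hN := isNonzeroPath_junction_right hσ hR hτ hend hcomp ht
  have h2 := o.follows_bandLetter hσ o.β.length
  rw [bandLetter_σL, show (o.β.length + 1 : ℤ) = o.β.length + 1 + o.ρ.length by omega,
    bandLetter_σR] at h2
  rcases hf : o.fR with _ | f
  · rw [hf] at hE hN
    obtain ⟨hs, -⟩ := EndCond_none hE
    obtain ⟨-, -, h3, h4⟩ := (isNonzeroPath_append t o.σR).1 hN
    -- Only one arrow may precede the first arrow of `t` without relation. It is the last arrow of
    -- `σ_R`, which differs from that of `σ_L` since `σ_L σ_R` is reduced.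
    by_contra h5
    have h6 := h2.2
    rw [hsi, hs] at h6
    refine h6 (hR.nonrel_right t.firstArrow ⟨?_, h5⟩ ⟨h3, h4⟩)
    rw [h3]
    simpa [Letter.lft, Letter.rgt, hsi, hs] using h2.1.symm
  · rw [hf] at hE
    have h6 := (hE.follows_of_component' hlft h2).2
    rwa [hsi, hti] at h6

/-- The mirror image: a zigzag coming from `τ_L` cannot leave a trivial overlap along `σ_R`. -/
theorem label_mul_label_left (h0 : o.ρ.length = 0) {t : Letter Q}
    (ht : o.string.letterAt (-1) = some t) :
    label k R false (some t) * vert k R o.σL.rgt * label k R false (some o.σR) = 0 := by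
  cases hti : t.isInv
  swap
  · simp [label, hti]
  cases hsi : o.σR.isInv
  swap
  · simp [label, hsi]
  rw [label_some hti, label_some hsi]
  have hrgt : t.rgt = o.σL.rgt := hτ.base_left _ ht
  refine elt_mul_elt k R _ _ _ (by simpa [Letter.rgt, hti] using hrgt.symm) ?_
  have hE := hend.endCond_left ht
  have hN := isNonzeroPath_junction_left hσ hR hτ hend hcomp ht
  have h2 := o.follows_bandLetter hσ o.β.length
  rw [bandLetter_σL, show (o.β.length + 1 : ℤ) = o.β.length + 1 + o.ρ.length by omega,
    bandLetter_σR] at h2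
  rcases hf : o.fL with _ | f
  · rw [hf] at hE hN
    obtain ⟨hs, -⟩ := EndCond_none hE
    rw [Letter.bar_isInv, Bool.not_eq_false'] at hs
    obtain ⟨-, -, h3, h4⟩ := (isNonzeroPath_append t o.σL).1 hN
    by_contra h5
    have h6 := h2.2
    rw [hsi, hs] at h6
    refine h6 (hR.nonrel_right t.firstArrow ⟨h3, h4⟩ ⟨?_, h5⟩)
    rw [h3]
    simpa [Letter.lft, Letter.rgt, hsi, hs] using h2.1
  · rw [hf] at hE
    have h6 := (hE.follows_of_component' (by simpa using hrgt) h2.bar).bar.2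
    simpa [hsi, hti] using h6

end Overlap

end Labels
-- The reduced differential is the differential of the string complex
theorem smul_mul_neg_smul {k A : Type*} [Field k] [Ring A] [Algebra k A] (u w : kˣ) (x y : A) :
    u • (x * ((-w) • y)) = -(u • (x * (w • y))) := by
  simp [Units.smul_def]

section Differential

variable {Q : Type u} [Quiver.{u} Q] [Fintype Q] {k : Type u} [Field k]
  {R : Quiver.Total Q → Quiver.Total Q → Prop}

namespace Overlap

variable {o : Overlap Q} {lam : kˣ} {ε : ℤ → kˣ}

variable (k R o lam ε) in
/-- The map from the string to the cone given by the vertices outside the overlap and by the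
zigzags through the overlap. -/
def stringReduction (n : ℤ) :
    (o.string.diagram k R).X n →ₗ[BoundAlg k R] (o.cone.diagram k R).X n :=
  Diagram.matMap (o.string.diagram k R) (o.cone.diagram k R) (o.ofString k R ε) n n +
  Diagram.matMap (o.band.diagram k R lam) (o.cone.diagram k R) (o.ofBand k R ε) (n + 1) n ∘ₗ
    Diagram.matMap (o.band.diagram k R lam) (o.band.diagram k R lam)
      (o.band.diagram k R lam).out n (n + 1) ∘ₗ
    Diagram.matMap (o.string.diagram k R) (o.band.diagram k R lam) (o.overlapInv k R lam) n n

variable (hσ : IsHomotopyBand R o.band.word) (hτ : o.string.IsHomotopyString R)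
  (hend : o.Endpoints) (hc : o.cone.IsHomotopyString R)

include hσ hc in
-- Neighbours in the band are found by integer arithmetic and may differ from the chosen
-- representative by one full turn.
theorem ofBand_el_of_eq {i p : ℤ} (h0 : -o.β.length ≤ i) (h1 : i ≤ o.α.length)
    (hp : p = -i ∨ p = -i + o.band.word.length ∨ p = -i - o.band.word.length) (n : ℤ)
    (x : BoundAlg k R) :
    Diagram.matMap (o.band.diagram k R lam) (o.cone.diagram k R) (o.ofBand k R ε) (n + 1) n
      (o.bandEl R lam (n + 1) p x) = o.cone.el k R n i ((ε i)⁻¹ • x) := by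
  rw [← ofBand_el hσ hc h0 h1]
  rcases hp with rfl | rfl | rfl
  · rfl
  · rw [bandEl_add_length]
  · rw [← bandEl_add_length, sub_add_cancel]

theorem ofBand_el_ρ_of_eq {j p : ℤ} (h0 : 0 ≤ j) (h1 : j ≤ o.ρ.length)
    (hp : p = o.β.length + 1 + j ∨ p = o.β.length + 1 + j - o.band.word.length) (n n' : ℤ)
    (x : BoundAlg k R) :
    Diagram.matMap (o.band.diagram k R lam) (o.cone.diagram k R) (o.ofBand k R ε) n n'
      (o.bandEl R lam n p x) = 0 := by
  rw [← ofBand_el_ρ h0 h1 n n' x]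
  rcases hp with rfl | rfl
  · rfl
  · rw [← bandEl_add_length, sub_add_cancel]

section

include hσ hτ hend hc

theorem stringReduction_of_gt {i : ℤ} (h : o.α.length < i) (n : ℤ) (x : BoundAlg k R) :
    o.stringReduction k R lam ε n (o.string.el k R n (i - o.α.length + o.ρ.length) x) =
      o.cone.el k R n i ((ε i)⁻¹ • x) := by
  rw [stringReduction, LinearMap.add_apply, LinearMap.comp_apply, LinearMap.comp_apply,
    overlapInv_el_eq_zero (by omega), map_zero, map_zero, add_zero,
    ofString_el_of_gt hσ hτ hend hc h]

omit hτ hc in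
theorem stringReduction_of_lt {i : ℤ} (h : i < -o.β.length) (n : ℤ) (x : BoundAlg k R) :
    o.stringReduction k R lam ε n (o.string.el k R n (i + o.β.length) x) =
      o.cone.el k R n i ((ε i)⁻¹ • x) := by
  rw [stringReduction, LinearMap.add_apply, LinearMap.comp_apply, LinearMap.comp_apply,
    overlapInv_el_eq_zero (by omega), map_zero, map_zero, add_zero,
    ofString_el_of_lt hσ hend h]

omit hend in
-- At the right end of `ρ` the band differential has two possible components. The one along `σ_R`
-- leaves the overlap and stays. The other runs inside `ρ` and is killed by `ofBand`, unless `ρ` is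
-- trivial and it leaves along `σ_L`; `hx` excludes this.
theorem stringReduction_right (n : ℤ) (x : BoundAlg k R)
    (hx : o.ρ.length = 0 → x * vert k R o.σR.lft * label k R true (some o.σL) = 0) :
    o.stringReduction k R lam ε n (o.string.el k R n o.ρ.length x) =
      o.cone.el k R n o.α.length ((ε o.α.length)⁻¹ •
        (((o.unitScalar lam (o.β.length + 1 + o.ρ.length))⁻¹ • x) * vert k R o.σR.lft *
        (o.weight lam (o.β.length + 1 + o.ρ.length) • label k R false (some o.σR)))) := by
  have hN := o.length_word
  rw [stringReduction, LinearMap.add_apply, LinearMap.comp_apply, LinearMap.comp_apply,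
    ofString_el_ρ (by omega) le_rfl, zero_add, overlapInv_el hσ hτ (by omega) le_rfl,
    d_bandEl hσ, map_add, ofBand_el_of_eq (i := o.α.length) hσ hc (by omega) le_rfl (by omega),
    bandLetter_σR, Int.toNat_natCast]
  refine (congrArg₂ (· + ·) rfl ?_).trans (add_zero _)
  rcases Nat.eq_zero_or_pos o.ρ.length with h | h
  · have e : (o.β.length + 1 + o.ρ.length - 1 : ℤ) = o.β.length := by omega
    rw [e, bandLetter_σL, mul_smul_comm, smul_mul_assoc, smul_mul_assoc, hx h, smul_zero, smul_zero,
      map_zero, map_zero]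
  · exact ofBand_el_ρ_of_eq (o := o) (j := o.ρ.length - 1) (by omega) (by omega) (by omega) _ _ _

omit hend in
theorem stringReduction_left (n : ℤ) (x : BoundAlg k R)
    (hx : o.ρ.length = 0 → x * vert k R o.σL.rgt * label k R false (some o.σR) = 0) :
    o.stringReduction k R lam ε n (o.string.el k R n 0 x) =
      o.cone.el k R n (-o.β.length) ((ε (-o.β.length))⁻¹ •
        (((o.unitScalar lam (o.β.length + 1))⁻¹ • x) * vert k R o.σL.rgt *
        (o.weight lam o.β.length • label k R true (some o.σL)))) := by
  have hN := o.length_word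
  have e0 : (o.bandLetter (o.β.length + 1)).lft = o.σL.rgt := by
    rw [← (o.follows_bandLetter hσ o.β.length).1, bandLetter_σL]
  rw [stringReduction, LinearMap.add_apply, LinearMap.comp_apply, LinearMap.comp_apply,
    ofString_el_ρ le_rfl (by omega), zero_add, overlapInv_el hσ hτ le_rfl (by omega), add_zero,
    d_bandEl hσ, map_add, add_sub_cancel_right, e0,
    ofBand_el_of_eq (i := -o.β.length) (p := o.β.length) hσ hc le_rfl (by omega) (by omega),
    bandLetter_σL, Int.toNat_zero, add_zero]
  refine (congrArg₂ (· + ·) ?_ rfl).trans (zero_add _)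
  rcases Nat.eq_zero_or_pos o.ρ.length with h | h
  · have e : (o.β.length + 1 : ℤ) = o.β.length + 1 + o.ρ.length := by omega
    rw [e, bandLetter_σR, mul_smul_comm, smul_mul_assoc, smul_mul_assoc, hx h, smul_zero, smul_zero,
      map_zero, map_zero]
  · exact ofBand_el_ρ_of_eq (o := o) (j := 1) (by omega) (by omega) (by omega) _ _ _

end

variable (hε : o.Normalizes lam ε)


include hε

/-- The defining property of `ε`, in a form without case distinction: for a missing or inverse
letter both sides are zero. -/
theorem normalized_right {i : ℤ} {t : Option (Letter Q)} (ht : o.cone.letterAt i = t)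
    (x y : BoundAlg k R) :
    (ε (i + 1))⁻¹ • ((ε i • x) * y * (o.coefficient lam i • label k R false t)) =
      x * y * label k R false t := by
  rcases t with _ | l
  · simp [label]
  · cases hl : l.isInv
    · exact inv_smul_smul_mul_smul ((hε i l ht).1 hl) _ _ _
    · simp [label, hl]

theorem normalized_left {i : ℤ} {t : Option (Letter Q)} (ht : o.cone.letterAt i = t)
    (x y : BoundAlg k R) :
    (ε i)⁻¹ • ((ε (i + 1) • x) * y * (o.coefficient lam i • label k R true t)) =
      x * y * label k R true t := by
  rcases t with _ | l
  · simp [label]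
  · cases hl : l.isInv
    · simp [label, hl]
    · exact inv_smul_smul_mul_smul ((hε i l ht).2 hl) _ _ _

include hσ hend hc in
-- From a vertex of the band only `-d_B` and `f` contribute. The neighbours on both sides are
-- treated separately: inside `β̄ ᾱ` the arrow comes from `-d_B`, and at a junction the band
-- differential runs into the overlap and is replaced by the component `f_L` or `f_R`.
theorem differential_mid {i : ℤ} (h0 : -o.β.length ≤ i) (h1 : i ≤ o.α.length) {n : ℤ}
    (hn : o.cone.deg i = n) (hτ : o.string.IsHomotopyString R) :
    Diagram.matMap (o.cone.diagram k R) (o.cone.diagram k R) (o.cone.diagram k R).out n (n + 1)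
      (o.cone.el k R n i 1) =
    - Diagram.matMap (o.band.diagram k R lam) (o.cone.diagram k R) (o.ofBand k R ε)
        (n + 1 + 1) (n + 1) (Diagram.matMap (o.band.diagram k R lam) (o.band.diagram k R lam)
          (o.band.diagram k R lam).out (n + 1) (n + 1 + 1)
          (o.bandEl R lam (n + 1) (-i) (ε i • 1))) +
      Diagram.matMap (o.string.diagram k R) (o.cone.diagram k R) (o.ofString k R ε)
        (n + 1) (n + 1) (Diagram.matMap (o.band.diagram k R lam) (o.string.diagram k R)
          (o.components k R lam) (n + 1) (n + 1)
          (o.bandEl R lam (n + 1) (-i) (ε i • 1))) := by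
  have hN := o.length_word
  have hd := ((mid_degree_iff hσ h0 h1 n).1 ⟨cone_isVertex_mid h0 h1, hn⟩).2
  rw [StringData.d_el _ ⟨cone_isVertex_mid h0 h1, hn⟩, d_bandEl hσ,
    components_el_mid hend h0 h1 hd, map_add, map_add, cone_vtx_mid hσ hc h0 h1]
  have hr : o.cone.el k R (n + 1) (i + 1) (1 * vert k R (o.bandLetter (-i)).lft *
        label k R false (o.cone.letterAt i)) =
      -Diagram.matMap (o.band.diagram k R lam) (o.cone.diagram k R) (o.ofBand k R ε)
        (n + 1 + 1) (n + 1) (o.bandEl R lam (n + 1 + 1) (-i - 1) (ε i • 1 *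
          vert k R (o.bandLetter (-i)).lft *
          o.weight lam (-i - 1) • label k R true (some (o.bandLetter (-i - 1))))) +
      Diagram.matMap (o.string.diagram k R) (o.cone.diagram k R) (o.ofString k R ε)
        (n + 1) (n + 1) (if i = o.α.length then o.string.el k R (n + 1) (o.ρ.length + 1)
          (ε i • 1 * vert k R (o.bandLetter (-i)).lft *
          o.unitScalar lam (o.β.length + o.ρ.length + 2) • label k R false o.fR) else 0) := by
    rcases h1.lt_or_eq with h | rfl
    · have hl := o.cone_letterAt_mid h0 h
      have hco : o.coefficient lam i = -o.weight lam (-i - 1) := by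
        rw [coefficient, if_neg (by omega), if_neg (by omega), if_pos ⟨h0, h⟩]
      rw [if_neg (by omega), map_zero, add_zero,
        ofBand_el_of_eq (i := i + 1) hσ hc (by omega) (by omega) (by omega), hl,
        ← normalized_right hε hl, label_bar, hco, ← map_neg]
      congr 1
      exact smul_mul_neg_smul _ _ _ _
    -- Right junction: an arrow along `σ_R` ends at the last vertex of `ρ` and is killed by
    -- `ofBand`; only `f_R` remains.
    · rw [if_pos rfl, ofBand_el_ρ_of_eq (j := o.ρ.length) (by omega) le_rfl (by omega), neg_zero,
        zero_add, ← normalized_right hε rfl, coefficient, if_pos rfl,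
        show (o.ρ.length + 1 : ℤ) = o.α.length + 1 - o.α.length + o.ρ.length by ring,
        ofString_el_of_gt hσ hτ hend hc (by omega)]
      rw [cone_letterAt_junction_right]
      rcases ht : o.string.letterAt o.ρ.length with _ | t
      · simp [hend.fR_eq_none ht, label]
      · rw [Option.map_some, (hend.endCond_right ht).label_false_junctionLetter]
        rcases o.fR with _ | f
        · simp [label]
        · simp
  have hl : o.cone.el k R (n + 1) (i - 1) (1 * vert k R (o.bandLetter (-i)).lft *
        label k R true (o.cone.letterAt (i - 1))) =
      -Diagram.matMap (o.band.diagram k R lam) (o.cone.diagram k R) (o.ofBand k R ε)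
        (n + 1 + 1) (n + 1) (o.bandEl R lam (n + 1 + 1) (-i + 1) (ε i • 1 *
          vert k R (o.bandLetter (-i)).lft *
          o.weight lam (-i) • label k R false (some (o.bandLetter (-i))))) +
      Diagram.matMap (o.string.diagram k R) (o.cone.diagram k R) (o.ofString k R ε)
        (n + 1) (n + 1) (if i = -o.β.length then o.string.el k R (n + 1) (-1)
          (ε i • 1 * vert k R (o.bandLetter (-i)).lft *
          o.unitScalar lam o.β.length • label k R false o.fL) else 0) := by
    rcases h0.lt_or_eq with h | rfl
    · have hl := o.cone_letterAt_mid (i := i - 1) (by omega) (by omega)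
      rw [show -(i - 1) - 1 = -i by ring] at hl
      have hco : o.coefficient lam (i - 1) = -o.weight lam (-i) := by
        rw [coefficient, if_neg (by omega), if_neg (by omega), if_pos ⟨by omega, by omega⟩,
          show -(i - 1) - 1 = -i by ring]
      have hno := normalized_left hε hl 1 (vert k R (o.bandLetter (-i)).lft)
      rw [sub_add_cancel, label_bar, hco] at hno
      rw [if_neg (by omega), map_zero, add_zero,
        ofBand_el_of_eq (i := i - 1) hσ hc (by omega) (by omega) (by omega), hl, label_bar,
        ← hno, ← map_neg]
      congr 1
      exact smul_mul_neg_smul _ _ _ _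
    · have hno := normalized_left hε (i := -o.β.length - 1) rfl 1
        (vert k R (o.bandLetter o.β.length).lft)
      rw [sub_add_cancel, coefficient, if_neg (by omega), if_pos rfl,
        cone_letterAt_junction_left] at hno
      rw [if_pos rfl, ofBand_el_ρ_of_eq (j := 0) le_rfl (by omega) (by omega), neg_zero,
        zero_add, cone_letterAt_junction_left, neg_neg, ← hno,
        show (-1 : ℤ) = -o.β.length - 1 + o.β.length by ring,
        ofString_el_of_lt hσ hend (by omega)]
      rw [show (-o.β.length - 1 + o.β.length : ℤ) = -1 by ring]
      rcases ht : o.string.letterAt (-1) with _ | t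
      · simp [hend.fL_eq_none ht, label]
      · rw [Option.map_some, label_bar]
        simp only [Bool.not_true]
        rw [(hend.endCond_left ht).label_false_junctionLetter]
        rcases o.fL with _ | f
        · simp [label]
        · simp
  rw [hr, hl]
  abel

variable (hR : IsGentle R) (hcomp : o.Compatible R)

omit hε in
theorem smul_mul_coefficient (a u w : kˣ) (x y t v s : BoundAlg k R) :
    (a • x) * y * ((u⁻¹ * w) • (t * v * s)) = (u⁻¹ • ((a • x) * y * t)) * v * (w • s) := by
  simp only [mul_smul_comm, smul_mul_assoc, mul_assoc, smul_smul]
  congr 1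
  ac_rfl

omit hε in
include hend in
-- If `f_R` exists, the zigzag product is zero because one of its letters has the wrong direction,
-- so the value of the coefficient does not matter.
theorem coefficient_smul_right {t : Letter Q} (ht : o.string.letterAt o.ρ.length = some t) :
    o.coefficient lam o.α.length • (label k R true (some t) * vert k R o.σR.lft *
      label k R false (some o.σR)) = ((o.unitScalar lam (o.β.length + 1 + o.ρ.length))⁻¹ *
      o.weight lam (o.β.length + 1 + o.ρ.length)) • (label k R true (some t) *
      vert k R o.σR.lft * label k R false (some o.σR)) := by
  rw [coefficient, if_pos rfl]
  have hE := hend.endCond_right ht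
  rcases hf : o.fR with _ | f
  · rfl
  · rw [hf] at hE
    cases hE <;> simp [label, *]

omit hε in
include hend in
theorem coefficient_smul_left {t : Letter Q} (ht : o.string.letterAt (-1) = some t) :
    o.coefficient lam (-o.β.length - 1) • (label k R false (some t) * vert k R o.σL.rgt *
      label k R true (some o.σL)) = ((o.unitScalar lam (o.β.length + 1))⁻¹ *
      o.weight lam o.β.length) • (label k R false (some t) *
      vert k R o.σL.rgt * label k R true (some o.σL)) := by
  rw [coefficient, if_neg (by omega), if_pos rfl]
  have hE := hend.endCond_left ht
  rcases hf : o.fL with _ | f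
  · rfl
  · rw [hf] at hE
    have h1 : label k R true (some o.σL) = label k R false (some o.σL.bar) :=
      (label_bar false _).symm
    have h2 : label k R false (some t) = label k R true (some t.bar) := (label_bar true _).symm
    rw [h1, h2]
    generalize t.bar = t' at hE
    generalize o.σL.bar = s' at hE
    cases hE <;> simp [label, *]

include hσ hτ hend hc hR hcomp in
-- From a vertex of the string only `d_P` and the zigzags contribute. Away from the junction the
-- letters of cone and string coincide and have coefficient `1`.
theorem differential_of_gt {i : ℤ} (h : o.α.length < i) {n : ℤ}
    (hi : o.cone.IsVertex i) (hn : o.cone.deg i = n) :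
    Diagram.matMap (o.cone.diagram k R) (o.cone.diagram k R) (o.cone.diagram k R).out n (n + 1)
      (o.cone.el k R n i 1) =
    o.stringReduction k R lam ε (n + 1)
      (Diagram.matMap (o.string.diagram k R) (o.string.diagram k R) (o.string.diagram k R).out
        n (n + 1) (o.string.el k R n (i - o.α.length + o.ρ.length) (ε i • 1))) := by
  have hco : ∀ j : ℤ, o.α.length < j → o.coefficient lam j = 1 := fun j hj => by
    rw [coefficient, if_neg (by omega), if_neg (by omega), if_neg (by omega)]
  have hv := cone_vtx_of_gt hσ hτ hend hc h hi
  rw [StringData.d_el _ ⟨hi, hn⟩, StringData.d_el _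
    ⟨(cone_isVertex_of_gt h).1 hi, by rw [← hn, cone_deg_of_gt hσ hend h]⟩, map_add, ← hv]
  congr 1
  · rw [show i - o.α.length + o.ρ.length + 1 = i + 1 - o.α.length + o.ρ.length by ring,
      stringReduction_of_gt hσ hτ hend hc (by omega), ← cone_letterAt_of_gt _ h,
      ← normalized_right hε rfl, hco i h, one_smul]
  · have hno := normalized_left hε (i := i - 1) rfl 1 (vert k R (o.cone.vtx i))
    rw [sub_add_cancel] at hno
    rcases eq_or_ne (i - 1) o.α.length with e | e
    -- An arrow along `τ_R` ends at the right end of `ρ`; continued by the zigzag along `σ_R` it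
    -- becomes the composed junction letter.
    · have e' : i - o.α.length + o.ρ.length - 1 = o.ρ.length := by omega
      rw [e, cone_letterAt_junction_right, e']
      obtain ⟨t, ht⟩ : ∃ t, o.string.letterAt o.ρ.length = some t := by
        have := (cone_isVertex_of_gt h).1 hi
        rwa [StringData.isVertex_of_pos _ (by omega), e', Option.isSome_iff_exists] at this
      rw [e, cone_letterAt_junction_right, ht, Option.map_some,
        (hend.endCond_right ht).label_true_junctionLetter (string_head_lft hσ hτ ht)] at hno
      rw [ht, Option.map_some,
        (hend.endCond_right ht).label_true_junctionLetter (string_head_lft hσ hτ ht),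
        stringReduction_right hσ hτ hc, ← hno]
      · rw [coefficient_smul_right hend ht, smul_mul_coefficient]
      · intro h0
        rw [mul_assoc, mul_assoc, ← mul_assoc (label k R true _),
          label_mul_label_right hσ hR hτ hend hcomp h0 ht, mul_zero]
    · rw [show i - o.α.length + o.ρ.length - 1 = i - 1 - o.α.length + o.ρ.length by ring,
        stringReduction_of_gt hσ hτ hend hc (by omega), ← cone_letterAt_of_gt _ (by omega),
        ← hno, hco _ (by omega), one_smul]

include hσ hτ hend hc hR hcomp in
theorem differential_of_lt {i : ℤ} (h : i < -o.β.length) {n : ℤ}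
    (hi : o.cone.IsVertex i) (hn : o.cone.deg i = n) :
    Diagram.matMap (o.cone.diagram k R) (o.cone.diagram k R) (o.cone.diagram k R).out n (n + 1)
      (o.cone.el k R n i 1) =
    o.stringReduction k R lam ε (n + 1)
      (Diagram.matMap (o.string.diagram k R) (o.string.diagram k R) (o.string.diagram k R).out
        n (n + 1) (o.string.el k R n (i + o.β.length) (ε i • 1))) := by
  have hco : ∀ j : ℤ, j < -o.β.length - 1 → o.coefficient lam j = 1 := fun j hj => by
    rw [coefficient, if_neg (by omega), if_neg (by omega), if_neg (by omega)]
  have hv := cone_vtx_of_lt hσ hend h hi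
  rw [StringData.d_el _ ⟨hi, hn⟩, StringData.d_el _
    ⟨(cone_isVertex_of_lt h).1 hi, by rw [← hn, cone_deg_of_lt hσ hend h]⟩, map_add, ← hv]
  congr 1
  · have hno := normalized_right hε (i := i) rfl 1 (vert k R (o.cone.vtx i))
    rcases eq_or_ne i (-o.β.length - 1) with e | e
    · have e' : i + o.β.length = -1 := by omega
      obtain ⟨t, ht⟩ : ∃ t, o.string.letterAt (-1) = some t := by
        have := (cone_isVertex_of_lt h).1 hi
        rwa [e', StringData.isVertex_of_neg _ (by omega), Option.isSome_iff_exists] at this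
      have hl : label k R false (o.cone.letterAt i) = label k R false (some t) *
          vert k R o.σL.rgt * label k R true (some o.σL) := by
        have hb : t.rgt = o.σL.rgt := hτ.base_left t ht
        have := (hend.endCond_left ht).label_true_junctionLetter (R := R) (k := k)
          (by simpa using hb)
        rw [e, cone_letterAt_junction_left, ht, Option.map_some, label_bar]
        simpa [label_bar] using this
      rw [hl] at hno ⊢
      rw [e', ht, neg_add_cancel, stringReduction_left hσ hτ hc, ← hno, e,
        coefficient_smul_left hend ht, smul_mul_coefficient, sub_add_cancel]
      intro h0
      rw [mul_assoc, mul_assoc, ← mul_assoc (label k R false _),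
        label_mul_label_left hσ hR hτ hend hcomp h0 ht, mul_zero]
    · rw [show i + o.β.length + 1 = i + 1 + o.β.length by ring,
        stringReduction_of_lt hσ hend (by omega), ← cone_letterAt_of_lt _ (by omega),
        ← hno, hco _ (by omega), one_smul]
  · have hno := normalized_left hε (i := i - 1) rfl 1 (vert k R (o.cone.vtx i))
    rw [sub_add_cancel] at hno
    rw [show i + o.β.length - 1 = i - 1 + o.β.length by ring,
      stringReduction_of_lt hσ hend (by omega), ← cone_letterAt_of_lt _ (by omega),
      ← hno, hco _ (by omega), one_smul]

end Overlap

end Differential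
-- The elimination data and the homotopy equivalence
section Cone

variable {Q : Type u} [Quiver.{u} Q] [Fintype Q] {k : Type u} [Field k]
  {R : Quiver.Total Q → Quiver.Total Q → Prop}

variable (k R) in
/-- The differential of the complex of a string. -/
abbrev StringData.differential (S : StringData Q) (n : ℤ) :
    (S.diagram k R).X n →ₗ[BoundAlg k R] (S.diagram k R).X (n + 1) :=
  Diagram.matMap (S.diagram k R) (S.diagram k R) (S.diagram k R).out n (n + 1)

namespace Overlap

variable {o : Overlap Q} {lam : kˣ} {ε : ℤ → kˣ} {M : Type*} [AddCommMonoid M]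
  [Module (BoundAlg k R) M] {n : ℤ}

theorem cone_hom_ext {g h : (o.cone.diagram k R).X n →ₗ[BoundAlg k R] M}
    (H : ∀ i, o.cone.IsVertex i → o.cone.deg i = n →
      g (o.cone.el k R n i 1) = h (o.cone.el k R n i 1)) : g = h :=
  Diagram.hom_ext (o.cone.diagram k R) H

theorem string_hom_ext {g h : (o.string.diagram k R).X n →ₗ[BoundAlg k R] M}
    (Hlt : ∀ i : ℤ, i < -o.β.length → g (o.string.el k R n (i + o.β.length) 1) =
      h (o.string.el k R n (i + o.β.length) 1))
    (Hmid : ∀ j : ℤ, 0 ≤ j → j ≤ o.ρ.length →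
      g (o.string.el k R n j 1) = h (o.string.el k R n j 1))
    (Hgt : ∀ i : ℤ, o.α.length < i → g (o.string.el k R n (i - o.α.length + o.ρ.length) 1) =
      h (o.string.el k R n (i - o.α.length + o.ρ.length) 1)) : g = h := by
  refine Diagram.hom_ext (o.string.diagram k R) fun (j : ℤ) _ _ => ?_
  change g (o.string.el k R n j 1) = h (o.string.el k R n j 1)
  rcases lt_or_ge j 0 with h0 | h0
  · have := Hlt (j - o.β.length) (by omega)
    rwa [sub_add_cancel] at this
  · rcases le_or_gt j o.ρ.length with h1 | h1
    · exact Hmid j h0 h1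
    · have := Hgt (j - o.ρ.length + o.α.length) (by omega)
      rwa [add_sub_cancel_right, sub_add_cancel] at this

theorem band_hom_ext {g h : (o.band.diagram k R lam).X n →ₗ[BoundAlg k R] M}
    (Hout : ∀ i : ℤ, -o.β.length ≤ i → i ≤ o.α.length →
      g (o.bandEl R lam n (-i) 1) = h (o.bandEl R lam n (-i) 1))
    (Hρ : ∀ j : ℤ, 0 ≤ j → j ≤ o.ρ.length →
      g (o.bandEl R lam n (o.β.length + 1 + j) 1) = h (o.bandEl R lam n (o.β.length + 1 + j) 1)) :
    g = h := by
  refine Diagram.hom_ext (o.band.diagram k R lam) fun (v : ℕ) hv _ => ?_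
  rcases o.exists_of_lt_length hv with ⟨i, h0, h1, rfl⟩ | ⟨j, h0, h1, rfl⟩
  · exact Hout i h0 h1
  · exact Hρ j h0 h1

omit [Fintype Q] in
theorem vertex_cases (o : Overlap Q) (i : ℤ) :
    i < -o.β.length ∨ (-o.β.length ≤ i ∧ i ≤ o.α.length) ∨ o.α.length < i := by
  omega

variable (hσ : IsHomotopyBand R o.band.word) (hτ : o.string.IsHomotopyString R)
  (hend : o.Endpoints) (hc : o.cone.IsHomotopyString R)

variable (k R o lam ε) in
/-- The matrix of `toBand`. -/
abbrev toBandMap (p q : ℤ) :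
    (o.cone.diagram k R).X p →ₗ[BoundAlg k R] (o.band.diagram k R lam).X q :=
  Diagram.matMap (o.cone.diagram k R) (o.band.diagram k R lam) (o.toBand k R ε) p q

variable (k R o lam ε) in
/-- The matrix of `ofBand`. -/
abbrev ofBandMap (p q : ℤ) :
    (o.band.diagram k R lam).X p →ₗ[BoundAlg k R] (o.cone.diagram k R).X q :=
  Diagram.matMap (o.band.diagram k R lam) (o.cone.diagram k R) (o.ofBand k R ε) p q

variable (k R o ε) in
/-- The matrix of `toString`. -/
abbrev toStringMap (n : ℤ) :
    (o.cone.diagram k R).X n →ₗ[BoundAlg k R] (o.string.diagram k R).X n :=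
  Diagram.matMap (o.cone.diagram k R) (o.string.diagram k R) (o.toString k R ε) n n

variable (k R o ε) in
/-- The matrix of `ofString`. -/
abbrev ofStringMap (n : ℤ) :
    (o.string.diagram k R).X n →ₗ[BoundAlg k R] (o.cone.diagram k R).X n :=
  Diagram.matMap (o.string.diagram k R) (o.cone.diagram k R) (o.ofString k R ε) n n

variable (k R o lam) in
/-- The matrix of `overlapInv`. -/
abbrev overlapInvMap (n : ℤ) :
    (o.string.diagram k R).X n →ₗ[BoundAlg k R] (o.band.diagram k R lam).X n :=
  Diagram.matMap (o.string.diagram k R) (o.band.diagram k R lam) (o.overlapInv k R lam) n n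

variable (k R o lam) in
/-- The matrix of the graph map. -/
abbrev componentsMap (n : ℤ) :
    (o.band.diagram k R lam).X n →ₗ[BoundAlg k R] (o.string.diagram k R).X n :=
  Diagram.matMap (o.band.diagram k R lam) (o.string.diagram k R) (o.components k R lam) n n

variable (k R o lam) in
/-- The differential of the band complex. -/
abbrev bandDifferential (n : ℤ) :
    (o.band.diagram k R lam).X n →ₗ[BoundAlg k R] (o.band.diagram k R lam).X (n + 1) :=
  Diagram.matMap (o.band.diagram k R lam) (o.band.diagram k R lam)
    (o.band.diagram k R lam).out n (n + 1)

include hσ hτ hend hc in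
theorem ofBand_toBand_add (n : ℤ) :
    o.ofBandMap k R lam ε (n + 1) n ∘ₗ o.toBandMap k R lam ε n (n + 1) +
      o.ofStringMap k R ε n ∘ₗ o.toStringMap k R ε n = LinearMap.id := by
  refine cone_hom_ext (o := o) (k := k) (R := R) fun i _ _ => ?_
  rw [LinearMap.add_apply, LinearMap.comp_apply, LinearMap.comp_apply, LinearMap.id_apply]
  rcases o.vertex_cases i with h | ⟨h0, h1⟩ | h
  · rw [toBand_el_eq_zero (Or.inl h), map_zero, zero_add, toString_el_of_lt hσ hend h,
      ofString_el_of_lt hσ hend h, inv_smul_smul]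
  · rw [toString_el_mid h0 h1, map_zero, add_zero, toBand_el hσ hc h0 h1, ofBand_el hσ hc h0 h1,
      inv_smul_smul]
  · rw [toBand_el_eq_zero (Or.inr h), map_zero, zero_add, toString_el_of_gt hσ hτ hend hc h,
      ofString_el_of_gt hσ hτ hend hc h, inv_smul_smul]

include hσ hτ hend hc in
theorem overlapInv_toString (n : ℤ) : o.overlapInvMap k R lam n ∘ₗ o.toStringMap k R ε n = 0 := by
  refine cone_hom_ext (o := o) (k := k) (R := R) fun i _ _ => ?_
  rw [LinearMap.comp_apply, LinearMap.zero_apply]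
  rcases o.vertex_cases i with h | ⟨h0, h1⟩ | h
  · rw [toString_el_of_lt hσ hend h, overlapInv_el_eq_zero (by omega)]
  · rw [toString_el_mid h0 h1, map_zero]
  · rw [toString_el_of_gt hσ hτ hend hc h, overlapInv_el_eq_zero (by omega)]

include hσ hτ in
theorem ofBand_overlapInv (n : ℤ) :
    o.ofBandMap k R lam ε (n + 1) n ∘ₗ o.overlapInvMap k R lam (n + 1) = 0 := by
  refine string_hom_ext (o := o) (k := k) (R := R) (fun i h => ?_)
      (fun j h0 h1 => ?_) fun i h => ?_ <;>
    rw [LinearMap.comp_apply, LinearMap.zero_apply]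
  · rw [overlapInv_el_eq_zero (by omega), map_zero]
  · rw [overlapInv_el hσ hτ h0 h1, ofBand_el_ρ h0 h1]
  · rw [overlapInv_el_eq_zero (by omega), map_zero]

/-- The components `f_L` and `f_R` end at the vertices `-1` and `|ρ| + 1` of the string, just
outside the overlap. -/
theorem overlapInv_components_el_mid (hend : o.Endpoints) {i : ℤ} (h0 : -o.β.length ≤ i)
    (h1 : i ≤ o.α.length) (n : ℤ) (x : BoundAlg k R) :
    o.overlapInvMap k R lam n (o.componentsMap k R lam n (o.bandEl R lam n (-i) x)) = 0 := by
  by_cases hn : o.band.deg (o.bandVertex (-i)) = n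
  · rw [components_el_mid hend h0 h1 hn]
    refine (map_add _ _ _).trans ?_
    refine (congrArg₂ (· + ·) ?_ ?_).trans (add_zero _) <;> split_ifs
    · exact overlapInv_el_eq_zero (by omega) _ _ _
    · exact map_zero _
    · exact overlapInv_el_eq_zero (by omega) _ _ _
    · exact map_zero _
  · rw [bandEl_eq_zero hn, map_zero, map_zero]

include hσ hτ hend hc in
theorem toBand_ofBand_add (n : ℤ) :
    o.toBandMap k R lam ε n (n + 1) ∘ₗ o.ofBandMap k R lam ε (n + 1) n +
      o.overlapInvMap k R lam (n + 1) ∘ₗ o.componentsMap k R lam (n + 1) = LinearMap.id := by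
  refine band_hom_ext (o := o) (k := k) (R := R) (lam := lam) (fun i h0 h1 => ?_)
      fun j h0 h1 => ?_ <;>
    rw [LinearMap.add_apply, LinearMap.comp_apply, LinearMap.comp_apply, LinearMap.id_apply]
  · rw [overlapInv_components_el_mid hend h0 h1, add_zero, ofBand_el hσ hc h0 h1,
      toBand_el hσ hc h0 h1, smul_inv_smul]
  · rw [ofBand_el_ρ h0 h1, map_zero, zero_add, components_el_ρ hσ hτ h0 h1,
      overlapInv_el hσ hτ h0 h1, inv_smul_smul]

include hσ hτ hend hc in
theorem toString_ofString_add (n : ℤ) :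
    o.toStringMap k R ε n ∘ₗ o.ofStringMap k R ε n +
      o.componentsMap k R lam n ∘ₗ o.overlapInvMap k R lam n = LinearMap.id := by
  refine string_hom_ext (o := o) (k := k) (R := R) (fun i h => ?_)
      (fun j h0 h1 => ?_) fun i h => ?_ <;>
    rw [LinearMap.add_apply, LinearMap.comp_apply, LinearMap.comp_apply, LinearMap.id_apply]
  · rw [overlapInv_el_eq_zero (by omega), map_zero, add_zero, ofString_el_of_lt hσ hend h,
      toString_el_of_lt hσ hend h, smul_inv_smul]
  · rw [ofString_el_ρ h0 h1, map_zero, zero_add, overlapInv_el hσ hτ h0 h1,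
      components_el_ρ hσ hτ h0 h1, smul_inv_smul]
  · rw [overlapInv_el_eq_zero (by omega), map_zero, add_zero, ofString_el_of_gt hσ hτ hend hc h,
      toString_el_of_gt hσ hτ hend hc h, smul_inv_smul]

include hσ hc in
theorem toString_ofBand (n : ℤ) : o.toStringMap k R ε n ∘ₗ o.ofBandMap k R lam ε (n + 1) n = 0 := by
  refine band_hom_ext (o := o) (k := k) (R := R) (lam := lam) (fun i h0 h1 => ?_)
      fun j h0 h1 => ?_ <;>
    rw [LinearMap.comp_apply, LinearMap.zero_apply]
  · rw [ofBand_el hσ hc h0 h1, toString_el_mid h0 h1]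
  · rw [ofBand_el_ρ h0 h1, map_zero]

include hσ hτ hend hc in
theorem toBand_ofString (n : ℤ) : o.toBandMap k R lam ε n (n + 1) ∘ₗ o.ofStringMap k R ε n = 0 := by
  refine string_hom_ext (o := o) (k := k) (R := R) (fun i h => ?_)
      (fun j h0 h1 => ?_) fun i h => ?_ <;>
    rw [LinearMap.comp_apply, LinearMap.zero_apply]
  · rw [ofString_el_of_lt hσ hend h, toBand_el_eq_zero (Or.inl h)]
  · rw [ofString_el_ρ h0 h1, map_zero]
  · rw [ofString_el_of_gt hσ hτ hend hc h, toBand_el_eq_zero (Or.inr h)]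

include hσ hτ hend hc in
theorem cone_differential (hε : o.Normalizes lam ε) (hR : IsGentle R) (hcomp : o.Compatible R)
    {n i : ℤ} (hi : o.cone.IsVertex i) (hn : o.cone.deg i = n) :
    o.cone.differential k R n (o.cone.el k R n i 1) =
      -(o.ofBandMap k R lam ε (n + 1 + 1) (n + 1) (o.bandDifferential k R lam (n + 1)
        (o.toBandMap k R lam ε n (n + 1) (o.cone.el k R n i 1)))) +
      o.ofStringMap k R ε (n + 1) (o.componentsMap k R lam (n + 1)
        (o.toBandMap k R lam ε n (n + 1) (o.cone.el k R n i 1))) +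
      o.stringReduction k R lam ε (n + 1) (o.string.differential k R n
        (o.toStringMap k R ε n (o.cone.el k R n i 1))) := by
  rcases o.vertex_cases i with h | ⟨h0, h1⟩ | h
  · rw [toBand_el_eq_zero (Or.inl h), map_zero, map_zero, map_zero, map_zero, neg_zero, zero_add,
      zero_add, toString_el_of_lt hσ hend h, differential_of_lt hσ hτ hend hc hε hR hcomp h hi hn]
  · rw [toString_el_mid h0 h1, map_zero, map_zero, add_zero, toBand_el hσ hc h0 h1,
      differential_mid hσ hend hc hε h0 h1 hn hτ]
  · rw [toBand_el_eq_zero (Or.inr h), map_zero, map_zero, map_zero, map_zero, neg_zero, zero_add,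
      zero_add, toString_el_of_gt hσ hτ hend hc h,
      differential_of_gt hσ hτ hend hc hε hR hcomp h hi hn]

/-- The mapping cone of a compatibly oriented graph map from a band complex to a string complex is
homotopy equivalent to a string complex. -/
theorem nonempty_homotopyEquiv (hR : IsGentle R) (hσ : o.band.IsBand R)
    (hτ : o.string.IsHomotopyString R) (hend : o.Endpoints) (hcomp : o.Compatible R)
    (hc : o.cone.IsHomotopyString R)
    (f : bandComplex k R o.band lam hσ ⟶ stringComplex k R o.string hτ) (hf : o.IsGraphMap f) :
    Nonempty (HomotopyEquiv (CochainComplex.mappingCone f) (stringComplex k R o.cone hc)) := by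
  obtain ⟨ε, hε⟩ := o.exists_normalizes lam
  refine nonempty_homotopyEquiv_mappingCone f
    (fun n => ModuleCat.ofHom (o.overlapInvMap k R lam n))
    (fun p q => ModuleCat.ofHom (o.toBandMap k R lam ε p q))
    (fun p q => ModuleCat.ofHom (o.ofBandMap k R lam ε p q))
    (fun n => ModuleCat.ofHom (o.toStringMap k R ε n))
    (fun n => ModuleCat.ofHom (o.ofStringMap k R ε n))
    (fun n => ModuleCat.hom_ext (ofBand_toBand_add hσ.band hτ hend hc n))
    (fun n => ModuleCat.hom_ext (overlapInv_toString hσ.band hτ hend hc n))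
    (fun n => ModuleCat.hom_ext (ofBand_overlapInv hσ.band hτ n))
    (fun n => ?_) (fun n => ?_)
    (fun n => ModuleCat.hom_ext (toString_ofBand hσ.band hc n))
    (fun n => ModuleCat.hom_ext (toBand_ofString hσ.band hτ hend hc n)) (fun n => ?_)
  · rw [hf]
    exact ModuleCat.hom_ext (toBand_ofBand_add hσ.band hτ hend hc n)
  · rw [hf]
    exact ModuleCat.hom_ext (toString_ofString_add hσ.band hτ hend hc n)
  · have h1 : ∀ n, (stringComplex k R o.cone hc).d n (n + 1) =
        ModuleCat.ofHom (o.cone.differential k R n) := Diagram.complex_d _ _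
    have h2 : ∀ n, (stringComplex k R o.string hτ).d n (n + 1) =
        ModuleCat.ofHom (o.string.differential k R n) := Diagram.complex_d _ _
    have h3 : ∀ n, (bandComplex k R o.band lam hσ).d n (n + 1) =
        ModuleCat.ofHom (o.bandDifferential k R lam n) := Diagram.complex_d _ _
    rw [hf, h1, h2, h3]
    refine ModuleCat.hom_ext (cone_hom_ext (o := o) (k := k) (R := R) fun i hi hn => ?_)
    -- `stringReduction` bundles the last two terms of the elimination formula, whence the
    -- reassociation.
    exact (cone_differential hσ.band hτ hend hc hε hR hcomp hi hn).trans (add_assoc _ _ _).symm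

end Overlap

end Cone
end Gentle

end

/-! ### Passage to a Morita equivalent algebra -/

theorem mainTheorem8
    {k : Type u} [Field k] [IsAlgClosed k]
    {Q : Type u} [Fintype Q] [Quiver.{u} Q] [Finite (Quiver.Total Q)]
    (R : Quiver.Total Q → Quiver.Total Q → Prop) (hR : Gentle.IsGentle R)
    {Λ : Type u} [Ring Λ] [Algebra k Λ] (E : MoritaEquivalence k (Gentle.BoundAlg k R) Λ)
    (o : Gentle.Overlap Q) (lam : kˣ)
    (hσ : o.band.IsBand R) (hτ : o.string.IsHomotopyString R)
    (hend : o.Endpoints) (hcomp : o.Compatible R)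
    (f : Gentle.bandComplex k R o.band lam hσ ⟶ Gentle.stringComplex k R o.string hτ)
    (hf : o.IsGraphMap f) :
    ∃ hc : o.cone.IsHomotopyString R,
      Nonempty
        ((HomotopyCategory.quotient (ModuleCat.{u} Λ) (ComplexShape.up ℤ)).obj
            (CochainComplex.mappingCone
              ((E.eqv.functor.mapHomologicalComplex (ComplexShape.up ℤ)).map f)) ≅
          (HomotopyCategory.quotient (ModuleCat.{u} Λ) (ComplexShape.up ℤ)).obj
            ((E.eqv.functor.mapHomologicalComplex (ComplexShape.up ℤ)).obj
              (Gentle.stringComplex k R o.cone hc))) := by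
  have hc := Gentle.Overlap.cone_isHomotopyString hσ.band hR hτ hend hcomp
  obtain ⟨h⟩ := Gentle.Overlap.nonempty_homotopyEquiv hR hσ hτ hend hcomp hc f hf
  -- The functor of the Morita equivalence is additive, so it commutes with mapping cones and
  -- preserves homotopy equivalences.
  exact ⟨hc, ⟨(HomotopyCategory.quotient _ _).mapIso
      (CochainComplex.mappingCone.mapHomologicalComplexIso f E.eqv.functor).symm ≪≫
    HomotopyCategory.isoOfHomotopyEquiv (E.eqv.functor.mapHomotopyEquiv h)⟩⟩
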